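/- All algebras are associative unital $\mathbf C$-algebras. For an algebra $R$ let $R^{\mathrm{Lie}}_1=R$ and $R^{\mathrm{Lie}}_{m+1}=[R,R^{\mathrm{Lie}}_m]$ (span of commutators), and let $F^dR=\sum_m\sum_{i_1+\dots+i_m-m=d}R\cdot R^{\mathrm{Lie}}_{i_1}\cdot R\cdots R\cdot R^{\mathrm{Lie}}_{i_m}\cdot R$ be the NC-filtration. Then $R_{ab}=R/F^1R$ is commutative, and $\mathrm{gr}_F(R)=\bigoplus_{i\ge 0}F^iR/F^{i+1}R$ is a graded Poisson algebra with product and bracket induced by $xy$ and by $xy-yx\in F^{i+j+1}R$ for $x\in F^iR$, $y\in F^jR$. Let $\mathcal N_d$ be the category of algebras with $F^{d+1}=0$. The algebra $R$ is called $d$-smooth if it is finitely generated, lies in $\mathcal N_d$, and for every surjection $\Lambda'\to\Lambda$ in $\mathcal N_d$ with nilpotent kernel the map $\mathrm{Hom}(R,\Lambda')\to\mathrm{Hom}(R,\Lambda)$ is surjective. For a commutative algebra $A$ let $P(A)$ be its Poisson envelope, i.e. the value at $A$ of the left adjoint of the forgetful functor from Poisson algebras to commutative algebras; let $P^i(A)\subset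 P(A)$ be the span of the expressions in elements of $A$, built by products and Poisson brackets, with exactly $i$ instances of the bracket, and let $P^{\ge n}(A)=\sum_{i\ge n}P^i(A)$, which is a Poisson ideal. For an $A$-module $M$ let $\mathrm{Lie}_A(M)=\bigoplus_{k\ge1}\mathrm{Lie}^k_A(M)$ be the free Lie algebra over $A$ generated by $M$, and let $Q^i_A(M)$ be the degree $i$ part of the symmetric algebra over $A$ of $\bigoplus_{k\ge 2}\mathrm{Lie}^k_A(M)$, where $\mathrm{Lie}^k_A(M)$ is given degree $k-1$. **Theorem.** Let $d\ge 0$, let $R$ be a $d$-smooth algebra and $A=R_{ab}$. Then there is a unique isomorphism of Poisson algebras $P(A)/P^{\ge d+1}(A)\to\mathrm{gr}_F(R)$ which is compatible with the canonical maps from $A$ (the map $A\to P(A)$ and the identification $A=\mathrm{gr}^0_F(R)$). It respects the gradings: it maps the image of $P^i(A)$ onto $\mathrm{gr}^i_F(R)$ for every $i\ge 0$. Moreover, for every $0\le i\le d$ there is an isomorphism of $A$-modules $\mathrm{gr}^i_F(R)\simeq Q^i_A(\Omega^1_A)$. -/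

import Mathlib

universe u

namespace NCGeom

/-! ## Poisson algebras -/

/-- A Poisson algebra over `ℂ`: a commutative algebra with an anticommutative bilinear bracket
which satisfies the Jacobi identity and is a derivation in each argument. -/
class PoissonAlgebra (P : Type u) [CommRing P] [Algebra ℂ P] where
  bracket : P →ₗ[ℂ] P →ₗ[ℂ] P
  antisymm : ∀ x y : P, bracket x y = -bracket y x
  jacobi : ∀ x y z : P,
    bracket x (bracket y z) + bracket y (bracket z x) + bracket z (bracket x y) = 0
  leibniz : ∀ x y z : P, bracket x (y * z) = bracket x y * z + y * bracket x z

/-- The Poisson bracket. -/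
def pb {P : Type u} [CommRing P] [Algebra ℂ P] [PoissonAlgebra P] (x y : P) : P :=
  PoissonAlgebra.bracket x y

/-- A Poisson ideal of a Poisson algebra: an ideal stable under bracketing with any element. -/
def IsPoissonIdeal {P : Type u} [CommRing P] [Algebra ℂ P] [PoissonAlgebra P]
    (I : Ideal P) : Prop :=
  ∀ x y : P, y ∈ I → pb x y ∈ I

/-- The bracket on the quotient by a Poisson ideal: `{x mod I, y mod I} = {x, y} mod I`. -/
def quotientBracket {P : Type u} [CommRing P] [Algebra ℂ P] [PoissonAlgebra P]
    (I : Ideal P) (hI : IsPoissonIdeal I) (x y : P ⧸ I) : P ⧸ I :=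
  Quotient.liftOn₂ x y (fun x y => Ideal.Quotient.mk I (pb x y)) (by
    intro x y x' y' hx hy
    have hx : x - x' ∈ I := (Submodule.quotientRel_def I).1 hx
    have hy : y - y' ∈ I := (Submodule.quotientRel_def I).1 hy
    refine Ideal.Quotient.eq.2 ?_
    have h : pb x y - pb x' y' = pb x (y - y') - pb y' (x - x') := by
      simp only [pb, map_sub]
      rw [PoissonAlgebra.antisymm y' x, PoissonAlgebra.antisymm y' x']
      abel
    rw [h]
    exact I.sub_mem (hI _ _ hy) (hI _ _ hx))

/-- The Poisson algebra structure on the quotient by a Poisson ideal. -/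
@[reducible] def PoissonAlgebra.quotient {P : Type u} [CommRing P] [Algebra ℂ P]
    [PoissonAlgebra P] (I : Ideal P) (hI : IsPoissonIdeal I) : PoissonAlgebra (P ⧸ I) where
  bracket := LinearMap.mk₂ ℂ (quotientBracket I hI)
    (fun x y z => by
      obtain ⟨x, rfl⟩ := Ideal.Quotient.mk_surjective x
      obtain ⟨y, rfl⟩ := Ideal.Quotient.mk_surjective y
      obtain ⟨z, rfl⟩ := Ideal.Quotient.mk_surjective z
      exact congrArg (Ideal.Quotient.mk I) (LinearMap.map_add₂ (PoissonAlgebra.bracket) x y z))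
    (fun c x y => by
      obtain ⟨x, rfl⟩ := Ideal.Quotient.mk_surjective x
      obtain ⟨y, rfl⟩ := Ideal.Quotient.mk_surjective y
      exact congrArg (Ideal.Quotient.mk I) (LinearMap.map_smul₂ (PoissonAlgebra.bracket) c x y))
    (fun x y z => by
      obtain ⟨x, rfl⟩ := Ideal.Quotient.mk_surjective x
      obtain ⟨y, rfl⟩ := Ideal.Quotient.mk_surjective y
      obtain ⟨z, rfl⟩ := Ideal.Quotient.mk_surjective z
      exact congrArg (Ideal.Quotient.mk I) (map_add (PoissonAlgebra.bracket x) y z))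
    (fun c x y => by
      obtain ⟨x, rfl⟩ := Ideal.Quotient.mk_surjective x
      obtain ⟨y, rfl⟩ := Ideal.Quotient.mk_surjective y
      exact congrArg (Ideal.Quotient.mk I) (map_smul (PoissonAlgebra.bracket x) c y))
  antisymm x y := by
    obtain ⟨x, rfl⟩ := Ideal.Quotient.mk_surjective x
    obtain ⟨y, rfl⟩ := Ideal.Quotient.mk_surjective y
    exact congrArg (Ideal.Quotient.mk I) (PoissonAlgebra.antisymm x y)
  jacobi x y z := by
    obtain ⟨x, rfl⟩ := Ideal.Quotient.mk_surjective x
    obtain ⟨y, rfl⟩ := Ideal.Quotient.mk_surjective y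
    obtain ⟨z, rfl⟩ := Ideal.Quotient.mk_surjective z
    exact congrArg (Ideal.Quotient.mk I) (PoissonAlgebra.jacobi x y z)
  leibniz x y z := by
    obtain ⟨x, rfl⟩ := Ideal.Quotient.mk_surjective x
    obtain ⟨y, rfl⟩ := Ideal.Quotient.mk_surjective y
    obtain ⟨z, rfl⟩ := Ideal.Quotient.mk_surjective z
    exact congrArg (Ideal.Quotient.mk I) (PoissonAlgebra.leibniz x y z)

/-! ## The Poisson envelope of a commutative algebra -/

/-- Formal expressions in the elements of `A`: sums, products and Poisson brackets. -/
inductive EnvTerm (A : Type u) : Type u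
  | of (a : A)
  | add (x y : EnvTerm A)
  | mul (x y : EnvTerm A)
  | bracket (x y : EnvTerm A)

/-- The identities imposed on formal expressions: those of a commutative Poisson `ℂ`-algebra, and
those saying that `A` maps to it by a homomorphism of `ℂ`-algebras. (The scalar `c : ℂ` acts as
multiplication by `of (algebraMap ℂ A c)`, the additive inverse of `x` is `of (-1) * x`.) -/
inductive EnvRel (A : Type u) [CommRing A] [Algebra ℂ A] : EnvTerm A → EnvTerm A → Prop
  | of_add (a b : A) : EnvRel A (.of (a + b)) (.add (.of a) (.of b))
  | of_mul (a b : A) : EnvRel A (.of (a * b)) (.mul (.of a) (.of b))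
  | add_assoc (x y z : EnvTerm A) : EnvRel A (.add (.add x y) z) (.add x (.add y z))
  | add_comm (x y : EnvTerm A) : EnvRel A (.add x y) (.add y x)
  | zero_add (x : EnvTerm A) : EnvRel A (.add (.of 0) x) x
  | zero_mul (x : EnvTerm A) : EnvRel A (.mul (.of 0) x) (.of 0)
  | one_mul (x : EnvTerm A) : EnvRel A (.mul (.of 1) x) x
  | mul_assoc (x y z : EnvTerm A) : EnvRel A (.mul (.mul x y) z) (.mul x (.mul y z))
  | mul_comm (x y : EnvTerm A) : EnvRel A (.mul x y) (.mul y x)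
  | add_mul (x y z : EnvTerm A) : EnvRel A (.mul (.add x y) z) (.add (.mul x z) (.mul y z))
  | bracket_add (x y z : EnvTerm A) :
      EnvRel A (.bracket x (.add y z)) (.add (.bracket x y) (.bracket x z))
  | bracket_smul (c : ℂ) (x y : EnvTerm A) :
      EnvRel A (.bracket x (.mul (.of (algebraMap ℂ A c)) y))
        (.mul (.of (algebraMap ℂ A c)) (.bracket x y))
  | antisymm (x y : EnvTerm A) : EnvRel A (.bracket x y) (.mul (.of (-1)) (.bracket y x))
  | jacobi (x y z : EnvTerm A) :
      EnvRel A (.add (.add (.bracket x (.bracket y z)) (.bracket y (.bracket z x)))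
        (.bracket z (.bracket x y))) (.of 0)
  | leibniz (x y z : EnvTerm A) :
      EnvRel A (.bracket x (.mul y z)) (.add (.mul (.bracket x y) z) (.mul y (.bracket x z)))
  | add_left {x x' : EnvTerm A} (y : EnvTerm A) (h : EnvRel A x x') :
      EnvRel A (.add x y) (.add x' y)
  | add_right (x : EnvTerm A) {y y' : EnvTerm A} (h : EnvRel A y y') :
      EnvRel A (.add x y) (.add x y')
  | mul_left {x x' : EnvTerm A} (y : EnvTerm A) (h : EnvRel A x x') :
      EnvRel A (.mul x y) (.mul x' y)
  | mul_right (x : EnvTerm A) {y y' : EnvTerm A} (h : EnvRel A y y') :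
      EnvRel A (.mul x y) (.mul x y')
  | bracket_left {x x' : EnvTerm A} (y : EnvTerm A) (h : EnvRel A x x') :
      EnvRel A (.bracket x y) (.bracket x' y)
  | bracket_right (x : EnvTerm A) {y y' : EnvTerm A} (h : EnvRel A y y') :
      EnvRel A (.bracket x y) (.bracket x y')

/-- The Poisson envelope `P(A)` of a commutative `ℂ`-algebra `A`: the universal Poisson algebra
with a homomorphism of commutative algebras from `A`. -/
def Env (A : Type u) [CommRing A] [Algebra ℂ A] : Type u := Quot (EnvRel A)

namespace Env

section

variable {A : Type u} [CommRing A] [Algebra ℂ A]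

/-- The class of an expression. -/
def mk (t : EnvTerm A) : Env A := Quot.mk _ t

/-- The class of an element of `A`. -/
def of (a : A) : Env A := mk (.of a)

instance : Add (Env A) := ⟨Quot.map₂ .add (fun x _ _ h => .add_right x h) fun _ _ y h => .add_left y h⟩
instance : Mul (Env A) := ⟨Quot.map₂ .mul (fun x _ _ h => .mul_right x h) fun _ _ y h => .mul_left y h⟩

/-- The bracket of two classes. -/
def br : Env A → Env A → Env A :=
  Quot.map₂ .bracket (fun x _ _ h => .bracket_right x h) fun _ _ y h => .bracket_left y h

theorem of_add (a b : A) : of (a + b) = of a + of b := Quot.sound (.of_add a b)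
theorem of_mul (a b : A) : of (a * b) = of a * of b := Quot.sound (.of_mul a b)

protected theorem add_assoc' (x y z : Env A) : x + y + z = x + (y + z) := by
  induction x using Quot.ind; induction y using Quot.ind; induction z using Quot.ind
  exact Quot.sound (.add_assoc _ _ _)
protected theorem add_comm' (x y : Env A) : x + y = y + x := by
  induction x using Quot.ind; induction y using Quot.ind
  exact Quot.sound (.add_comm _ _)
protected theorem zero_add' (x : Env A) : of 0 + x = x := by
  induction x using Quot.ind
  exact Quot.sound (.zero_add _)
protected theorem zero_mul' (x : Env A) : of 0 * x = of 0 := by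
  induction x using Quot.ind
  exact Quot.sound (.zero_mul _)
protected theorem one_mul' (x : Env A) : of 1 * x = x := by
  induction x using Quot.ind
  exact Quot.sound (.one_mul _)
protected theorem mul_assoc' (x y z : Env A) : x * y * z = x * (y * z) := by
  induction x using Quot.ind; induction y using Quot.ind; induction z using Quot.ind
  exact Quot.sound (.mul_assoc _ _ _)
protected theorem mul_comm' (x y : Env A) : x * y = y * x := by
  induction x using Quot.ind; induction y using Quot.ind
  exact Quot.sound (.mul_comm _ _)
protected theorem add_mul' (x y z : Env A) : (x + y) * z = x * z + y * z := by
  induction x using Quot.ind; induction y using Quot.ind; induction z using Quot.ind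
  exact Quot.sound (.add_mul _ _ _)

theorem br_add (x y z : Env A) : br x (y + z) = br x y + br x z := by
  induction x using Quot.ind; induction y using Quot.ind; induction z using Quot.ind
  exact Quot.sound (.bracket_add _ _ _)
theorem br_smul (c : ℂ) (x y : Env A) :
    br x (of (algebraMap ℂ A c) * y) = of (algebraMap ℂ A c) * br x y := by
  induction x using Quot.ind; induction y using Quot.ind
  exact Quot.sound (.bracket_smul _ _ _)
theorem br_antisymm (x y : Env A) : br x y = of (-1) * br y x := by
  induction x using Quot.ind; induction y using Quot.ind
  exact Quot.sound (.antisymm _ _)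
theorem br_jacobi (x y z : Env A) : br x (br y z) + br y (br z x) + br z (br x y) = of 0 := by
  induction x using Quot.ind; induction y using Quot.ind; induction z using Quot.ind
  exact Quot.sound (.jacobi _ _ _)
theorem br_leibniz (x y z : Env A) : br x (y * z) = br x y * z + y * br x z := by
  induction x using Quot.ind; induction y using Quot.ind; induction z using Quot.ind
  exact Quot.sound (.leibniz _ _ _)

instance : Zero (Env A) := ⟨of 0⟩
instance : One (Env A) := ⟨of 1⟩
instance : Neg (Env A) := ⟨fun x => of (-1) * x⟩

instance : CommRing (Env A) where
  nsmul := nsmulRec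
  zsmul := zsmulRec
  add_assoc := Env.add_assoc'
  add_comm := Env.add_comm'
  zero_add := Env.zero_add'
  add_zero x := (Env.add_comm' x _).trans (Env.zero_add' x)
  neg_add_cancel x := by
    have h : of (-1) * x + of 1 * x = of 0 := by
      rw [← Env.add_mul', ← of_add, neg_add_cancel, Env.zero_mul']
    rwa [Env.one_mul'] at h
  mul_assoc := Env.mul_assoc'
  mul_comm := Env.mul_comm'
  one_mul := Env.one_mul'
  mul_one x := (Env.mul_comm' x _).trans (Env.one_mul' x)
  zero_mul := Env.zero_mul'
  mul_zero x := (Env.mul_comm' x _).trans (Env.zero_mul' x)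
  right_distrib := Env.add_mul'
  left_distrib x y z := by
    rw [Env.mul_comm', Env.add_mul', Env.mul_comm' y, Env.mul_comm' z]

instance : Algebra ℂ (Env A) :=
  RingHom.toAlgebra
    { toFun := fun c => of (algebraMap ℂ A c)
      map_one' := by rw [map_one]; rfl
      map_zero' := by rw [map_zero]; rfl
      map_mul' := fun x y => by rw [map_mul, of_mul]
      map_add' := fun x y => by rw [map_add, of_add] }

theorem smul_eq (c : ℂ) (x : Env A) : c • x = of (algebraMap ℂ A c) * x := rfl

theorem of_neg_one_mul (x : Env A) : of (-1) * x = -x := rfl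

/-- The canonical homomorphism `A → P(A)`. -/
def ι (A : Type u) [CommRing A] [Algebra ℂ A] : A →ₐ[ℂ] Env A where
  toFun := of
  map_one' := rfl
  map_zero' := rfl
  map_mul' := of_mul
  map_add' := of_add
  commutes' _ := rfl

instance : PoissonAlgebra (Env A) where
  bracket := LinearMap.mk₂ ℂ br
    (fun x y z => by
      rw [br_antisymm, br_add, br_antisymm x, br_antisymm y]
      exact mul_add _ _ _)
    (fun c x y => by
      rw [br_antisymm, smul_eq, br_smul, br_antisymm x, smul_eq]
      exact mul_left_comm _ _ _)
    br_add
    (fun c x y => by rw [smul_eq, br_smul, smul_eq])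
  antisymm := br_antisymm
  jacobi := br_jacobi
  leibniz := br_leibniz

/-- `IsExpr d x`: the element `x` of `P(A)` is (the image of) a monomial expression, built from
elements of `A` by products and Poisson brackets, with exactly `d` instances of the bracket. -/
inductive IsExpr : ℕ → Env A → Prop
  | of (a : A) : IsExpr 0 (ι A a)
  | mul {i j : ℕ} {x y : Env A} (hx : IsExpr i x) (hy : IsExpr j y) : IsExpr (i + j) (x * y)
  | pb {i j : ℕ} {x y : Env A} (hx : IsExpr i x) (hy : IsExpr j y) :
      IsExpr (i + j + 1) (pb x y)

end

section

variable (A : Type u) [CommRing A] [Algebra ℂ A]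

/-- The graded component `P^d(A)`, spanned by the expressions with `d` brackets. -/
def deg (d : ℕ) : Submodule ℂ (Env A) := Submodule.span ℂ {x | IsExpr d x}

/-- `P^{≥ n}(A)`, the sum of the components `P^i(A)` with `i ≥ n`, as a subspace. -/
def geSpace (n : ℕ) : Submodule ℂ (Env A) := ⨆ (i : ℕ) (_ : n ≤ i), deg A i

variable {A}

theorem geSpace_eq_span (n : ℕ) :
    geSpace A n = Submodule.span ℂ {x | ∃ i, n ≤ i ∧ IsExpr i x} := by
  refine le_antisymm (iSup₂_le fun i hi => Submodule.span_mono fun x hx => ⟨i, hi, hx⟩)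
    (Submodule.span_le.2 ?_)
  rintro x ⟨i, hi, hx⟩
  exact (le_iSup₂_of_le (f := fun i (_ : n ≤ i) => deg A i) i hi le_rfl) (Submodule.subset_span hx)

theorem bilin_span {S T : Set (Env A)} {K : Submodule ℂ (Env A)}
    (f : Env A →ₗ[ℂ] Env A →ₗ[ℂ] Env A) (h : ∀ s ∈ S, ∀ t ∈ T, f s t ∈ K)
    {x y : Env A} (hx : x ∈ Submodule.span ℂ S) (hy : y ∈ Submodule.span ℂ T) : f x y ∈ K := by
  have hle : Submodule.map₂ f (Submodule.span ℂ S) (Submodule.span ℂ T) ≤ K := by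
    rw [Submodule.map₂_span_span, Submodule.span_le]
    rintro _ ⟨s, hs, t, ht, rfl⟩
    exact h s hs t ht
  exact hle (Submodule.apply_mem_map₂ f hx hy)

theorem mul_mem_geSpace {m n : ℕ} {x y : Env A} (hx : x ∈ geSpace A m) (hy : y ∈ geSpace A n) :
    x * y ∈ geSpace A (m + n) := by
  rw [geSpace_eq_span] at hx hy ⊢
  refine bilin_span (LinearMap.mul ℂ (Env A)) ?_ hx hy
  rintro s ⟨i, hi, hs⟩ t ⟨j, hj, ht⟩
  exact Submodule.subset_span ⟨i + j, by omega, hs.mul ht⟩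

theorem pb_mem_geSpace {m n : ℕ} {x y : Env A} (hx : x ∈ geSpace A m) (hy : y ∈ geSpace A n) :
    pb x y ∈ geSpace A (m + n + 1) := by
  rw [geSpace_eq_span] at hx hy ⊢
  refine bilin_span PoissonAlgebra.bracket ?_ hx hy
  rintro s ⟨i, hi, hs⟩ t ⟨j, hj, ht⟩
  exact Submodule.subset_span ⟨i + j + 1, by omega, hs.pb ht⟩

theorem geSpace_antitone {m n : ℕ} (h : m ≤ n) : geSpace A n ≤ geSpace A m :=
  iSup₂_le fun i hi => le_iSup₂_of_le (f := fun i (_ : m ≤ i) => deg A i) i (h.trans hi) le_rfl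

theorem mk_mem_geSpace_zero (t : EnvTerm A) : mk t ∈ geSpace A 0 := by
  induction t with
  | of a =>
    rw [geSpace_eq_span]
    exact Submodule.subset_span ⟨0, le_rfl, IsExpr.of a⟩
  | add x y hx hy =>
    change mk x + mk y ∈ geSpace A 0
    exact add_mem hx hy
  | mul x y hx hy =>
    change mk x * mk y ∈ geSpace A (0 + 0)
    exact mul_mem_geSpace hx hy
  | bracket x y hx hy =>
    change pb (mk x) (mk y) ∈ geSpace A 0
    exact geSpace_antitone (Nat.zero_le _) (pb_mem_geSpace hx hy)

theorem mem_geSpace_zero (x : Env A) : x ∈ geSpace A 0 :=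
  Quot.ind (β := fun x : Env A => x ∈ geSpace A 0) mk_mem_geSpace_zero x

variable (A)

/-- `P^{≥ n}(A)` as an ideal of `P(A)`. -/
def ge (n : ℕ) : Ideal (Env A) where
  carrier := geSpace A n
  add_mem' := add_mem
  zero_mem' := zero_mem _
  smul_mem' x y hy := by
    have h := mul_mem_geSpace (mem_geSpace_zero x) hy
    rwa [Nat.zero_add] at h

theorem isPoissonIdeal_ge (n : ℕ) : IsPoissonIdeal (ge A n) := fun x y hy =>
  geSpace_antitone (by omega) (pb_mem_geSpace (mem_geSpace_zero x) (show y ∈ geSpace A n from hy))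

instance (n : ℕ) : PoissonAlgebra (Env A ⧸ ge A n) :=
  PoissonAlgebra.quotient (ge A n) (isPoissonIdeal_ge A n)

end

end Env

/-! ## The NC-filtration -/

section

attribute [local instance] LieRing.ofAssociativeRing LieAlgebra.ofAssociativeAlgebra

/-- The term `L_{k+1}` of the lower central series `L_1 = L`, `L_{m+1} = [L, L_m]` of the Lie
algebra `L = R^Lie`, that is, of `R` with the commutator bracket. -/
def lieTerm (R : Type u) [Ring R] [Algebra ℂ R] (k : ℕ) : Submodule ℂ R :=
  (LieModule.lowerCentralSeries ℂ R R k).toSubmodule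

theorem lieTerm_zero (R : Type u) [Ring R] [Algebra ℂ R] : lieTerm R 0 = ⊤ := rfl

theorem lieTerm_succ (R : Type u) [Ring R] [Algebra ℂ R] (k : ℕ) : lieTerm R (k + 1) =
    Submodule.span ℂ {z | ∃ x : R, ∃ y ∈ lieTerm R k, x * y - y * x = z} := by
  rw [lieTerm, LieModule.lowerCentralSeries_succ, LieSubmodule.lieIdeal_oper_eq_linear_span']
  congr 1
  ext z
  simp [lieTerm, LieRing.of_associative_ring_bracket]

end

section

variable (R : Type u) [Ring R] [Algebra ℂ R]

/-- The NC-filtration: `F^d R` is the sum of all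
`R · L_{i_1} · R · ⋯ · R · L_{i_m} · R` with `i_1 + ⋯ + i_m - m = d`. The list `l` consists of the
numbers `i_1 - 1, …, i_m - 1`. -/
def ncFil (d : ℕ) : Submodule ℂ R :=
  ⨆ (l : List ℕ) (_ : l.sum = d), ⊤ * (l.map fun k => lieTerm R k * ⊤).prod

variable {R}

theorem comm_mem_lieTerm_succ (k : ℕ) (x : R) {y : R} (hy : y ∈ lieTerm R k) :
    x * y - y * x ∈ lieTerm R (k + 1) := by
  rw [lieTerm_succ]
  exact Submodule.subset_span ⟨x, y, hy, rfl⟩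

theorem lieTerm_succ_le (k : ℕ) : lieTerm R (k + 1) ≤ lieTerm R k := by
  induction k with
  | zero => exact le_top
  | succ k ih =>
    rw [lieTerm_succ R (k + 1), Submodule.span_le]
    rintro _ ⟨x, y, hy, rfl⟩
    exact comm_mem_lieTerm_succ k x (ih hy)

theorem comm_lieTerm (j k : ℕ) {x y : R} (hx : x ∈ lieTerm R j) (hy : y ∈ lieTerm R k) :
    x * y - y * x ∈ lieTerm R (j + k + 1) := by
  induction j generalizing x y k with
  | zero =>
    rw [Nat.zero_add]
    exact comm_mem_lieTerm_succ k x hy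
  | succ j ih =>
    rw [lieTerm_succ] at hx
    induction hx using Submodule.span_induction with
    | mem z hz =>
      obtain ⟨a, b, hb, rfl⟩ := hz
      have h1 := comm_mem_lieTerm_succ _ a (ih k hb hy)
      have h2 := ih (k + 1) hb (comm_mem_lieTerm_succ k a hy)
      have e : (a * b - b * a) * y - y * (a * b - b * a) =
          (a * (b * y - y * b) - (b * y - y * b) * a)
            - (b * (a * y - y * a) - (a * y - y * a) * b) := by noncomm_ring
      rw [e]
      refine sub_mem ?_ ?_
      · convert h1 using 2; omega
      · convert h2 using 2; omega
    | zero => simp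
    | add a b _ _ ha hb =>
      have e : (a + b) * y - y * (a + b) = (a * y - y * a) + (b * y - y * b) := by noncomm_ring
      rw [e]
      exact add_mem ha hb
    | smul c a _ ha =>
      have e : (c • a) * y - y * (c • a) = c • (a * y - y * a) := by
        rw [smul_mul_assoc, mul_smul_comm, smul_sub]
      rw [e]
      exact Submodule.smul_mem _ _ ha

theorem top_mul_top' : (⊤ : Submodule ℂ R) * ⊤ = ⊤ := by
  refine top_le_iff.1 fun x _ => ?_
  have h := Submodule.mul_mem_mul (Submodule.mem_top (R := ℂ) (x := x))
    (Submodule.mem_top (R := ℂ) (x := (1 : R)))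
  rwa [mul_one] at h

/-- `F` is the smallest multiplicative family of subspaces with `L_{k+1} ≤ F^k`. -/
theorem ncFil_le (N : ℕ → Submodule ℂ R) (hL : ∀ k, lieTerm R k ≤ N k)
    (hN : ∀ i j, N i * N j ≤ N (i + j)) (d : ℕ) : ncFil R d ≤ N d := by
  have h0 : ⊤ ≤ N 0 := hL 0
  have key : ∀ l : List ℕ, (l.map fun k => lieTerm R k * ⊤).prod ≤ N l.sum := by
    intro l
    induction l with
    | nil => exact le_top.trans h0
    | cons k l ih =>
      rw [List.map_cons, List.prod_cons, List.sum_cons]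
      exact (mul_le_mul' ((mul_le_mul' (hL k) h0).trans (hN k 0)) ih).trans
        (hN _ _)
  refine iSup₂_le ?_
  rintro l rfl
  have h := (mul_le_mul' h0 (key l)).trans (hN 0 l.sum)
  rwa [Nat.zero_add] at h

theorem lieTerm_le_ncFil (k : ℕ) : lieTerm R k ≤ ncFil R k := by
  refine le_trans ?_ (le_iSup₂_of_le
    (f := fun (l : List ℕ) (_ : l.sum = k) => ⊤ * (l.map fun k => lieTerm R k * ⊤).prod)
    [k] (by simp) le_rfl)
  intro x hx
  have h := Submodule.mul_mem_mul (Submodule.mem_top (R := ℂ) (x := (1 : R)))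
    (Submodule.mul_mem_mul hx (Submodule.mem_top (R := ℂ) (x := (1 : R))))
  simpa using h

theorem ncFil_zero : ncFil R 0 = ⊤ := top_le_iff.1 (lieTerm_le_ncFil 0)

theorem ncFil_mul_le (i j : ℕ) : ncFil R i * ncFil R j ≤ ncFil R (i + j) := by
  have key : ∀ l : List ℕ, ⊤ * (l.map fun k => lieTerm R k * ⊤).prod * ⊤ =
      ⊤ * (l.map fun k => lieTerm R k * ⊤).prod := by
    intro l
    induction l with
    | nil => simp [top_mul_top']
    | cons k l ih =>
      rw [List.map_cons, List.prod_cons]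
      rw [mul_assoc, mul_assoc, mul_assoc, ← mul_assoc ⊤ _ ⊤, ih]
      simp only [mul_assoc]
  simp only [ncFil, Submodule.iSup_mul, Submodule.mul_iSup]
  refine iSup₂_le fun l hl => iSup₂_le fun l' hl' => ?_
  refine le_iSup₂_of_le (f := fun (l : List ℕ) (_ : l.sum = i + j) =>
    ⊤ * (l.map fun k => lieTerm R k * ⊤).prod) (l' ++ l) (by simp; omega) ?_
  rw [← mul_assoc, key, List.map_append, List.prod_append, ← mul_assoc]

theorem mul_mem_ncFil {i j : ℕ} {x y : R} (hx : x ∈ ncFil R i) (hy : y ∈ ncFil R j) :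
    x * y ∈ ncFil R (i + j) := ncFil_mul_le i j (Submodule.mul_mem_mul hx hy)

theorem ncFil_succ_le (d : ℕ) : ncFil R (d + 1) ≤ ncFil R d := by
  refine (ncFil_le (fun n => ncFil R n ⊓ ncFil R (n - 1)) (fun k => ?_) (fun i j => ?_) _).trans
    inf_le_right
  · refine le_inf (lieTerm_le_ncFil k) ?_
    cases k with
    | zero => exact lieTerm_le_ncFil 0
    | succ k => exact (lieTerm_succ_le k).trans (lieTerm_le_ncFil k)
  · refine Submodule.mul_le.2 fun x hx y hy => ⟨mul_mem_ncFil hx.1 hy.1, ?_⟩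
    cases j with
    | zero =>
      have h := mul_mem_ncFil hx.2 hy.1
      exact h
    | succ j =>
      have h := mul_mem_ncFil hx.1 hy.2
      exact h

theorem ncFil_antitone : Antitone (ncFil R) := antitone_nat_of_succ_le ncFil_succ_le

/-- The elements `x` of `F^a` with `[x, y] ∈ F^{a+b+1}` for all `y` in the given subspaces `G b`. -/
def commSub (G : ℕ → Submodule ℂ R) (a : ℕ) : Submodule ℂ R where
  carrier := {x | x ∈ ncFil R a ∧ ∀ b, ∀ y ∈ G b, x * y - y * x ∈ ncFil R (a + b + 1)}
  zero_mem' := ⟨zero_mem _, fun b y _ => by simp⟩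
  add_mem' := by
    rintro x x' ⟨hx, h⟩ ⟨hx', h'⟩
    refine ⟨add_mem hx hx', fun b y hy => ?_⟩
    have e : (x + x') * y - y * (x + x') = (x * y - y * x) + (x' * y - y * x') := by noncomm_ring
    rw [e]
    exact add_mem (h b y hy) (h' b y hy)
  smul_mem' := by
    rintro c x ⟨hx, h⟩
    refine ⟨Submodule.smul_mem _ _ hx, fun b y hy => ?_⟩
    rw [smul_mul_assoc, mul_smul_comm, ← smul_sub]
    exact Submodule.smul_mem _ _ (h b y hy)

theorem commSub_mul_le (G : ℕ → Submodule ℂ R) (i j : ℕ) :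
    commSub G i * commSub G j ≤ commSub G (i + j) := by
  refine Submodule.mul_le.2 ?_
  rintro x ⟨hx, h⟩ x' ⟨hx', h'⟩
  refine ⟨mul_mem_ncFil hx hx', fun b y hy => ?_⟩
  have e : x * x' * y - y * (x * x') = x * (x' * y - y * x') + (x * y - y * x) * x' := by
    noncomm_ring
  rw [e]
  refine add_mem ?_ ?_
  · have := mul_mem_ncFil hx (h' b y hy)
    convert this using 2; omega
  · have := mul_mem_ncFil (h b y hy) hx'
    convert this using 2; omega

theorem comm_mem_ncFil {i j : ℕ} {x y : R} (hx : x ∈ ncFil R i) (hy : y ∈ ncFil R j) :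
    x * y - y * x ∈ ncFil R (i + j + 1) := by
  have h1 : ∀ a, ncFil R a ≤ commSub (lieTerm R) a :=
    ncFil_le _ (fun k x hx => ⟨lieTerm_le_ncFil k hx,
      fun b y hy => lieTerm_le_ncFil _ (comm_lieTerm k b hx hy)⟩) (commSub_mul_le _)
  have h2 : ∀ a, ncFil R a ≤ commSub (ncFil R) a := by
    refine ncFil_le _ (fun k x hx => ⟨lieTerm_le_ncFil k hx, fun b y hy => ?_⟩) (commSub_mul_le _)
    have h := neg_mem ((h1 b hy).2 k x hx)
    rw [neg_sub] at h
    convert h using 2; omega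
  exact (h2 i hx).2 j y hy

/-- `F^d R` as a (left) ideal; it is two-sided. -/
def ncIdeal (R : Type u) [Ring R] [Algebra ℂ R] (d : ℕ) : Ideal R where
  carrier := ncFil R d
  add_mem' := add_mem
  zero_mem' := zero_mem _
  smul_mem' x y hy := by
    have h := mul_mem_ncFil (i := 0) (x := x) (by rw [ncFil_zero]; trivial) hy
    rwa [Nat.zero_add] at h

instance (d : ℕ) : (ncIdeal R d).IsTwoSided where
  mul_mem_of_left {x} y hx := mul_mem_ncFil (j := 0) (y := y) hx (by rw [ncFil_zero]; trivial)

variable (R)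

/-- The commutativization `R_ab = R / F^1 R`, where `F^1 R` is the two-sided ideal generated by all
commutators. -/
abbrev Rab : Type u := R ⧸ ncIdeal R 1

noncomputable instance : CommRing (Rab R) where
  mul_comm x y := by
    obtain ⟨x, rfl⟩ := Ideal.Quotient.mk_surjective x
    obtain ⟨y, rfl⟩ := Ideal.Quotient.mk_surjective y
    rw [← map_mul, ← map_mul]
    refine Ideal.Quotient.eq.2 (comm_mem_ncFil (i := 0) (j := 0) ?_ ?_) <;>
    · rw [ncFil_zero]; trivial

/-! ## The associated graded Poisson algebra -/

/-- The graded piece `gr^i_F(R) = F^i R / F^{i+1} R`. -/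
def GrPiece (i : ℕ) : Type u := ncFil R i ⧸ (ncFil R (i + 1)).submoduleOf (ncFil R i)

instance (i : ℕ) : AddCommGroup (GrPiece R i) :=
  Submodule.Quotient.addCommGroup ((ncFil R (i + 1)).submoduleOf (ncFil R i))
instance (i : ℕ) : Module ℂ (GrPiece R i) :=
  Submodule.Quotient.module ((ncFil R (i + 1)).submoduleOf (ncFil R i))

/-- The projection `F^i R → gr^i_F(R)`. -/
def GrPiece.mk (i : ℕ) : ncFil R i →ₗ[ℂ] GrPiece R i :=
  ((ncFil R (i + 1)).submoduleOf (ncFil R i)).mkQ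

/-- The associated graded space `gr_F(R) = ⨁ F^i R / F^{i+1} R`. -/
def Gr : Type u := DirectSum ℕ fun i => GrPiece R i

noncomputable instance : AddCommGroup (Gr R) :=
  inferInstanceAs (AddCommGroup (DirectSum ℕ fun i => GrPiece R i))
noncomputable instance : Module ℂ (Gr R) :=
  inferInstanceAs (Module ℂ (DirectSum ℕ fun i => GrPiece R i))

namespace Gr

/-- The inclusion of the graded piece of degree `i`. -/
noncomputable def incl (i : ℕ) : GrPiece R i →ₗ[ℂ] Gr R := DirectSum.lof ℂ ℕ (fun i => GrPiece R i) i

/-- The symbol of degree `i` of an element of `F^i R`. -/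
noncomputable def symb (i : ℕ) : ncFil R i →ₗ[ℂ] Gr R := incl R i ∘ₗ GrPiece.mk R i

variable {R}

theorem symb_congr {i j : ℕ} (h : i = j) {x y : R} (hx : x ∈ ncFil R i) (hy : y ∈ ncFil R j)
    (e : x = y) : symb R i ⟨x, hx⟩ = symb R j ⟨y, hy⟩ := by
  subst h; subst e; rfl

theorem symb_eq_zero {i : ℕ} {x : ncFil R i} (h : (x : R) ∈ ncFil R (i + 1)) : symb R i x = 0 := by
  have : GrPiece.mk R i x = 0 := (Submodule.Quotient.mk_eq_zero _).2 h
  exact (congrArg (incl R i) this).trans (map_zero _)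

@[elab_as_elim]
theorem induct {p : Gr R → Prop} (x : Gr R)
    (h : ∀ i (x : R) (hx : x ∈ ncFil R i), p (symb R i ⟨x, hx⟩))
    (hadd : ∀ x y, p x → p y → p (x + y)) : p x := by
  refine DirectSum.induction_on (motive := p) x ?_ ?_ hadd
  · have := h 0 0 (zero_mem _)
    rwa [show (⟨0, zero_mem _⟩ : ncFil R 0) = 0 from rfl, map_zero] at this
  · intro i y
    obtain ⟨⟨y, hy⟩, rfl⟩ : ∃ z, GrPiece.mk R i z = y := Submodule.Quotient.mk_surjective _ y
    exact h i y hy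

/-- Descend a bilinear map in its second argument from the `F^j R` to `gr_F(R)`. -/
noncomputable def liftRight {N : Type u} [AddCommGroup N] [Module ℂ N]
    (B : ∀ j, N →ₗ[ℂ] ncFil R j →ₗ[ℂ] Gr R)
    (h : ∀ j (x : N) (y : ncFil R j), (y : R) ∈ ncFil R (j + 1) → B j x y = 0) :
    N →ₗ[ℂ] Gr R →ₗ[ℂ] Gr R :=
  LinearMap.flip (DirectSum.toModule ℂ ℕ (N →ₗ[ℂ] Gr R) fun j =>
    Submodule.liftQ ((ncFil R (j + 1)).submoduleOf (ncFil R j)) (B j).flip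
      (fun y hy => LinearMap.ext fun x => h j x y hy) :
    (DirectSum ℕ fun i => GrPiece R i) →ₗ[ℂ] N →ₗ[ℂ] Gr R)

theorem liftRight_symb {N : Type u} [AddCommGroup N] [Module ℂ N]
    (B : ∀ j, N →ₗ[ℂ] ncFil R j →ₗ[ℂ] Gr R) (h) (j : ℕ) (x : N) (y : ncFil R j) :
    liftRight B h x (symb R j y) = B j x y := by
  have e := DirectSum.toModule_lof ℂ (ι := ℕ) (M := fun i => GrPiece R i) (N := N →ₗ[ℂ] Gr R)
    (φ := fun j => Submodule.liftQ ((ncFil R (j + 1)).submoduleOf (ncFil R j)) (B j).flip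
      (fun y hy => LinearMap.ext fun x => h j x y hy)) j (GrPiece.mk R j y)
  exact congrArg (fun f : N →ₗ[ℂ] Gr R => f x) e

/-- The bilinear operation on `gr_F(R)` which is induced by operations `B i j` on representatives
of homogeneous elements. -/
noncomputable def lift₂ (B : ∀ i j, ncFil R i →ₗ[ℂ] ncFil R j →ₗ[ℂ] Gr R)
    (h₁ : ∀ i j (x : ncFil R i) (y : ncFil R j), (x : R) ∈ ncFil R (i + 1) → B i j x y = 0)
    (h₂ : ∀ i j (x : ncFil R i) (y : ncFil R j), (y : R) ∈ ncFil R (j + 1) → B i j x y = 0) :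
    Gr R →ₗ[ℂ] Gr R →ₗ[ℂ] Gr R :=
  LinearMap.flip (liftRight (N := Gr R)
    (fun i => (liftRight (fun j => B i j) (h₂ i)).flip)
    (fun i z x hx => by
      rw [LinearMap.flip_apply]
      refine induct z (fun j y hy => ?_) (fun y z hy hz => by rw [map_add, hy, hz, add_zero])
      rw [liftRight_symb]
      exact h₁ i j x _ hx))

theorem lift₂_symb (B : ∀ i j, ncFil R i →ₗ[ℂ] ncFil R j →ₗ[ℂ] Gr R) (h₁) (h₂) (i j : ℕ)
    (x : ncFil R i) (y : ncFil R j) : lift₂ B h₁ h₂ (symb R i x) (symb R j y) = B i j x y := by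
  rw [lift₂, LinearMap.flip_apply, liftRight_symb, LinearMap.flip_apply, liftRight_symb]

/-- Multiplication: the product of the symbols of `x ∈ F^i` and `y ∈ F^j` is the symbol of `x * y`
in degree `i + j`. -/
noncomputable def mulMap : Gr R →ₗ[ℂ] Gr R →ₗ[ℂ] Gr R :=
  lift₂
    (fun i j => LinearMap.mk₂ ℂ (fun x y => symb R (i + j) ⟨x * y, mul_mem_ncFil x.2 y.2⟩)
      (fun x x' y => by rw [← map_add]; exact symb_congr rfl _ _ (add_mul _ _ _))
      (fun c x y => by rw [← map_smul]; exact symb_congr rfl _ _ (smul_mul_assoc _ _ _))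
      (fun x y y' => by rw [← map_add]; exact symb_congr rfl _ _ (mul_add _ _ _))
      (fun c x y => by rw [← map_smul]; exact symb_congr rfl _ _ (mul_smul_comm _ _ _)))
    (fun i j x y hx => symb_eq_zero (by
      exact ncFil_antitone (by omega) (mul_mem_ncFil hx y.2)))
    (fun i j x y hy => symb_eq_zero (by
      exact ncFil_antitone (by omega) (mul_mem_ncFil x.2 hy)))

/-- The bracket: the bracket of the symbols of `x ∈ F^i` and `y ∈ F^j` is the symbol of
`x * y - y * x` in degree `i + j + 1`. -/
noncomputable def bracketMap : Gr R →ₗ[ℂ] Gr R →ₗ[ℂ] Gr R :=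
  lift₂
    (fun i j => LinearMap.mk₂ ℂ
      (fun x y => symb R (i + j + 1) ⟨x * y - y * x, comm_mem_ncFil x.2 y.2⟩)
      (fun x x' y => by
        rw [← map_add]
        refine symb_congr rfl _ _ ?_
        simp only [Submodule.coe_add]
        noncomm_ring)
      (fun c x y => by
        rw [← map_smul]
        refine symb_congr rfl _ _ ?_
        simp only [Submodule.coe_smul]
        rw [smul_mul_assoc, mul_smul_comm, smul_sub])
      (fun x y y' => by
        rw [← map_add]
        refine symb_congr rfl _ _ ?_
        simp only [Submodule.coe_add]
        noncomm_ring)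
      (fun c x y => by
        rw [← map_smul]
        refine symb_congr rfl _ _ ?_
        simp only [Submodule.coe_smul]
        rw [smul_mul_assoc, mul_smul_comm, smul_sub]))
    (fun i j x y hx => symb_eq_zero (by
      exact ncFil_antitone (by omega) (comm_mem_ncFil hx y.2)))
    (fun i j x y hy => symb_eq_zero (by
      exact ncFil_antitone (by omega) (comm_mem_ncFil x.2 hy)))

noncomputable instance : Mul (Gr R) := ⟨fun x y => mulMap x y⟩
noncomputable instance : One (Gr R) := ⟨symb R 0 ⟨1, by rw [ncFil_zero]; trivial⟩⟩

theorem symb_mul (i j : ℕ) {x y : R} (hx : x ∈ ncFil R i) (hy : y ∈ ncFil R j) :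
    symb R i ⟨x, hx⟩ * symb R j ⟨y, hy⟩ = symb R (i + j) ⟨x * y, mul_mem_ncFil hx hy⟩ :=
  lift₂_symb _ _ _ i j _ _

theorem bracket_symb (i j : ℕ) {x y : R} (hx : x ∈ ncFil R i) (hy : y ∈ ncFil R j) :
    bracketMap (symb R i ⟨x, hx⟩) (symb R j ⟨y, hy⟩) =
      symb R (i + j + 1) ⟨x * y - y * x, comm_mem_ncFil hx hy⟩ :=
  lift₂_symb _ _ _ i j _ _

protected theorem add_mul' (x y z : Gr R) : (x + y) * z = x * z + y * z :=
  LinearMap.map_add₂ mulMap x y z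
protected theorem mul_add' (x y z : Gr R) : x * (y + z) = x * y + x * z := map_add (mulMap x) y z

protected theorem mul_comm' (x y : Gr R) : x * y = y * x := by
  refine induct x (fun i x hx => ?_) (fun x x' h h' => by rw [Gr.add_mul', Gr.mul_add', h, h'])
  refine induct y (fun j y hy => ?_) (fun x x' h h' => by rw [Gr.add_mul', Gr.mul_add', h, h'])
  rw [symb_mul, symb_mul, symb_congr (Nat.add_comm j i) _
    (by rw [Nat.add_comm]; exact mul_mem_ncFil hy hx) rfl, ← sub_eq_zero, ← map_sub]
  exact symb_eq_zero (comm_mem_ncFil hx hy)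

protected theorem mul_assoc' (x y z : Gr R) : x * y * z = x * (y * z) := by
  refine induct x (fun i x hx => ?_) (fun x x' h h' => by simp only [Gr.add_mul', h, h'])
  refine induct y (fun j y hy => ?_)
    (fun x x' h h' => by simp only [Gr.add_mul', Gr.mul_add', h, h'])
  refine induct z (fun k z hz => ?_) (fun x x' h h' => by simp only [Gr.mul_add', h, h'])
  simp only [symb_mul]
  exact symb_congr (Nat.add_assoc _ _ _) _ _ (mul_assoc _ _ _)

protected theorem one_mul' (x : Gr R) : 1 * x = x := by
  refine induct x (fun i x hx => ?_) (fun x x' h h' => by rw [Gr.mul_add', h, h'])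
  exact (symb_mul _ _ _ _).trans (symb_congr (Nat.zero_add i) _ _ (one_mul x))

noncomputable instance : CommRing (Gr R) where
  zero_mul x := LinearMap.map_zero₂ mulMap x
  mul_zero x := map_zero (mulMap x)
  left_distrib := Gr.mul_add'
  right_distrib := Gr.add_mul'
  mul_assoc := Gr.mul_assoc'
  mul_comm := Gr.mul_comm'
  one_mul := Gr.one_mul'
  mul_one x := (Gr.mul_comm' x 1).trans (Gr.one_mul' x)
  neg_add_cancel := neg_add_cancel
  sub_eq_add_neg := sub_eq_add_neg
  zsmul := fun n x => n • x
  zsmul_zero' := zero_zsmul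
  zsmul_succ' := SubNegMonoid.zsmul_succ'
  zsmul_neg' := SubNegMonoid.zsmul_neg'

noncomputable instance : Algebra ℂ (Gr R) :=
  Algebra.ofModule (fun c x y => LinearMap.map_smul₂ mulMap c x y)
    (fun c x y => map_smul (mulMap x) c y)

noncomputable instance : PoissonAlgebra (Gr R) where
  bracket := bracketMap
  antisymm x y := by
    refine induct x (fun i x hx => ?_)
      (fun x x' h h' => by simp only [map_add, LinearMap.add_apply, h, h', neg_add])
    refine induct y (fun j y hy => ?_)
      (fun x x' h h' => by simp only [map_add, LinearMap.add_apply, h, h', neg_add])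
    rw [bracket_symb, bracket_symb, ← map_neg]
    exact symb_congr (by omega) _ _ (by simp)
  jacobi x y z := by
    refine induct x (fun i x hx => ?_) (fun x x' h h' => by
      simp only [map_add, LinearMap.add_apply]
      rw [← add_zero (0 : Gr R)]
      nth_rw 1 [← h]
      rw [← h']
      abel)
    refine induct y (fun j y hy => ?_) (fun x x' h h' => by
      simp only [map_add, LinearMap.add_apply]
      rw [← add_zero (0 : Gr R)]
      nth_rw 1 [← h]
      rw [← h']
      abel)
    refine induct z (fun k z hz => ?_) (fun x x' h h' => by
      simp only [map_add, LinearMap.add_apply]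
      rw [← add_zero (0 : Gr R)]
      nth_rw 1 [← h]
      rw [← h']
      abel)
    simp only [bracket_symb]
    have hm : ∀ {n : ℕ} {w : R}, n = i + j + k + 2 → w ∈ ncFil R n → w ∈ ncFil R (i + j + k + 2) := by
      rintro n w rfl h
      exact h
    rw [symb_congr (j := i + j + k + 2) (by omega) _ (hm (by omega)
        (comm_mem_ncFil hx (comm_mem_ncFil hy hz))) rfl,
      symb_congr (j := i + j + k + 2) (by omega) _ (hm (by omega)
        (comm_mem_ncFil hy (comm_mem_ncFil hz hx))) rfl,
      symb_congr (j := i + j + k + 2) (by omega) _ (hm (by omega)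
        (comm_mem_ncFil hz (comm_mem_ncFil hx hy))) rfl,
      ← map_add, ← map_add, ← map_zero (symb R (i + j + k + 2))]
    refine symb_congr rfl _ _ ?_
    simp only [Submodule.coe_add]
    noncomm_ring
  leibniz x y z := by
    refine induct x (fun i x hx => ?_) (fun x x' h h' => by
      simp only [map_add, LinearMap.add_apply, h, h']
      ring)
    refine induct y (fun j y hy => ?_) (fun x x' h h' => by
      simp only [map_add, add_mul, h, h']
      ring)
    refine induct z (fun k z hz => ?_) (fun x x' h h' => by
      simp only [map_add, mul_add, h, h']
      ring)
    simp only [bracket_symb, symb_mul]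
    have hm : ∀ {n : ℕ} {w : R}, n = i + j + k + 1 → w ∈ ncFil R n → w ∈ ncFil R (i + j + k + 1) := by
      rintro n w rfl h
      exact h
    rw [symb_congr (j := i + j + k + 1) (by omega) _ (hm (by omega)
        (comm_mem_ncFil hx (mul_mem_ncFil hy hz))) rfl,
      symb_congr (j := i + j + k + 1) (by omega) _ (hm (by omega)
        (mul_mem_ncFil (comm_mem_ncFil hx hy) hz)) rfl,
      symb_congr (j := i + j + k + 1) (by omega) _ (hm (by omega)
        (mul_mem_ncFil hy (comm_mem_ncFil hx hz))) rfl,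
      ← map_add]
    refine symb_congr rfl _ _ ?_
    simp only
    noncomm_ring

variable (R)

/-- The map `R → gr_F(R)` sending `r` to its symbol in degree `0`. -/
noncomputable def ofR : R →ₐ[ℂ] Gr R :=
  AlgHom.ofLinearMap (symb R 0 ∘ₗ LinearMap.codRestrict (ncFil R 0) LinearMap.id
      (fun x => by rw [ncFil_zero]; trivial)) rfl
    (fun x y => (symb_mul 0 0 _ _).symm)

/-- The canonical homomorphism `R_ab = gr^0_F(R) → gr_F(R)`, `r mod F^1 ↦` the symbol of `r` in
degree `0`. -/
noncomputable def ofRab : Rab R →ₐ[ℂ] Gr R :=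
  Ideal.Quotient.liftₐ (ncIdeal R 1) (ofR R) (fun _ ha => symb_eq_zero ha)

/-- `gr_F(R)` as an algebra over `R_ab = gr^0_F(R)`. -/
noncomputable instance : Algebra (Rab R) (Gr R) := (ofRab R).toRingHom.toAlgebra

/-- The graded component `gr^i_F(R)` of `gr_F(R)`, as an `R_ab`-submodule. -/
noncomputable def deg (i : ℕ) : Submodule (Rab R) (Gr R) where
  carrier := Set.range (incl R i)
  zero_mem' := ⟨0, map_zero _⟩
  add_mem' := by
    rintro _ _ ⟨x, rfl⟩ ⟨y, rfl⟩
    exact ⟨x + y, map_add _ _ _⟩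
  smul_mem' := by
    rintro a _ ⟨x, rfl⟩
    obtain ⟨a, rfl⟩ := Ideal.Quotient.mk_surjective a
    obtain ⟨⟨x, hx⟩, rfl⟩ : ∃ z, GrPiece.mk R i z = x := Submodule.Quotient.mk_surjective _ x
    have h0 : a ∈ ncFil R 0 := by rw [ncFil_zero]; trivial
    have hax : a * x ∈ ncFil R i := by
      have h := mul_mem_ncFil h0 hx
      rwa [Nat.zero_add] at h
    refine ⟨GrPiece.mk R i ⟨a * x, hax⟩, ?_⟩
    exact ((symb_mul 0 i h0 hx).trans (symb_congr (Nat.zero_add i) _ hax rfl)).symm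

end Gr

end

/-! ## `d`-smooth algebras -/

/-- `R` is NC-nilpotent of degree `d`, i.e. an object of the category `N_d`: `F^{d+1} R = 0`. -/
def IsNCNilpotent (d : ℕ) (R : Type u) [Ring R] [Algebra ℂ R] : Prop := ncFil R (d + 1) = ⊥

/-- `R` is `d`-smooth: it is a finitely generated algebra in `N_d`, and the functor
`Hom(R, -)` on `N_d` is formally smooth, i.e. takes each surjection in `N_d` whose kernel is a
nilpotent ideal to a surjection. -/
structure IsDSmooth (d : ℕ) (R : Type u) [Ring R] [Algebra ℂ R] : Prop where
  finiteType : Algebra.FiniteType ℂ R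
  ncNilpotent : IsNCNilpotent d R
  formallySmooth : ∀ (S T : Type u) [Ring S] [Algebra ℂ S] [Ring T] [Algebra ℂ T],
    IsNCNilpotent d S → IsNCNilpotent d T → ∀ p : S →ₐ[ℂ] T, Function.Surjective p →
    IsNilpotent (LinearMap.ker p.toLinearMap : Submodule ℂ S) →
    ∀ f : R →ₐ[ℂ] T, ∃ g : R →ₐ[ℂ] S, p.comp g = f

/-! ## The functors `Q^d_A` -/

section

variable (A M : Type u) [CommRing A] [AddCommGroup M] [Module A M]

/-- The ideal of linear relations in the free Lie algebra on the set `M`. -/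
noncomputable def freeLieRel : LieIdeal A (FreeLieAlgebra A M) :=
  LieSubmodule.lieSpan A (FreeLieAlgebra A M)
    ({z | ∃ m n : M, FreeLieAlgebra.of A (m + n) - (FreeLieAlgebra.of A m + FreeLieAlgebra.of A n)
        = z} ∪
     {z | ∃ (a : A) (m : M), FreeLieAlgebra.of A (a • m) - a • FreeLieAlgebra.of A m = z})

/-- The free Lie algebra `Lie_A(M)` over `A` generated by the `A`-module `M`. -/
abbrev FreeLie : Type u := FreeLieAlgebra A M ⧸ freeLieRel A M

/-- The class of a generator `m ∈ M`. -/
noncomputable def FreeLie.of (m : M) : FreeLie A M := LieSubmodule.Quotient.mk (FreeLieAlgebra.of A m)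

/-- The component of degree `k + 1` of `Lie_A(M)`: the span of the brackets
`[m_0, [m_1, …, [m_{k-1}, m_k]…]]` with all `m_j` in `M`. -/
noncomputable def FreeLie.deg : ℕ → Submodule A (FreeLie A M)
  | 0 => Submodule.span A {z | ∃ m : M, FreeLie.of A M m = z}
  | k + 1 => Submodule.span A {z | ∃ m : M, ∃ y ∈ FreeLie.deg k, ⁅FreeLie.of A M m, y⁆ = z}

/-- `Lie_+(M)`, the direct sum of the components of degrees `≥ 2` of `Lie_A(M)`; the summand with
index `k` is the component of degree `k + 2`, and it is given the new degree `k + 1`. -/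
abbrev LiePlus : Type u := DirectSum ℕ fun k => FreeLie.deg A M (k + 1)

/-- The summand of `Lie_+(M)` with index `k`, inside the symmetric algebra of `Lie_+(M)`. -/
noncomputable def symGen (k : ℕ) : Submodule A (SymmetricAlgebra A (LiePlus A M)) :=
  LinearMap.range (SymmetricAlgebra.ι A (LiePlus A M) ∘ₗ
    DirectSum.lof A ℕ (fun k => FreeLie.deg A M (k + 1)) k)

/-- `Q^d_A(M)`, the homogeneous part of degree `d` of the symmetric algebra of `Lie_+(M)`: the span
of the products of homogeneous elements of `Lie_+(M)` whose degrees add up to `d`. -/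
noncomputable def Q (d : ℕ) : Submodule A (SymmetricAlgebra A (LiePlus A M)) :=
  ⨆ (l : List ℕ) (_ : (l.map fun k => k + 1).sum = d), (l.map fun k => symGen A M k).prod

end

end NCGeom

/-!
The identity of `A = R_ab` extends to a homomorphism `P(A) → gr_F(R)`, which maps `P^i(A)` onto
`gr^i_F(R)` because the NC-filtration is generated by iterated commutators. On the other hand,
`P(A)` is generated over `A` by right-normed words `{a_0, {a_1, …}}`. Since `A` is formally smooth,
`a ⊗ b ↦ a db` has an `A`-linear section, with which Lie polynomials in differentials can be turned
into combinations of such words: this maps `Q^i_A(Ω)` onto `P^i(A)`. So everything follows from the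
injectivity of the composite `Q^i_A(Ω) → gr^i_F(R)` for `i ≤ d`.

By `d`-smoothness, `a ↦ a + da` lifts to a homomorphism `g` from `R` to a truncation of the tensor
algebra `T_A(Ω)`. The leading component of `g` on a word is the same word in the differentials of
its letters, so on a product of `s` Lie elements of total degree `i` it is their product in
`T_A(Ω)`, of weight `i + s`. If the symbol in `gr^i_F(R)` vanishes, this is also a sum of products
of Lie elements of total degree greater than `i`, which must have fewer than `s` factors. To
conclude without the Poincaré–Birkhoff–Witt theorem, let `Lie_A(Ω)` act on `Lie_A(Ω) ⊕ A ξ` with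
`ξ` as the negative of the Euler derivation. On the power `ξ^s` in the symmetric algebra, a product
of `s` Lie elements acts with constant term `s!` times their commutative product, up to the degrees
of the factors, while fewer factors act without a constant term. Hence an element of the kernel has
no part with `0` factors, then none with `1` factor, and so on.
-/

namespace NCGeom

section PoissonBracket

variable {P : Type*} [CommRing P] [Algebra ℂ P] [PoissonAlgebra P]

theorem pb_add (x y z : P) : pb x (y + z) = pb x y + pb x z := map_add _ _ _

theorem add_pb (x y z : P) : pb (x + y) z = pb x z + pb y z := LinearMap.map_add₂ _ _ _ _

theorem pb_smul (c : ℂ) (x y : P) : pb x (c • y) = c • pb x y := map_smul _ _ _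

theorem pb_antisymm (x y : P) : pb x y = -pb y x := PoissonAlgebra.antisymm x y

theorem pb_mul (x y z : P) : pb x (y * z) = pb x y * z + y * pb x z :=
  PoissonAlgebra.leibniz x y z

theorem mul_pb (x y z : P) : pb (x * y) z = x * pb y z + pb x z * y := by
  rw [pb_antisymm, pb_mul, pb_antisymm z x, pb_antisymm z y]
  ring

theorem pb_self (x : P) : pb x x = 0 := by
  have h : (2 : ℂ) • pb x x = 0 := by
    rw [two_smul]
    exact eq_neg_iff_add_eq_zero.1 (pb_antisymm x x)
  exact (smul_eq_zero.1 h).resolve_left two_ne_zero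

theorem pb_pb (x y z : P) : pb x (pb y z) = pb (pb x y) z + pb y (pb x z) := by
  have jacobi : pb x (pb y z) + pb y (pb z x) + pb z (pb x y) = 0 := PoissonAlgebra.jacobi x y z
  have flip : pb y (pb z x) = -pb y (pb x z) := by
    rw [pb_antisymm z x]
    exact map_neg (PoissonAlgebra.bracket y) _
  rw [flip, pb_antisymm z] at jacobi
  linear_combination jacobi

end PoissonBracket

namespace Env

variable {A : Type u} [CommRing A] [Algebra ℂ A]

/-! ### The universal property of the Poisson envelope -/

section Lift

variable {P : Type*} [CommRing P] [Algebra ℂ P] [PoissonAlgebra P] (f : A →ₐ[ℂ] P)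

/-- The value of a formal expression in a Poisson algebra `P`, its leaves being sent to `P`
by `f`. -/
def interpret : EnvTerm A → P
  | .of a => f a
  | .add x y => interpret x + interpret y
  | .mul x y => interpret x * interpret y
  | .bracket x y => pb (interpret x) (interpret y)

theorem interpret_eq_of_envRel {s t : EnvTerm A} (h : EnvRel A s t) :
    interpret f s = interpret f t := by
  induction h with
  | of_add a b => simp [interpret]
  | of_mul a b => simp [interpret]
  | add_assoc x y z => simp [interpret, add_assoc]
  | add_comm x y => simp [interpret, add_comm]
  | zero_add x => simp [interpret]
  | zero_mul x => simp [interpret]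
  | one_mul x => simp [interpret]
  | mul_assoc x y z => simp [interpret, mul_assoc]
  | mul_comm x y => simp [interpret, mul_comm]
  | add_mul x y z => simp [interpret, add_mul]
  | bracket_add x y z => simp [interpret, pb_add]
  | bracket_smul c x y => simp [interpret, ← Algebra.smul_def, pb_smul]
  | antisymm x y => simpa [interpret] using pb_antisymm _ _
  | jacobi x y z =>
    rw [show interpret f (.of (0 : A)) = 0 from map_zero f]
    exact PoissonAlgebra.jacobi _ _ _
  | leibniz x y z => simp [interpret, pb_mul]
  | add_left y _ ih => simp [interpret, ih]
  | add_right x _ ih => simp [interpret, ih]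
  | mul_left y _ ih => simp [interpret, ih]
  | mul_right x _ ih => simp [interpret, ih]
  | bracket_left y _ ih => simp [interpret, ih]
  | bracket_right x _ ih => simp [interpret, ih]

/-- The homomorphism of Poisson algebras `P(A) → P` which extends `f : A → P`. -/
def lift : Env A →ₐ[ℂ] P where
  toFun := Quot.lift (interpret f) fun _ _ => interpret_eq_of_envRel f
  map_one' := map_one f
  map_zero' := map_zero f
  map_mul' x y := by
    induction x using Quot.ind; induction y using Quot.ind
    rfl
  map_add' x y := by
    induction x using Quot.ind; induction y using Quot.ind
    rfl
  commutes' c := f.commutes c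

theorem lift_pb (x y : Env A) : lift f (pb x y) = pb (lift f x) (lift f y) := by
  induction x using Quot.ind; induction y using Quot.ind
  rfl

theorem hom_ext {g h : Env A →ₐ[ℂ] P} (hg : ∀ x y, g (pb x y) = pb (g x) (g y))
    (hh : ∀ x y, h (pb x y) = pb (h x) (h y)) (hι : ∀ a, g (ι A a) = h (ι A a)) : g = h := by
  refine AlgHom.ext fun x => ?_
  obtain ⟨t, rfl⟩ : ∃ t, mk t = x := Quot.exists_rep x
  induction t with
  | of a => exact hι a
  | add x y hx hy =>
    change g (mk x + mk y) = h (mk x + mk y)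
    rw [map_add, map_add, hx, hy]
  | mul x y hx hy =>
    change g (mk x * mk y) = h (mk x * mk y)
    rw [map_mul, map_mul, hx, hy]
  | bracket x y hx hy =>
    change g (pb (mk x) (mk y)) = h (pb (mk x) (mk y))
    rw [hg, hh, hx, hy]

end Lift

/-! ### Lie words span the Poisson envelope modulo decomposable elements -/

section Words

theorem mul_mem_deg {i j k : ℕ} (h : i + j = k) {x y : Env A} (hx : x ∈ deg A i)
    (hy : y ∈ deg A j) : x * y ∈ deg A k :=
  bilin_span (LinearMap.mul ℂ (Env A))
    (fun _ hs _ ht => Submodule.subset_span (h ▸ IsExpr.mul hs ht)) hx hy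

theorem pb_mem_deg {i j k : ℕ} (h : i + j + 1 = k) {x y : Env A} (hx : x ∈ deg A i)
    (hy : y ∈ deg A j) : pb x y ∈ deg A k :=
  bilin_span PoissonAlgebra.bracket
    (fun _ hs _ ht => Submodule.subset_span (h ▸ IsExpr.pb hs ht)) hx hy

theorem ι_mem_deg (a : A) : ι A a ∈ deg A 0 := Submodule.subset_span (.of a)

theorem ι_mul_mem_deg {k : ℕ} (a : A) {x : Env A} (hx : x ∈ deg A k) : ι A a * x ∈ deg A k :=
  mul_mem_deg (Nat.zero_add k) (ι_mem_deg a) hx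

theorem IsExpr.exists_ι_eq {k : ℕ} {x : Env A} (hx : IsExpr k x) (hk : k = 0) :
    ∃ a, ι A a = x := by
  induction hx with
  | of a => exact ⟨a, rfl⟩
  | mul _ _ ihx ihy =>
    obtain ⟨a, rfl⟩ := ihx (by omega)
    obtain ⟨b, rfl⟩ := ihy (by omega)
    exact ⟨a * b, map_mul _ _ _⟩
  | pb => omega

theorem exists_ι_eq_of_mem_deg_zero {x : Env A} (hx : x ∈ deg A 0) : ∃ a, ι A a = x := by
  have h : deg A 0 ≤ LinearMap.range (ι A).toLinearMap :=
    Submodule.span_le.2 fun _ hx => IsExpr.exists_ι_eq hx rfl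
  exact h hx

/-- The decomposable elements of degree `k` of `P(A)`: sums of products of two elements of
positive degrees. -/
def dec (A : Type u) [CommRing A] [Algebra ℂ A] (k : ℕ) : Submodule ℂ (Env A) :=
  Submodule.span ℂ {z | ∃ i j, i + 1 + (j + 1) = k ∧ ∃ x ∈ deg A (i + 1), ∃ y ∈ deg A (j + 1),
    x * y = z}

theorem mul_mem_dec {i j k : ℕ} (h : i + 1 + (j + 1) = k) {x y : Env A} (hx : x ∈ deg A (i + 1))
    (hy : y ∈ deg A (j + 1)) : x * y ∈ dec A k :=
  Submodule.subset_span ⟨i, j, h, x, hx, y, hy, rfl⟩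

theorem dec_le_deg (k : ℕ) : dec A k ≤ deg A k := by
  refine Submodule.span_le.2 ?_
  rintro _ ⟨i, j, h, x, hx, y, hy, rfl⟩
  exact mul_mem_deg h hx hy

theorem ι_mul_mem_dec {k : ℕ} (a : A) {x : Env A} (hx : x ∈ dec A k) : ι A a * x ∈ dec A k := by
  have h : dec A k ≤ (dec A k).comap (LinearMap.mul ℂ (Env A) (ι A a)) := by
    refine Submodule.span_le.2 ?_
    rintro _ ⟨i, j, h, x, hx, y, hy, rfl⟩
    change ι A a * (x * y) ∈ dec A k
    rw [← mul_assoc]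
    exact mul_mem_dec h (ι_mul_mem_deg a hx) hy
  exact h hx

theorem pb_mem_dec_of_mem_right {i j k : ℕ} (h : i + j + 1 = k) {x y : Env A} (hx : x ∈ deg A i)
    (hy : y ∈ dec A j) : pb x y ∈ dec A k := by
  have hle : dec A j ≤ (dec A k).comap (PoissonAlgebra.bracket x) := by
    refine Submodule.span_le.2 ?_
    rintro _ ⟨l, m, rfl, y, hy, z, hz, rfl⟩
    change pb x (y * z) ∈ dec A k
    rw [pb_mul]
    exact add_mem
      (mul_mem_dec (i := i + l + 1) (j := m) (by omega) (pb_mem_deg (by omega) hx hy) hz)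
      (mul_mem_dec (i := l) (j := i + m + 1) (by omega) hy (pb_mem_deg (by omega) hx hz))
  exact hle hy

theorem pb_mem_dec_of_mem_left {i j k : ℕ} (h : i + j + 1 = k) {x y : Env A} (hx : x ∈ dec A i)
    (hy : y ∈ deg A j) : pb x y ∈ dec A k := by
  rw [pb_antisymm]
  exact neg_mem (pb_mem_dec_of_mem_right (by omega) hy hx)

/-- The right-normed Lie words `{a_0, {a_1, …, {a_{k-1}, a_k}…}}` with `k` brackets in the elements
of `A`, which generate `P(A)` modulo decomposable elements. -/
inductive IsWord : ℕ → Env A → Prop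
  | of (a : A) : IsWord 0 (ι A a)
  | pb {k : ℕ} (a : A) {x : Env A} (hx : IsWord k x) : IsWord (k + 1) (pb (ι A a) x)

/-- The span over `ℂ` of the Lie words with `k` brackets. -/
def wordSpan (A : Type u) [CommRing A] [Algebra ℂ A] (k : ℕ) : Submodule ℂ (Env A) :=
  Submodule.span ℂ {w | IsWord k w}

theorem IsWord.mem_wordSpan {k : ℕ} {w : Env A} (hw : IsWord k w) : w ∈ wordSpan A k :=
  Submodule.subset_span hw

theorem IsWord.mem_deg {k : ℕ} {w : Env A} (hw : IsWord k w) : w ∈ deg A k := by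
  induction hw with
  | of a => exact ι_mem_deg a
  | pb a _ ih => exact pb_mem_deg (by omega) (ι_mem_deg a) ih

theorem pb_ι_mem_wordSpan (a : A) {k : ℕ} {x : Env A} (hx : x ∈ wordSpan A k) :
    pb (ι A a) x ∈ wordSpan A (k + 1) := by
  have h : wordSpan A k ≤ (wordSpan A (k + 1)).comap (PoissonAlgebra.bracket (ι A a)) :=
    Submodule.span_le.2 fun _ hw => (IsWord.pb a hw).mem_wordSpan
  exact h hx

theorem IsWord.pb_mem_wordSpan {i j k : ℕ} (h : i + j + 1 = k) {x y : Env A} (hx : IsWord i x)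
    (hy : y ∈ wordSpan A j) : NCGeom.pb x y ∈ wordSpan A k := by
  subst h
  induction hx generalizing j y with
  | of a => simpa only [Nat.zero_add] using pb_ι_mem_wordSpan a hy
  | @pb i a x _ ih =>
    have jacobi : NCGeom.pb (NCGeom.pb (ι A a) x) y =
        NCGeom.pb (ι A a) (NCGeom.pb x y) - NCGeom.pb x (NCGeom.pb (ι A a) y) :=
      eq_sub_of_add_eq (pb_pb _ _ _).symm
    rw [jacobi]
    refine sub_mem ?_ ?_
    · rw [show i + 1 + j + 1 = i + j + 1 + 1 by omega]
      exact pb_ι_mem_wordSpan a (ih hy)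
    · rw [show i + 1 + j + 1 = i + (j + 1) + 1 by omega]
      exact ih (pb_ι_mem_wordSpan a hy)

/-- The span of the `A`-multiples of Lie words with `k` brackets and of the decomposable elements
of degree `k`; it turns out to be all of `P^k(A)`. -/
def wordDec (A : Type u) [CommRing A] [Algebra ℂ A] (k : ℕ) : Submodule ℂ (Env A) :=
  Submodule.span ℂ {z | ∃ (a : A) (w : Env A), IsWord k w ∧ ι A a * w = z} ⊔ dec A k

theorem dec_le_wordDec (k : ℕ) : dec A k ≤ wordDec A k := le_sup_right

theorem ι_mul_mem_wordDec_of_isWord {k : ℕ} (a : A) {w : Env A} (hw : IsWord k w) :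
    ι A a * w ∈ wordDec A k :=
  Submodule.mem_sup_left (Submodule.subset_span ⟨a, w, hw, rfl⟩)

theorem wordSpan_le_wordDec (k : ℕ) : wordSpan A k ≤ wordDec A k :=
  Submodule.span_le.2 fun w hw => by simpa using ι_mul_mem_wordDec_of_isWord (1 : A) hw

theorem wordDec_le_deg (k : ℕ) : wordDec A k ≤ deg A k := by
  refine sup_le (Submodule.span_le.2 ?_) (dec_le_deg k)
  rintro _ ⟨a, w, hw, rfl⟩
  exact ι_mul_mem_deg a hw.mem_deg

theorem ι_mul_mem_wordDec {k : ℕ} (a : A) {x : Env A} (hx : x ∈ wordDec A k) :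
    ι A a * x ∈ wordDec A k := by
  have h : wordDec A k ≤ (wordDec A k).comap (LinearMap.mul ℂ (Env A) (ι A a)) := by
    refine sup_le (Submodule.span_le.2 ?_) fun x hx => dec_le_wordDec k (ι_mul_mem_dec a hx)
    rintro _ ⟨b, w, hw, rfl⟩
    change ι A a * (ι A b * w) ∈ wordDec A k
    rw [← mul_assoc, ← map_mul]
    exact ι_mul_mem_wordDec_of_isWord _ hw
  exact h hx

theorem mul_mem_wordDec {i j k : ℕ} (h : i + j = k) {x y : Env A} (hx : x ∈ wordDec A i)
    (hy : y ∈ wordDec A j) : x * y ∈ wordDec A k := by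
  subst h
  match i, j with
  | 0, j =>
    obtain ⟨a, rfl⟩ := exists_ι_eq_of_mem_deg_zero (wordDec_le_deg 0 hx)
    simpa only [Nat.zero_add] using ι_mul_mem_wordDec a hy
  | i, 0 =>
    obtain ⟨a, rfl⟩ := exists_ι_eq_of_mem_deg_zero (wordDec_le_deg 0 hy)
    rw [mul_comm]
    exact ι_mul_mem_wordDec a hx
  | i + 1, j + 1 =>
    exact dec_le_wordDec _ (mul_mem_dec rfl (wordDec_le_deg _ hx) (wordDec_le_deg _ hy))

theorem IsWord.pb_ι_mul_mem_wordDec {i j k : ℕ} (h : i + j + 1 = k) (a b : A) {w v : Env A}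
    (hw : IsWord i w) (hv : IsWord j v) : NCGeom.pb (ι A a * w) (ι A b * v) ∈ wordDec A k := by
  have word_pb {l m n : ℕ} (h : l + m + 1 = n) {x y : Env A} (hx : IsWord l x) (hy : IsWord m y) :
      NCGeom.pb x y ∈ wordDec A n :=
    wordSpan_le_wordDec n (hx.pb_mem_wordSpan h hy.mem_wordSpan)
  have hw' : w ∈ wordDec A i := wordSpan_le_wordDec i hw.mem_wordSpan
  have hv' : v ∈ wordDec A j := wordSpan_le_wordDec j hv.mem_wordSpan
  rw [mul_pb, pb_mul, pb_mul]
  refine add_mem (ι_mul_mem_wordDec a (add_mem ?_ (ι_mul_mem_wordDec b (word_pb h hw hv))))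
    (mul_mem_wordDec (i := j + 1) (by omega) (add_mem ?_ (ι_mul_mem_wordDec b ?_)) hw')
  · exact mul_mem_wordDec (by omega) (word_pb rfl hw (.of b)) hv'
  · exact mul_mem_wordDec (by omega) (word_pb rfl (.of a) (.of b)) hv'
  · exact word_pb (by omega) (.of a) hv

theorem pb_mem_wordDec {i j : ℕ} {x y : Env A} (hx : x ∈ wordDec A i) (hy : y ∈ wordDec A j) :
    pb x y ∈ wordDec A (i + j + 1) := by
  have hxd := wordDec_le_deg i hx
  obtain ⟨y, hys, y', hy', rfl⟩ := Submodule.mem_sup.1 hy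
  have hyd : y ∈ deg A j := wordDec_le_deg j (Submodule.mem_sup_left hys)
  obtain ⟨x, hxs, x', hx', rfl⟩ := Submodule.mem_sup.1 hx
  rw [pb_add, add_pb]
  refine add_mem (add_mem ?_ (dec_le_wordDec _ (pb_mem_dec_of_mem_left rfl hx' hyd)))
    (dec_le_wordDec _ (pb_mem_dec_of_mem_right rfl hxd hy'))
  refine bilin_span PoissonAlgebra.bracket ?_ hxs hys
  rintro _ ⟨a, w, hw, rfl⟩ _ ⟨b, v, hv, rfl⟩
  exact hw.pb_ι_mul_mem_wordDec rfl a b hv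

theorem deg_le_wordDec (k : ℕ) : deg A k ≤ wordDec A k := by
  refine Submodule.span_le.2 fun x hx => ?_
  induction hx with
  | of a => exact wordSpan_le_wordDec 0 (IsWord.of a).mem_wordSpan
  | mul _ _ ihx ihy => exact mul_mem_wordDec rfl ihx ihy
  | pb _ _ ihx ihy => exact pb_mem_wordDec ihx ihy

end Words

end Env

/-! ### The canonical homomorphism from the Poisson envelope to the associated graded algebra -/

namespace Gr

variable {R : Type u} [Ring R] [Algebra ℂ R]

theorem mem_ncFil_zero (r : R) : r ∈ ncFil R 0 := by
  rw [ncFil_zero]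
  trivial

theorem ofRab_mk (r : R) : ofRab R (Ideal.Quotient.mk _ r) = symb R 0 ⟨r, mem_ncFil_zero r⟩ := rfl

theorem incl_injective (i : ℕ) : Function.Injective (incl R i) :=
  DirectSum.of_injective (β := fun i => GrPiece R i) i

theorem symb_eq_zero_iff {i : ℕ} {x : ncFil R i} : symb R i x = 0 ↔ (x : R) ∈ ncFil R (i + 1) := by
  refine ⟨fun h => ?_, symb_eq_zero⟩
  have h' : GrPiece.mk R i x = 0 := incl_injective i (h.trans (map_zero _).symm)
  exact (Submodule.Quotient.mk_eq_zero ((ncFil R (i + 1)).submoduleOf (ncFil R i))).1 h'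

theorem pb_symb (i j : ℕ) {x y : R} (hx : x ∈ ncFil R i) (hy : y ∈ ncFil R j) :
    pb (symb R i ⟨x, hx⟩) (symb R j ⟨y, hy⟩) =
      symb R (i + j + 1) ⟨x * y - y * x, comm_mem_ncFil hx hy⟩ :=
  bracket_symb i j hx hy

theorem symb_mem_deg {i : ℕ} (x : ncFil R i) : symb R i x ∈ deg R i := ⟨_, rfl⟩

theorem mem_deg_iff {i : ℕ} {z : Gr R} :
    z ∈ deg R i ↔ ∃ (x : R) (hx : x ∈ ncFil R i), symb R i ⟨x, hx⟩ = z := by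
  constructor
  · rintro ⟨y, rfl⟩
    obtain ⟨⟨x, hx⟩, rfl⟩ : ∃ z, GrPiece.mk R i z = y := Submodule.Quotient.mk_surjective _ y
    exact ⟨x, hx, rfl⟩
  · rintro ⟨x, hx, rfl⟩
    exact symb_mem_deg _

theorem mul_mem_deg {i j : ℕ} {y z : Gr R} (hy : y ∈ deg R i) (hz : z ∈ deg R j) :
    y * z ∈ deg R (i + j) := by
  obtain ⟨x, hx, rfl⟩ := mem_deg_iff.1 hy
  obtain ⟨x', hx', rfl⟩ := mem_deg_iff.1 hz
  rw [symb_mul]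
  exact symb_mem_deg _

theorem pb_mem_deg {i j : ℕ} {y z : Gr R} (hy : y ∈ deg R i) (hz : z ∈ deg R j) :
    pb y z ∈ deg R (i + j + 1) := by
  obtain ⟨x, hx, rfl⟩ := mem_deg_iff.1 hy
  obtain ⟨x', hx', rfl⟩ := mem_deg_iff.1 hz
  rw [pb_symb]
  exact symb_mem_deg _

theorem eq_zero_of_mem_deg {d i : ℕ} (hR : IsNCNilpotent d R) (hi : d < i) {z : Gr R}
    (hz : z ∈ deg R i) : z = 0 := by
  obtain ⟨x, hx, rfl⟩ := mem_deg_iff.1 hz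
  obtain rfl : x = 0 := by
    have h : x ∈ ncFil R (d + 1) := ncFil_antitone hi hx
    rwa [hR] at h
  exact map_zero _

variable (R) in
/-- The projection of `gr_F(R)` onto its component of degree `i`. -/
noncomputable def component (i : ℕ) : Gr R →ₗ[ℂ] GrPiece R i :=
  DirectSum.component ℂ ℕ (fun i => GrPiece R i) i

theorem component_incl (i : ℕ) (y : GrPiece R i) : component R i (incl R i y) = y :=
  DirectSum.component.lof_self ℂ i y

theorem component_eq_zero_of_ne {i j : ℕ} (h : i ≠ j) {z : Gr R} (hz : z ∈ deg R i) :
    component R j z = 0 := by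
  obtain ⟨y, rfl⟩ := hz
  exact (DirectSum.component.of ℂ j i y).trans (dif_neg h)

theorem eq_zero_of_component_eq_zero {i : ℕ} {z : Gr R} (hz : z ∈ deg R i)
    (h : component R i z = 0) : z = 0 := by
  obtain ⟨y, rfl⟩ := hz
  rw [component_incl] at h
  rw [h, map_zero]

variable (R) in
/-- The canonical homomorphism `P(R_ab) → gr_F(R)`. -/
noncomputable def envHom : Env (Rab R) →ₐ[ℂ] Gr R := Env.lift (ofRab R)

theorem envHom_pb (x y : Env (Rab R)) : envHom R (pb x y) = pb (envHom R x) (envHom R y) :=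
  Env.lift_pb _ _ _

theorem envHom_ι (a : Rab R) : envHom R (Env.ι _ a) = ofRab R a := rfl

theorem envHom_mem_deg_of_isExpr {i : ℕ} {x : Env (Rab R)} (hx : Env.IsExpr i x) :
    envHom R x ∈ deg R i := by
  induction hx with
  | of a =>
    obtain ⟨r, rfl⟩ := Ideal.Quotient.mk_surjective a
    exact symb_mem_deg _
  | mul _ _ ihx ihy =>
    rw [map_mul]
    exact mul_mem_deg ihx ihy
  | pb _ _ ihx ihy =>
    rw [envHom_pb]
    exact pb_mem_deg ihx ihy

theorem envHom_mem_deg {i : ℕ} {x : Env (Rab R)} (hx : x ∈ Env.deg (Rab R) i) :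
    envHom R x ∈ deg R i := by
  have h : Env.deg (Rab R) i ≤ (LinearMap.range (incl R i)).comap (envHom R).toLinearMap :=
    Submodule.span_le.2 fun _ => envHom_mem_deg_of_isExpr
  exact h hx

variable (R) in
/-- The elements of `F^i R` whose symbol comes from `P^i(R_ab)`; they turn out to be all
of `F^i R`. -/
noncomputable def symbolsFromEnv (i : ℕ) : Submodule ℂ R :=
  (((Env.deg (Rab R) i).map (envHom R).toLinearMap).comap (symb R i)).map (ncFil R i).subtype

theorem mem_symbolsFromEnv {i : ℕ} {x : R} : x ∈ symbolsFromEnv R i ↔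
    ∃ hx : x ∈ ncFil R i, ∃ y ∈ Env.deg (Rab R) i, envHom R y = symb R i ⟨x, hx⟩ :=
  ⟨fun ⟨x, hx, h⟩ => h ▸ ⟨x.2, hx⟩, fun ⟨hx, h⟩ => ⟨⟨x, hx⟩, h, rfl⟩⟩

theorem lieTerm_le_symbolsFromEnv (k : ℕ) : lieTerm R k ≤ symbolsFromEnv R k := by
  induction k with
  | zero =>
    exact fun x _ => mem_symbolsFromEnv.2
      ⟨mem_ncFil_zero x, Env.ι _ (Ideal.Quotient.mk _ x), Env.ι_mem_deg _, rfl⟩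
  | succ k ih =>
    rw [lieTerm_succ, Submodule.span_le]
    rintro _ ⟨x, y, hy, rfl⟩
    obtain ⟨hy', w, hw, h⟩ := mem_symbolsFromEnv.1 (ih hy)
    have hxy : x * y - y * x ∈ ncFil R (k + 1) := by
      simpa only [Nat.zero_add] using comm_mem_ncFil (mem_ncFil_zero x) hy'
    refine mem_symbolsFromEnv.2 ⟨hxy, pb (Env.ι _ (Ideal.Quotient.mk _ x)) w,
      Env.pb_mem_deg (by omega) (Env.ι_mem_deg _) hw, ?_⟩
    rw [envHom_pb, h, envHom_ι, ofRab_mk, pb_symb]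
    exact symb_congr (by omega) _ _ rfl

theorem symbolsFromEnv_mul_le (i j : ℕ) :
    symbolsFromEnv R i * symbolsFromEnv R j ≤ symbolsFromEnv R (i + j) := by
  refine Submodule.mul_le.2 fun x hx y hy => ?_
  obtain ⟨hx', v, hv, hvx⟩ := mem_symbolsFromEnv.1 hx
  obtain ⟨hy', w, hw, hwy⟩ := mem_symbolsFromEnv.1 hy
  refine mem_symbolsFromEnv.2 ⟨mul_mem_ncFil hx' hy', v * w, Env.mul_mem_deg rfl hv hw, ?_⟩
  rw [map_mul, hvx, hwy, symb_mul]

theorem exists_envHom_eq {i : ℕ} {z : Gr R} (hz : z ∈ deg R i) :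
    ∃ x ∈ Env.deg (Rab R) i, envHom R x = z := by
  obtain ⟨x, hx, rfl⟩ := mem_deg_iff.1 hz
  have hle : ncFil R i ≤ symbolsFromEnv R i :=
    ncFil_le (symbolsFromEnv R) lieTerm_le_symbolsFromEnv symbolsFromEnv_mul_le i
  obtain ⟨_, h⟩ := mem_symbolsFromEnv.1 (hle hx)
  exact h

theorem envHom_image_deg (i : ℕ) : envHom R '' Env.deg (Rab R) i = deg R i :=
  Set.Subset.antisymm (Set.image_subset_iff.2 fun _ => envHom_mem_deg) fun _ => exists_envHom_eq

theorem envHom_surjective : Function.Surjective (envHom R) := fun z => by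
  refine Gr.induct z (fun i x hx => ?_) ?_
  · obtain ⟨y, _, h⟩ := exists_envHom_eq (symb_mem_deg ⟨x, hx⟩)
    exact ⟨y, h⟩
  · rintro _ _ ⟨x, rfl⟩ ⟨y, rfl⟩
    exact ⟨x + y, map_add _ _ _⟩

theorem envHom_eq_zero_of_mem_ge {d : ℕ} (hR : IsNCNilpotent d R) {x : Env (Rab R)}
    (hx : x ∈ Env.ge (Rab R) (d + 1)) : envHom R x = 0 := by
  have h : Env.geSpace (Rab R) (d + 1) ≤ LinearMap.ker (envHom R).toLinearMap :=
    iSup₂_le fun i hi y hy => eq_zero_of_mem_deg hR hi (envHom_mem_deg hy)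
  exact h hx

theorem mem_ge_of_envHom_eq_zero {m : ℕ}
    (hinj : ∀ i < m, ∀ x ∈ Env.deg (Rab R) i, envHom R x = 0 → x = 0) {x : Env (Rab R)}
    (hx : envHom R x = 0) : x ∈ Env.ge (Rab R) m := by
  have hsup : x ∈ ⨆ i, Env.deg (Rab R) i := by
    simpa only [Env.geSpace, Nat.zero_le, iSup_pos] using Env.mem_geSpace_zero x
  obtain ⟨f, hf, rfl⟩ := (Submodule.mem_iSup_iff_exists_finsupp _ _).1 hsup
  have hcomp : ∀ j ∈ f.support, component R j (envHom R (f j)) = 0 := fun j hj => by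
    have h := congrArg (component R j) hx
    rw [Finsupp.sum, map_sum, map_sum, map_zero, Finset.sum_eq_single j] at h
    · exact h
    · exact fun i _ hij => component_eq_zero_of_ne hij (envHom_mem_deg (hf i))
    · exact fun h' => absurd hj h'
  refine Ideal.sum_mem _ fun j hj => ?_
  obtain hjm | hjm := le_or_gt m j
  · exact le_iSup₂_of_le (f := fun i (_ : m ≤ i) => Env.deg (Rab R) i) j hjm le_rfl (hf j)
  · rw [hinj j hjm _ (hf j)
      (eq_zero_of_component_eq_zero (envHom_mem_deg (hf j)) (hcomp j hj))]
    exact zero_mem _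

/-- The isomorphism `P(R_ab)/P^{≥ d+1}(R_ab) → gr_F(R)` induced by `envHom`, if the latter is
injective in the degrees `≤ d`. -/
noncomputable def envEquiv {d : ℕ} (hR : IsNCNilpotent d R)
    (hinj : ∀ i < d + 1, ∀ x ∈ Env.deg (Rab R) i, envHom R x = 0 → x = 0) :
    (Env (Rab R) ⧸ Env.ge (Rab R) (d + 1)) ≃ₐ[ℂ] Gr R :=
  AlgEquiv.ofBijective
    (Ideal.Quotient.liftₐ (Env.ge (Rab R) (d + 1)) (envHom R)
      fun _ hx => envHom_eq_zero_of_mem_ge hR hx)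
    ⟨(injective_iff_map_eq_zero _).2 <| Ideal.Quotient.mk_surjective.forall.2 fun _ hx =>
        Ideal.Quotient.eq_zero_iff_mem.2 (mem_ge_of_envHom_eq_zero hinj hx),
      fun z => (envHom_surjective z).imp' (Ideal.Quotient.mk _) fun _ => id⟩

theorem envEquiv_pb {d : ℕ} (hR : IsNCNilpotent d R)
    (hinj : ∀ i < d + 1, ∀ x ∈ Env.deg (Rab R) i, envHom R x = 0 → x = 0)
    (x y : Env (Rab R) ⧸ Env.ge (Rab R) (d + 1)) :
    envEquiv hR hinj (pb x y) = pb (envEquiv hR hinj x) (envEquiv hR hinj y) := by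
  obtain ⟨x, rfl⟩ := Ideal.Quotient.mk_surjective x
  obtain ⟨y, rfl⟩ := Ideal.Quotient.mk_surjective y
  exact envHom_pb x y

theorem comp_mk_eq_envHom {m : ℕ} {e : (Env (Rab R) ⧸ Env.ge (Rab R) m) →ₐ[ℂ] Gr R}
    (hpb : ∀ x y, e (pb x y) = pb (e x) (e y))
    (hι : ∀ a, e (Ideal.Quotient.mk _ (Env.ι (Rab R) a)) = ofRab R a) :
    e.comp (Ideal.Quotient.mkₐ ℂ (Env.ge (Rab R) m)) = envHom R :=
  Env.hom_ext (fun x y => hpb (Ideal.Quotient.mk _ x) (Ideal.Quotient.mk _ y)) envHom_pb hι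

end Gr

/-! ### The free Lie algebra of a module -/

namespace FreeLie

section Lift

variable {A M : Type u} [CommRing A] [AddCommGroup M] [Module A M]
variable {L : Type*} [LieRing L] [LieAlgebra A L] (f : M →ₗ[A] L)

theorem freeLieRel_le_ker : freeLieRel A M ≤ (FreeLieAlgebra.lift A f).ker := by
  refine LieSubmodule.lieSpan_le.2 ?_
  rintro z (⟨m, n, rfl⟩ | ⟨a, m, rfl⟩) <;> simp [LieHom.mem_ker]

/-- The homomorphism of Lie algebras `Lie_A(M) → L` which extends an `A`-linear map `M → L`. -/
noncomputable def lift : FreeLie A M →ₗ⁅A⁆ L where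
  toLinearMap := Submodule.liftQ (freeLieRel A M).toSubmodule
    (FreeLieAlgebra.lift A f : FreeLieAlgebra A M →ₗ[A] L)
    fun _ hx => LieHom.mem_ker.1 (freeLieRel_le_ker f hx)
  map_lie' {x y} := by
    obtain ⟨x, rfl⟩ := Quotient.mk_surjective x
    obtain ⟨y, rfl⟩ := Quotient.mk_surjective y
    exact (FreeLieAlgebra.lift A f).map_lie x y

theorem lift_of (m : M) : lift f (of A M m) = f m := FreeLieAlgebra.lift_of_apply f m

end Lift

section Deg

variable (A M : Type u) [CommRing A] [AddCommGroup M] [Module A M]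

/-- The inclusion of the generators as a linear map onto the first component of `Lie_A(M)`. -/
noncomputable def ofDeg : M →ₗ[A] deg A M 0 where
  toFun m := ⟨of A M m, Submodule.subset_span ⟨m, rfl⟩⟩
  map_add' m n := Subtype.ext <| (Submodule.Quotient.eq (freeLieRel A M).toSubmodule).2
    (LieSubmodule.subset_lieSpan (Or.inl ⟨m, n, rfl⟩))
  map_smul' a m := Subtype.ext <| (Submodule.Quotient.eq (freeLieRel A M).toSubmodule).2
    (LieSubmodule.subset_lieSpan (Or.inr ⟨a, m, rfl⟩))

variable {A M}

theorem coe_ofDeg (m : M) : (ofDeg A M m : FreeLie A M) = of A M m := rfl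

theorem of_mem_deg (m : M) : of A M m ∈ deg A M 0 := (ofDeg A M m).2

theorem exists_of_eq {u : FreeLie A M} (hu : u ∈ deg A M 0) : ∃ m, of A M m = u := by
  have h : deg A M 0 ≤ LinearMap.range ((deg A M 0).subtype ∘ₗ ofDeg A M) :=
    Submodule.span_le.2 fun _ h => h
  exact h hu

theorem of_lie_mem_deg (m : M) {k : ℕ} {y : FreeLie A M} (hy : y ∈ deg A M k) :
    ⁅of A M m, y⁆ ∈ deg A M (k + 1) :=
  Submodule.subset_span ⟨m, y, hy, rfl⟩

theorem deg_le {N : ℕ → Submodule A (FreeLie A M)} (of_mem : ∀ m, of A M m ∈ N 0)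
    (lie_mem : ∀ k m, ∀ y ∈ deg A M k, y ∈ N k → ⁅of A M m, y⁆ ∈ N (k + 1)) (k : ℕ) :
    deg A M k ≤ N k := by
  induction k with
  | zero =>
    refine Submodule.span_le.2 ?_
    rintro _ ⟨m, rfl⟩
    exact of_mem m
  | succ k ih =>
    refine Submodule.span_le.2 ?_
    rintro _ ⟨m, y, hy, rfl⟩
    exact lie_mem k m y hy (ih hy)

theorem lie_mem_deg {j k n : ℕ} (h : j + k + 1 = n) {x y : FreeLie A M} (hx : x ∈ deg A M j)
    (hy : y ∈ deg A M k) : ⁅x, y⁆ ∈ deg A M n := by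
  induction j generalizing k n x y with
  | zero =>
    obtain ⟨m, rfl⟩ := exists_of_eq hx
    rw [← h, Nat.zero_add]
    exact of_lie_mem_deg m hy
  | succ j ih =>
    refine Submodule.span_induction (p := fun x _ => ⁅x, y⁆ ∈ deg A M n) ?_
      (by rw [zero_lie]; exact zero_mem _)
      (fun _ _ _ _ hx hx' => by rw [add_lie]; exact add_mem hx hx')
      (fun a _ _ hx => by rw [smul_lie]; exact Submodule.smul_mem _ a hx) hx
    rintro _ ⟨m, x, hx, rfl⟩
    obtain rfl : n = j + k + 1 + 1 := by omega
    rw [lie_lie]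
    exact sub_mem (of_lie_mem_deg m (ih rfl hx hy)) (ih (by omega) hx (of_lie_mem_deg m hy))

/-- The Lie bracket between the graded components of `Lie_A(M)`. The degree `n` of the result is
a parameter in order to avoid casts. -/
noncomputable def lieDeg {j k n : ℕ} (h : j + k + 1 = n) :
    deg A M j →ₗ[A] deg A M k →ₗ[A] deg A M n :=
  LinearMap.mk₂ A (fun x y => ⟨⁅(x : FreeLie A M), (y : FreeLie A M)⁆, lie_mem_deg h x.2 y.2⟩)
    (fun _ _ _ => Subtype.ext (add_lie _ _ _)) (fun _ _ _ => Subtype.ext (smul_lie _ _ _))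
    (fun _ _ _ => Subtype.ext (lie_add _ _ _)) (fun _ _ _ => Subtype.ext (lie_smul _ _ _))

theorem coe_lieDeg {j k n : ℕ} (h : j + k + 1 = n) (x : deg A M j) (y : deg A M k) :
    (lieDeg h x y : FreeLie A M) = ⁅(x : FreeLie A M), (y : FreeLie A M)⁆ := rfl

theorem deg_hom_ext {N : Type*} [AddCommGroup N] [Module A N] {f g : ∀ k, deg A M k →ₗ[A] N}
    (hof : ∀ m, f 0 (ofDeg A M m) = g 0 (ofDeg A M m))
    (hlie : ∀ k m (y : deg A M k), f k y = g k y → f (k + 1) (lieDeg (by omega) (ofDeg A M m) y) =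
      g (k + 1) (lieDeg (by omega) (ofDeg A M m) y)) (k : ℕ) : f k = g k := by
  have hle : deg A M k ≤ ((f k).eqLocus (g k)).map (deg A M k).subtype :=
    deg_le (N := fun k => ((f k).eqLocus (g k)).map (deg A M k).subtype)
      (fun m => ⟨ofDeg A M m, hof m, rfl⟩)
      (fun k m _ _ ⟨y, hy, e⟩ =>
        ⟨lieDeg (by omega) (ofDeg A M m) y, hlie k m y hy, by rw [← e]; rfl⟩) k
  refine LinearMap.ext fun x => ?_
  obtain ⟨y, hy, e⟩ := hle x.2
  obtain rfl : y = x := Subtype.ext e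
  exact hy

end Deg

section ToTensor

attribute [local instance] LieRing.ofAssociativeRing

variable (A M : Type u) [CommRing A] [AddCommGroup M] [Module A M]

/-- The homomorphism from the free Lie algebra to the tensor algebra with the commutator
bracket. -/
noncomputable def toTensor : FreeLie A M →ₗ[A] TensorAlgebra A M :=
  (lift (TensorAlgebra.ι A) : FreeLie A M →ₗ⁅A⁆ TensorAlgebra A M)

variable {A M}

theorem toTensor_of (m : M) : toTensor A M (of A M m) = TensorAlgebra.ι A m := lift_of _ m

theorem toTensor_lie (x y : FreeLie A M) : toTensor A M ⁅x, y⁆ =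
    toTensor A M x * toTensor A M y - toTensor A M y * toTensor A M x :=
  (lift (TensorAlgebra.ι A) : FreeLie A M →ₗ⁅A⁆ TensorAlgebra A M).map_lie x y

end ToTensor

section Rep

variable (A M : Type u) [CommRing A] [AddCommGroup M] [Module A M]

/-- The direct sum of the graded components of `Lie_A(M)`. They are independent as submodules of
`Lie_A(M)`, but the external sum spares the proof of this. -/
abbrev Graded : Type u := DirectSum ℕ fun k => deg A M k

/-- The extension `Lie_A(M) ⊕ A` of the graded free Lie algebra by its Euler derivation. -/
abbrev GradedExt : Type u := Graded A M × A

variable {A M}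

/-- The inclusion of the component with index `k` into the graded free Lie algebra. -/
noncomputable abbrev lof (k : ℕ) : deg A M k →ₗ[A] Graded A M :=
  DirectSum.lof A ℕ (fun k => deg A M k) k

theorem lof_congr {j k : ℕ} (h : j = k) {x : deg A M j} {y : deg A M k}
    (e : (x : FreeLie A M) = y) : lof j x = lof k y := by
  subst h
  rw [Subtype.ext e]

/-- The adjoint action of a graded component on the graded free Lie algebra. -/
noncomputable def adGraded (j : ℕ) : deg A M j →ₗ[A] Module.End A (Graded A M) :=
  (DirectSum.toModule A ℕ (deg A M j →ₗ[A] Graded A M) fun k =>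
    ((lieDeg rfl).compr₂ (lof (j + k + 1))).flip).flip

theorem adGraded_lof {j k n : ℕ} (h : j + k + 1 = n) (x : deg A M j) (y : deg A M k) :
    adGraded j x (lof k y) = lof n (lieDeg h x y) := by
  subst h
  exact LinearMap.congr_fun (DirectSum.toModule_lof ..) x

theorem adGraded_lieDeg {i j n : ℕ} (h : i + j + 1 = n) (x : deg A M i) (y : deg A M j) :
    adGraded n (lieDeg h x y) = adGraded i x * adGraded j y - adGraded j y * adGraded i x := by
  refine DirectSum.linearMap_ext A fun k => LinearMap.ext fun z => ?_
  simp only [LinearMap.comp_apply, LinearMap.sub_apply, Module.End.mul_apply]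
  rw [adGraded_lof rfl _ z, adGraded_lof rfl _ z, adGraded_lof rfl _ z,
    adGraded_lof (by omega : i + (j + k + 1) + 1 = n + k + 1),
    adGraded_lof (by omega : j + (i + k + 1) + 1 = n + k + 1), ← map_sub]
  exact lof_congr rfl (lie_lie _ _ _)

/-- The action of a graded component of `Lie_A(M)` on `Lie_A(M) ⊕ A`, in which `A` is spanned by
the negative of the Euler derivation. -/
noncomputable def repDeg (k : ℕ) : deg A M k →ₗ[A] Module.End A (GradedExt A M) :=
  LinearMap.mk₂ A (fun x n => (adGraded k x n.1 + (((k : A) + 1) * n.2) • lof k x, 0))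
    (fun x x' n => Prod.ext
      (by simp only [map_add, LinearMap.add_apply, smul_add, Prod.fst_add]; abel)
      (add_zero _).symm)
    (fun a x n => Prod.ext
      (by simp only [map_smul, LinearMap.smul_apply, smul_add, Prod.smul_fst, smul_comm a])
      (smul_zero _).symm)
    (fun x n n' => Prod.ext
      (by simp only [map_add, Prod.fst_add, Prod.snd_add, mul_add, add_smul]; abel)
      (add_zero _).symm)
    (fun a x n => Prod.ext
      (by simp only [map_smul, Prod.smul_fst, Prod.smul_snd, smul_add, mul_smul_comm, smul_assoc])
      (smul_zero _).symm)

theorem repDeg_apply {k : ℕ} (x : deg A M k) (n : GradedExt A M) :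
    repDeg k x n = (adGraded k x n.1 + (((k : A) + 1) * n.2) • lof k x, 0) := rfl

theorem repDeg_lieDeg {i j n : ℕ} (h : i + j + 1 = n) (x : deg A M i) (y : deg A M j) :
    repDeg n (lieDeg h x y) = repDeg i x * repDeg j y - repDeg j y * repDeg i x := by
  have skew : adGraded j y (lof i x) = -lof n (lieDeg h x y) := by
    rw [adGraded_lof (by omega : j + i + 1 = n), ← map_neg]
    exact lof_congr rfl (lie_skew _ _).symm
  refine LinearMap.ext fun l => Prod.ext ?_ (sub_zero _).symm
  simp only [LinearMap.sub_apply, Module.End.mul_apply, repDeg_apply, Prod.fst_sub,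
    adGraded_lieDeg h, map_add, map_smul, skew, adGraded_lof h, mul_zero, zero_smul, add_zero]
  subst h
  push_cast
  module

end Rep

end FreeLie

/-! ### Derivations of symmetric algebras -/

section SymDerivation

variable {A N : Type*} [CommRing A] [AddCommGroup N] [Module A N]

/-- The homomorphism `x ↦ x + ε D x` from the symmetric algebra to its dual numbers, where `D` is
the derivation which extends a linear map `h` on the generators. -/
noncomputable def symDual (h : Module.End A N) :
    SymmetricAlgebra A N →ₐ[A] DualNumber (SymmetricAlgebra A N) :=
  SymmetricAlgebra.lift
    ((TrivSqZeroExt.inlAlgHom A (SymmetricAlgebra A N) (SymmetricAlgebra A N)).toLinearMap ∘ₗ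
        SymmetricAlgebra.ι A N +
      (TrivSqZeroExt.inrHom (SymmetricAlgebra A N) (SymmetricAlgebra A N)).restrictScalars A ∘ₗ
        SymmetricAlgebra.ι A N ∘ₗ h)

theorem fst_symDual (h : Module.End A N) (x : SymmetricAlgebra A N) : (symDual h x).fst = x := by
  have e : (TrivSqZeroExt.fstHom A (SymmetricAlgebra A N) (SymmetricAlgebra A N)).comp
      (symDual h) = AlgHom.id A _ := by
    refine SymmetricAlgebra.algHom_ext (LinearMap.ext fun n => ?_)
    simp [symDual]
  exact DFunLike.congr_fun e x

theorem symAlg_derivation_ext {D E : Derivation A (SymmetricAlgebra A N) (SymmetricAlgebra A N)}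
    (h : ∀ n, D (SymmetricAlgebra.ι A N n) = E (SymmetricAlgebra.ι A N n)) : D = E := by
  refine Derivation.ext fun x => ?_
  induction x using SymmetricAlgebra.induction with
  | algebraMap a => rw [D.map_algebraMap, E.map_algebraMap]
  | ι n => exact h n
  | mul x y hx hy => rw [D.leibniz, E.leibniz, hx, hy]
  | add x y hx hy => rw [map_add, map_add, hx, hy]

/-- The derivation of the symmetric algebra which extends an endomorphism of the module of
generators. -/
noncomputable def symDerivation :
    Module.End A N →ₗ[A] Derivation A (SymmetricAlgebra A N) (SymmetricAlgebra A N) where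
  toFun h := Derivation.mk' ((TrivSqZeroExt.sndHom _ _).restrictScalars A ∘ₗ
    (symDual h).toLinearMap) fun x y => by simp [fst_symDual, mul_comm]
  map_add' h h' := symAlg_derivation_ext fun n => by simp [symDual]
  map_smul' a h := symAlg_derivation_ext fun n => by simp [symDual]

theorem symDerivation_ι (h : Module.End A N) (n : N) :
    symDerivation h (SymmetricAlgebra.ι A N n) = SymmetricAlgebra.ι A N (h n) := by
  simp [symDerivation, symDual]

theorem symDerivation_commutator (h h' : Module.End A N) :
    symDerivation (h * h' - h' * h) = ⁅symDerivation h, symDerivation h'⁆ :=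
  symAlg_derivation_ext fun n => by
    simp only [symDerivation_ι, Derivation.commutator_apply, LinearMap.sub_apply,
      Module.End.mul_apply, map_sub (SymmetricAlgebra.ι A N)]

end SymDerivation

section PowDvd

variable {A B : Type*} [CommRing A] [CommRing B] [Algebra A B] (D : Derivation A B B)

theorem pow_dvd_derivation {x y : B} {n : ℕ} (h : x ^ (n + 1) ∣ y) : x ^ n ∣ D y := by
  obtain ⟨b, rfl⟩ := h
  rw [D.leibniz, D.leibniz_pow, Nat.add_sub_cancel, pow_succ, smul_eq_mul, smul_eq_mul,
    smul_eq_mul, nsmul_eq_mul]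
  exact ⟨x * D b + b * ((n + 1 : ℕ) * D x), by ring⟩

theorem pow_dvd_derivation_sub {x y q : B} {m n : ℕ}
    (h : x ^ (n + 1 + 1) ∣ y - m * (q * x ^ (n + 1))) :
    x ^ (n + 1) ∣ D y - ((n + 1) * m : ℕ) * (D x * q * x ^ n) := by
  have hD : D (m * (q * x ^ (n + 1))) =
      ((n + 1) * m : ℕ) * (D x * q * x ^ n) + x ^ (n + 1) * (m * D q) := by
    rw [← nsmul_eq_mul, map_nsmul, D.leibniz, D.leibniz_pow, Nat.add_sub_cancel]
    simp only [smul_eq_mul, nsmul_eq_mul]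
    push_cast
    ring
  have hy := pow_dvd_derivation D h
  rw [map_sub, hD, ← sub_sub] at hy
  exact (dvd_sub_left (dvd_mul_right _ _)).1 hy

end PowDvd

/-! ### Operator symbols on the tensor algebra -/

namespace FreeLie

section SymRep

variable {A M : Type u} [CommRing A] [AddCommGroup M] [Module A M]

/-- The action of a graded component of `Lie_A(M)` on the symmetric algebra of `Lie_A(M) ⊕ A`. -/
noncomputable def symRepDeg (k : ℕ) :
    deg A M k →ₗ[A] Module.End A (SymmetricAlgebra A (GradedExt A M)) where
  toFun x := symDerivation (repDeg k x)
  map_add' x y := by rw [map_add, map_add, Derivation.coe_add_linearMap]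
  map_smul' a x := by rw [map_smul, map_smul, Derivation.coe_smul_linearMap, RingHom.id_apply]

theorem symRepDeg_lieDeg {i j n : ℕ} (h : i + j + 1 = n) (x : deg A M i) (y : deg A M j) :
    symRepDeg n (lieDeg h x y) =
      symRepDeg i x * symRepDeg j y - symRepDeg j y * symRepDeg i x := by
  refine LinearMap.ext fun b => ?_
  change symDerivation (repDeg n (lieDeg h x y)) b = _
  rw [repDeg_lieDeg h, symDerivation_commutator]
  rfl

variable (A M) in
/-- The action of the tensor algebra on the symmetric algebra of `Lie_A(M) ⊕ A`, in which the
elements of `M` act by derivations. -/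
noncomputable def symRep :
    TensorAlgebra A M →ₐ[A] Module.End A (SymmetricAlgebra A (GradedExt A M)) :=
  TensorAlgebra.lift A (symRepDeg 0 ∘ₗ ofDeg A M)

theorem symRep_toTensor {k : ℕ} (x : deg A M k) :
    symRep A M (toTensor A M x) = symRepDeg k x := by
  have hι : ∀ m, symRep A M (TensorAlgebra.ι A m) = symRepDeg 0 (ofDeg A M m) :=
    TensorAlgebra.lift_ι_apply _
  refine LinearMap.congr_fun (deg_hom_ext
    (f := fun k => (symRep A M).toLinearMap ∘ₗ toTensor A M ∘ₗ (deg A M k).subtype)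
    (g := symRepDeg) (fun m => ?_) (fun k m y hy => ?_) k) x
  · simpa only [LinearMap.comp_apply, Submodule.subtype_apply, AlgHom.toLinearMap_apply, coe_ofDeg,
      toTensor_of] using hι m
  · simp only [LinearMap.comp_apply, Submodule.subtype_apply, AlgHom.toLinearMap_apply] at hy ⊢
    rw [coe_lieDeg, toTensor_lie, coe_ofDeg, toTensor_of, map_sub, map_mul, map_mul, hι, hy,
      symRepDeg_lieDeg]

theorem symRep_toTensor_eq_derivation {k : ℕ} (x : deg A M k)
    (b : SymmetricAlgebra A (GradedExt A M)) :
    symRep A M (toTensor A M x) b = symDerivation (repDeg k x) b := by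
  rw [symRep_toTensor]
  rfl

/-- The variable of the summand `A` in the symmetric algebra of `Lie_A(M) ⊕ A`. -/
noncomputable abbrev xi : SymmetricAlgebra A (GradedExt A M) :=
  SymmetricAlgebra.ι A (GradedExt A M) (0, 1)

theorem symDerivation_repDeg_xi {k : ℕ} (x : deg A M k) :
    symDerivation (repDeg k x) xi =
      SymmetricAlgebra.ι A (GradedExt A M) (((k : A) + 1) • lof k x, 0) := by
  rw [symDerivation_ι, repDeg_apply, map_zero, zero_add, mul_one]

variable (A M) in
/-- The span of the products of Lie elements of the tensor algebra, of the degrees listed in `l`. -/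
noncomputable def lieProd (l : List ℕ) : Submodule A (TensorAlgebra A M) :=
  (l.map fun k => (deg A M k).map (toTensor A M)).prod

theorem lieProd_cons (k : ℕ) (l : List ℕ) :
    lieProd A M (k :: l) = (deg A M k).map (toTensor A M) * lieProd A M l := by
  rw [lieProd, List.map_cons, List.prod_cons, lieProd]

theorem xi_pow_dvd_symRep {l : List ℕ} {v : TensorAlgebra A M} (hv : v ∈ lieProd A M l) {n : ℕ}
    {b : SymmetricAlgebra A (GradedExt A M)} (hb : xi ^ (l.length + n) ∣ b) :
    xi ^ n ∣ symRep A M v b := by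
  induction l generalizing v n with
  | nil =>
    obtain ⟨a, rfl⟩ := Submodule.mem_one.1 hv
    rw [List.length_nil, Nat.zero_add] at hb
    rw [AlgHom.commutes, Module.algebraMap_end_apply]
    exact dvd_smul_of_dvd a hb
  | cons k l ih =>
    rw [lieProd_cons] at hv
    induction hv using Submodule.mul_induction_on' with
    | mem_mul_mem u hu v hv =>
      obtain ⟨u, hu, rfl⟩ := hu
      rw [map_mul, Module.End.mul_apply, symRep_toTensor_eq_derivation ⟨u, hu⟩]
      refine pow_dvd_derivation _ (ih hv ?_)
      rwa [← Nat.add_assoc, Nat.add_right_comm]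
    | add v _ w _ hv hw =>
      rw [map_add]
      exact dvd_add hv hw

end SymRep

section OpSymbol

variable {A M : Type u} [CommRing A] [Algebra ℂ A] [AddCommGroup M] [Module A M]

variable (A) in
/-- The inverse of `n + 1` in `A`. -/
noncomputable def invSucc (n : ℕ) : A := algebraMap ℂ A ((n : ℂ) + 1)⁻¹

theorem invSucc_mul (n : ℕ) : invSucc A n * ((n : A) + 1) = 1 := by
  have h : ((n : A) + 1) = algebraMap ℂ A ((n : ℂ) + 1) := by
    rw [map_add, map_natCast, map_one]
  rw [h, invSucc, ← map_mul, inv_mul_cancel₀ (Nat.cast_add_one_ne_zero n), map_one]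

variable (A M) in
/-- The projection of `Lie_A(M) ⊕ A` onto `Lie_+(M)`, divided by the degree in each component. -/
noncomputable def projPlus : GradedExt A M →ₗ[A] LiePlus A M :=
  (DirectSum.toModule A ℕ (LiePlus A M) fun k => match k with
    | 0 => 0
    | k + 1 => invSucc A (k + 1) • DirectSum.lof A ℕ (fun k => deg A M (k + 1)) k) ∘ₗ
    LinearMap.fst A (Graded A M) A

theorem projPlus_lof {k : ℕ} (u : deg A M (k + 1)) :
    projPlus A M ((((k + 1 : ℕ) : A) + 1) • lof (k + 1) u, 0) =
      DirectSum.lof A ℕ (fun k => deg A M (k + 1)) k u := by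
  rw [projPlus, LinearMap.comp_apply, LinearMap.fst_apply, map_smul, DirectSum.toModule_lof,
    LinearMap.smul_apply, smul_smul, mul_comm, invSucc_mul, one_smul]

variable (A M) in
/-- The evaluation at `xi = 0` followed by the normalized projection to the symmetric algebra of
`Lie_+(M)`. -/
noncomputable def symProj :
    SymmetricAlgebra A (GradedExt A M) →ₐ[A] SymmetricAlgebra A (LiePlus A M) :=
  SymmetricAlgebra.lift (SymmetricAlgebra.ι A _ ∘ₗ projPlus A M)

theorem symProj_ι (n : GradedExt A M) :
    symProj A M (SymmetricAlgebra.ι A _ n) = SymmetricAlgebra.ι A _ (projPlus A M n) :=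
  SymmetricAlgebra.lift_ι_apply _ _

theorem symProj_xi : symProj A M xi = 0 := by
  have h : projPlus A M (0, 1) = 0 := by
    rw [projPlus, LinearMap.comp_apply, LinearMap.fst_apply, map_zero]
  rw [symProj_ι, h, map_zero]

theorem symProj_eq_zero_of_dvd {n : ℕ} {b : SymmetricAlgebra A (GradedExt A M)}
    (h : xi ^ (n + 1) ∣ b) : symProj A M b = 0 := by
  obtain ⟨c, rfl⟩ := h
  rw [map_mul, map_pow, symProj_xi, zero_pow n.succ_ne_zero, zero_mul]

/-- The generator of the symmetric algebra of `Lie_+(M)` which belongs to an element of the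
component with index `k + 1` of the free Lie algebra. -/
noncomputable def gen (k : ℕ) : deg A M (k + 1) →ₗ[A] SymmetricAlgebra A (LiePlus A M) :=
  SymmetricAlgebra.ι A (LiePlus A M) ∘ₗ DirectSum.lof A ℕ (fun k => deg A M (k + 1)) k

theorem symProj_symDerivation_xi {k : ℕ} (u : deg A M (k + 1)) :
    symProj A M (symDerivation (repDeg (k + 1) u) xi) = gen k u := by
  rw [symDerivation_repDeg_xi, symProj_ι, projPlus_lof]
  rfl

variable (A M) in
/-- The operator symbol of order `s` on the tensor algebra: the coefficient of the lowest power
of `xi` in the result of the operation on `xi ^ s`. -/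
noncomputable def opSymbol (s : ℕ) :
    TensorAlgebra A M →ₗ[A] SymmetricAlgebra A (LiePlus A M) :=
  (symProj A M).toLinearMap ∘ₗ LinearMap.applyₗ (xi ^ s) ∘ₗ (symRep A M).toLinearMap

theorem opSymbol_apply (s : ℕ) (t : TensorAlgebra A M) :
    opSymbol A M s t = symProj A M (symRep A M t (xi ^ s)) := rfl

theorem opSymbol_eq_zero {l : List ℕ} {v : TensorAlgebra A M} (hv : v ∈ lieProd A M l) {s : ℕ}
    (h : l.length < s) : opSymbol A M s v = 0 := by
  obtain ⟨n, rfl⟩ := Nat.exists_eq_add_of_lt h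
  exact symProj_eq_zero_of_dvd (xi_pow_dvd_symRep hv (n := n + 1) dvd_rfl)

variable (A M) in
/-- The pairs of a Lie element of the tensor algebra and the corresponding generator of the
symmetric algebra of `Lie_+(M)`. -/
noncomputable def genPair (k : ℕ) :
    Submodule A (TensorAlgebra A M × SymmetricAlgebra A (LiePlus A M)) :=
  LinearMap.range ((toTensor A M ∘ₗ (deg A M (k + 1)).subtype).prod (gen k))

theorem exists_symRep_sub_descFactorial_dvd {l : List ℕ}
    {p : TensorAlgebra A M × SymmetricAlgebra A (LiePlus A M)}
    (hp : p ∈ (l.map (genPair A M)).prod) :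
    ∃ q, symProj A M q = p.2 ∧ ∀ n, xi ^ (n + 1) ∣ symRep A M p.1 (xi ^ (l.length + n)) -
      (((l.length + n).descFactorial l.length : ℕ) :
        SymmetricAlgebra A (GradedExt A M)) * (q * xi ^ n) := by
  induction l generalizing p with
  | nil =>
    obtain ⟨a, rfl⟩ := Submodule.mem_one.1 hp
    refine ⟨algebraMap A _ a, AlgHom.commutes _ _, fun n => ?_⟩
    change _ ∣ symRep A M (algebraMap A _ a) _ - _
    rw [AlgHom.commutes, Module.algebraMap_end_apply, Algebra.smul_def, List.length_nil,
      Nat.zero_add, Nat.descFactorial_zero, Nat.cast_one, one_mul, sub_self]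
    exact dvd_zero _
  | cons k l ih =>
    rw [List.map_cons, List.prod_cons] at hp
    induction hp using Submodule.mul_induction_on' with
    | mem_mul_mem p hp p' hp' =>
      obtain ⟨u, rfl⟩ := hp
      obtain ⟨q, hq, h⟩ := ih hp'
      refine ⟨symDerivation (repDeg (k + 1) u) xi * q, ?_, fun n => ?_⟩
      · rw [map_mul, hq, symProj_symDerivation_xi]
        rfl
      · have hlen : (k :: l).length + n = l.length + (n + 1) := by rw [List.length_cons]; omega
        have hdesc : (l.length + (n + 1)).descFactorial (l.length + 1) =
            (n + 1) * (l.length + (n + 1)).descFactorial l.length := by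
          rw [Nat.descFactorial_succ, Nat.add_sub_cancel_left]
        have hdvd := pow_dvd_derivation_sub (symDerivation (repDeg (k + 1) u)) (h (n + 1))
        rw [← symRep_toTensor_eq_derivation, ← hdesc] at hdvd
        rw [Prod.fst_mul, map_mul, Module.End.mul_apply, hlen, List.length_cons]
        exact hdvd
    | add p _ p' _ h h' =>
      obtain ⟨q, hq, h⟩ := h
      obtain ⟨q', hq', h'⟩ := h'
      refine ⟨q + q', by rw [map_add, hq, hq', Prod.snd_add], fun n => ?_⟩
      rw [Prod.fst_add, map_add, LinearMap.add_apply, add_mul, mul_add, add_sub_add_comm]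
      exact dvd_add (h n) (h' n)

theorem opSymbol_eq_factorial_smul {l : List ℕ}
    {p : TensorAlgebra A M × SymmetricAlgebra A (LiePlus A M)}
    (hp : p ∈ (l.map (genPair A M)).prod) :
    opSymbol A M l.length p.1 = (l.length.factorial : A) • p.2 := by
  obtain ⟨q, hq, h⟩ := exists_symRep_sub_descFactorial_dvd hp
  have h₀ := symProj_eq_zero_of_dvd (h 0)
  rw [Nat.add_zero, Nat.descFactorial_self, pow_zero, mul_one, map_sub, map_mul, map_natCast, hq,
    sub_eq_zero] at h₀
  rw [opSymbol_apply, h₀, Nat.cast_smul_eq_nsmul, nsmul_eq_mul]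

end OpSymbol

end FreeLie

/-! ### Functoriality of the NC-filtration -/

section Functoriality

variable {R S : Type u} [Ring R] [Algebra ℂ R] [Ring S] [Algebra ℂ S]

theorem lieTerm_le_comap (f : R →ₐ[ℂ] S) (k : ℕ) :
    lieTerm R k ≤ (lieTerm S k).comap f.toLinearMap := by
  induction k with
  | zero => exact fun _ _ => Submodule.mem_top
  | succ k ih =>
    rw [lieTerm_succ, Submodule.span_le]
    rintro _ ⟨x, y, hy, rfl⟩
    change f (x * y - y * x) ∈ lieTerm S (k + 1)
    rw [map_sub, map_mul, map_mul]
    exact comm_mem_lieTerm_succ k (f x) (ih hy)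

theorem map_mem_ncFil (f : R →ₐ[ℂ] S) {k : ℕ} {x : R} (hx : x ∈ ncFil R k) :
    f x ∈ ncFil S k := by
  refine ncFil_le (fun k => (ncFil S k).comap f.toLinearMap) (fun k => ?_) (fun i j => ?_) k hx
  · exact (lieTerm_le_comap f k).trans (Submodule.comap_mono (lieTerm_le_ncFil k))
  · refine Submodule.mul_le.2 fun x hx y hy => ?_
    change f (x * y) ∈ ncFil S (i + j)
    rw [map_mul]
    exact mul_mem_ncFil hx hy

theorem lieTerm_le_map {f : R →ₐ[ℂ] S} (hf : Function.Surjective f) (k : ℕ) :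
    lieTerm S k ≤ (lieTerm R k).map f.toLinearMap := by
  induction k with
  | zero =>
    intro y _
    obtain ⟨x, rfl⟩ := hf y
    exact ⟨x, Submodule.mem_top, rfl⟩
  | succ k ih =>
    rw [lieTerm_succ, Submodule.span_le]
    rintro _ ⟨x, y, hy, rfl⟩
    obtain ⟨x, rfl⟩ := hf x
    obtain ⟨z, hz, rfl⟩ := ih hy
    refine ⟨x * z - z * x, comm_mem_lieTerm_succ k x hz, ?_⟩
    rw [map_sub]
    exact congrArg₂ _ (map_mul f x z) (map_mul f z x)

theorem exists_mem_ncFil_map_eq {f : R →ₐ[ℂ] S} (hf : Function.Surjective f) {k : ℕ} {y : S}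
    (hy : y ∈ ncFil S k) : ∃ x ∈ ncFil R k, f x = y := by
  refine ncFil_le (fun k => (ncFil R k).map f.toLinearMap) (fun k => ?_) (fun i j => ?_) k hy
  · exact (lieTerm_le_map hf k).trans (Submodule.map_mono (lieTerm_le_ncFil k))
  · refine Submodule.mul_le.2 ?_
    rintro _ ⟨x, hx, rfl⟩ _ ⟨y, hy, rfl⟩
    exact ⟨x * y, mul_mem_ncFil hx hy, map_mul f x y⟩

end Functoriality

/-! ### The filtration of the tensor algebra by products of Lie elements -/

namespace FreeLie

section LieFil

variable {A M : Type u} [CommRing A] [AddCommGroup M] [Module A M]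

theorem lieProd_append (l l' : List ℕ) :
    lieProd A M (l ++ l') = lieProd A M l * lieProd A M l' := by
  rw [lieProd, List.map_append, List.prod_append, lieProd, lieProd]

theorem toTensor_mem_lieProd {k : ℕ} {u : FreeLie A M} (hu : u ∈ deg A M k) :
    toTensor A M u ∈ lieProd A M [k] := by
  rw [lieProd, List.map_singleton, List.prod_singleton]
  exact Submodule.mem_map_of_mem hu

variable (A M) in
/-- The span of the products of Lie elements of total degree at least `i`; it turns out to contain
the `i`-th term of the NC-filtration of the tensor algebra. -/
noncomputable def lieFil (i : ℕ) : Submodule A (TensorAlgebra A M) :=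
  ⨆ (l : List ℕ) (_ : i ≤ l.sum), lieProd A M l

theorem lieProd_le_lieFil {i : ℕ} {l : List ℕ} (h : i ≤ l.sum) : lieProd A M l ≤ lieFil A M i :=
  le_iSup₂_of_le (f := fun (l : List ℕ) (_ : i ≤ l.sum) => lieProd A M l) l h le_rfl

theorem lieFil_antitone : Antitone (lieFil A M) := fun _ _ h =>
  iSup₂_le fun _ hl => lieProd_le_lieFil (h.trans hl)

theorem lieFil_mul_le (i j : ℕ) : lieFil A M i * lieFil A M j ≤ lieFil A M (i + j) := by
  simp only [lieFil, Submodule.iSup_mul, Submodule.mul_iSup]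
  refine iSup₂_le fun l hl => iSup₂_le fun l' hl' => ?_
  rw [← lieProd_append]
  exact lieProd_le_lieFil ((Nat.add_le_add hl' hl).trans_eq List.sum_append.symm)

theorem mul_mem_lieFil {i j k : ℕ} (h : i + j = k) {x y : TensorAlgebra A M}
    (hx : x ∈ lieFil A M i) (hy : y ∈ lieFil A M j) : x * y ∈ lieFil A M k :=
  h ▸ lieFil_mul_le i j (Submodule.mul_mem_mul hx hy)

theorem mem_lieFil_zero (t : TensorAlgebra A M) : t ∈ lieFil A M 0 := by
  induction t using TensorAlgebra.induction with
  | algebraMap a => exact lieProd_le_lieFil (l := []) le_rfl (Submodule.mem_one.2 ⟨a, rfl⟩)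
  | ι m =>
    rw [← toTensor_of]
    exact lieProd_le_lieFil (Nat.zero_le _) (toTensor_mem_lieProd (of_mem_deg m))
  | mul x y hx hy => exact mul_mem_lieFil (Nat.zero_add 0) hx hy
  | add x y hx hy => exact add_mem hx hy

theorem ι_commutator_mem_lieFil_of_mem_lieProd (m : M) {l : List ℕ} {v : TensorAlgebra A M}
    (hv : v ∈ lieProd A M l) :
    TensorAlgebra.ι A m * v - v * TensorAlgebra.ι A m ∈ lieFil A M (l.sum + 1) := by
  induction l generalizing v with
  | nil =>
    obtain ⟨a, rfl⟩ := Submodule.mem_one.1 hv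
    rw [Algebra.commutes, sub_self]
    exact zero_mem _
  | cons k l ih =>
    rw [lieProd_cons] at hv
    induction hv using Submodule.mul_induction_on' with
    | mem_mul_mem u hu v hv =>
      obtain ⟨u, hu, rfl⟩ := hu
      have leibniz : TensorAlgebra.ι A m * (toTensor A M u * v) -
          toTensor A M u * v * TensorAlgebra.ι A m = toTensor A M ⁅of A M m, u⁆ * v +
            toTensor A M u * (TensorAlgebra.ι A m * v - v * TensorAlgebra.ι A m) := by
        rw [toTensor_lie, toTensor_of]
        noncomm_ring
      have hu₀ : toTensor A M u ∈ lieFil A M k :=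
        lieProd_le_lieFil List.sum_singleton.ge (toTensor_mem_lieProd hu)
      have hu₁ : toTensor A M ⁅of A M m, u⁆ ∈ lieFil A M (k + 1) :=
        lieProd_le_lieFil List.sum_singleton.ge (toTensor_mem_lieProd (of_lie_mem_deg m hu))
      rw [leibniz, List.sum_cons]
      exact add_mem (mul_mem_lieFil (by omega) hu₁ (lieProd_le_lieFil le_rfl hv))
        (mul_mem_lieFil (by omega) hu₀ (ih hv))
    | add v _ w _ hv hw =>
      rw [mul_add, add_mul, add_sub_add_comm]
      exact add_mem hv hw

theorem ι_commutator_mem_lieFil (m : M) {k : ℕ} {v : TensorAlgebra A M} (hv : v ∈ lieFil A M k) :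
    TensorAlgebra.ι A m * v - v * TensorAlgebra.ι A m ∈ lieFil A M (k + 1) := by
  have h : lieFil A M k ≤ (lieFil A M (k + 1)).comap
      (LinearMap.mulLeft A (TensorAlgebra.ι A m) - LinearMap.mulRight A (TensorAlgebra.ι A m)) :=
    iSup₂_le fun l hl v hv => lieFil_antitone (Nat.succ_le_succ hl)
      (ι_commutator_mem_lieFil_of_mem_lieProd m hv)
  exact h hv

theorem commutator_mem_lieFil {k : ℕ} (t : TensorAlgebra A M) {v : TensorAlgebra A M}
    (hv : v ∈ lieFil A M k) : t * v - v * t ∈ lieFil A M (k + 1) := by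
  induction t using TensorAlgebra.induction with
  | algebraMap a =>
    rw [Algebra.commutes, sub_self]
    exact zero_mem _
  | ι m => exact ι_commutator_mem_lieFil m hv
  | mul x y hx hy =>
    have leibniz : x * y * v - v * (x * y) = x * (y * v - v * y) + (x * v - v * x) * y := by
      noncomm_ring
    rw [leibniz]
    exact add_mem (mul_mem_lieFil (Nat.zero_add _) (mem_lieFil_zero x) hy)
      (mul_mem_lieFil (Nat.add_zero _) hx (mem_lieFil_zero y))
  | add x y hx hy =>
    rw [add_mul, mul_add, add_sub_add_comm]
    exact add_mem hx hy

theorem ncFil_le_lieFil [Algebra ℂ A] [Module ℂ M] [IsScalarTower ℂ A M] (i : ℕ) :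
    ncFil (TensorAlgebra A M) i ≤ (lieFil A M i).restrictScalars ℂ := by
  refine ncFil_le (fun i => (lieFil A M i).restrictScalars ℂ) (fun k => ?_) (fun i j => ?_) i
  · induction k with
    | zero => exact fun t _ => mem_lieFil_zero t
    | succ k ih =>
      rw [lieTerm_succ, Submodule.span_le]
      rintro _ ⟨x, y, hy, rfl⟩
      exact commutator_mem_lieFil x (ih hy)
  · exact Submodule.mul_le.2 fun x hx y hy => lieFil_mul_le i j (Submodule.mul_mem_mul hx hy)

end LieFil

/-! ### The weight of elements of the tensor algebra -/

section Weight

open Polynomial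

variable {A M : Type u} [CommRing A] [AddCommGroup M] [Module A M]

variable (A M) in
/-- The grading of the tensor algebra, encoded as the coaction `m ↦ m X`: the component of weight
`w` of `t` is the coefficient of `X ^ w` in `weight A M t`. -/
noncomputable def weight : TensorAlgebra A M →ₐ[A] (TensorAlgebra A M)[X] :=
  TensorAlgebra.lift A ((monomial 1).restrictScalars A ∘ₗ TensorAlgebra.ι A)

theorem weight_ι (m : M) : weight A M (TensorAlgebra.ι A m) = monomial 1 (TensorAlgebra.ι A m) :=
  TensorAlgebra.lift_ι_apply _ _

theorem coeff_weight_algebraMap (a : A) (w : ℕ) :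
    (weight A M (algebraMap A _ a)).coeff w = if w = 0 then algebraMap A _ a else 0 := by
  rw [AlgHom.commutes]
  exact coeff_C

theorem weight_toTensor {k : ℕ} {u : FreeLie A M} (hu : u ∈ deg A M k) :
    weight A M (toTensor A M u) = monomial (k + 1) (toTensor A M u) := by
  refine deg_le (N := fun k => LinearMap.eqLocus ((weight A M).toLinearMap ∘ₗ toTensor A M)
    ((monomial (k + 1)).restrictScalars A ∘ₗ toTensor A M))
    (fun m => ?_) (fun k m y _ hy => ?_) k hu
  · change weight A M (toTensor A M (of A M m)) = monomial 1 (toTensor A M (of A M m))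
    rw [toTensor_of, weight_ι]
  · change weight A M (toTensor A M ⁅_, y⁆) = monomial (k + 1 + 1) (toTensor A M ⁅_, y⁆)
    replace hy : weight A M (toTensor A M y) = monomial (k + 1) (toTensor A M y) := hy
    rw [toTensor_lie, map_sub, map_mul, map_mul, hy, toTensor_of, weight_ι, monomial_mul_monomial,
      monomial_mul_monomial, map_sub, Nat.add_comm 1]

theorem weight_lieProd {l : List ℕ} {v : TensorAlgebra A M} (hv : v ∈ lieProd A M l) :
    weight A M v = monomial (l.sum + l.length) v := by
  induction l generalizing v with
  | nil =>
    obtain ⟨a, rfl⟩ := Submodule.mem_one.1 hv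
    rw [AlgHom.commutes]
    rfl
  | cons k l ih =>
    have hsum : (k :: l).sum + (k :: l).length = k + 1 + (l.sum + l.length) := by
      rw [List.sum_cons, List.length_cons]
      omega
    rw [lieProd_cons] at hv
    induction hv using Submodule.mul_induction_on' with
    | mem_mul_mem u hu v hv =>
      obtain ⟨u, hu, rfl⟩ := hu
      rw [map_mul, weight_toTensor hu, ih hv, monomial_mul_monomial, hsum]
    | add v _ w _ hv hw => rw [map_add, hv, hw, map_add]

theorem opSymbol_coeff_weight_eq_zero [Algebra ℂ A] [Module ℂ M] [IsScalarTower ℂ A M]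
    {i : ℕ} {t : TensorAlgebra A M} (ht : t ∈ ncFil (TensorAlgebra A M) (i + 1)) (s : ℕ) :
    opSymbol A M s ((weight A M t).coeff (i + s)) = 0 := by
  have h : lieFil A M (i + 1) ≤ LinearMap.ker (opSymbol A M s ∘ₗ
      (lcoeff (TensorAlgebra A M) (i + s)).restrictScalars A ∘ₗ (weight A M).toLinearMap) := by
    refine iSup₂_le fun l hl v hv => ?_
    change opSymbol A M s ((weight A M v).coeff (i + s)) = 0
    rw [weight_lieProd hv, coeff_monomial]
    split_ifs with h
    · exact opSymbol_eq_zero hv (by omega)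
    · exact map_zero _
  exact h (ncFil_le_lieFil (i + 1) ht)

variable (A M) in
/-- The ideal of the elements of weight at least `n` of the tensor algebra. -/
noncomputable def weightIdeal (n : ℕ) : Ideal (TensorAlgebra A M) where
  carrier := {t | X ^ n ∣ weight A M t}
  zero_mem' := by
    change X ^ n ∣ weight A M 0
    rw [map_zero]
    exact dvd_zero _
  add_mem' {x y} hx hy := by
    change X ^ n ∣ weight A M (x + y)
    rw [map_add]
    exact dvd_add hx hy
  smul_mem' x y hy := by
    obtain ⟨q, hq⟩ := hy
    exact ⟨weight A M x * q, by rw [smul_eq_mul, map_mul, hq, ← mul_assoc, ← X_pow_mul, mul_assoc]⟩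

theorem coeff_weight_eq_zero {n w : ℕ} {t : TensorAlgebra A M} (ht : t ∈ weightIdeal A M n)
    (hw : w < n) : (weight A M t).coeff w = 0 :=
  X_pow_dvd_iff.1 ht w hw

instance (n : ℕ) : (weightIdeal A M n).IsTwoSided where
  mul_mem_of_left {x} y hx := by
    change X ^ n ∣ weight A M (x * y)
    rw [map_mul]
    exact dvd_mul_of_dvd_left hx _

theorem mul_mem_weightIdeal {m n k : ℕ} (h : m + n = k) {x y : TensorAlgebra A M}
    (hx : x ∈ weightIdeal A M m) (hy : y ∈ weightIdeal A M n) : x * y ∈ weightIdeal A M k := by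
  obtain ⟨p, hp⟩ := hx
  obtain ⟨q, hq⟩ := hy
  refine ⟨p * q, ?_⟩
  rw [map_mul, hp, hq, mul_assoc, ← mul_assoc p, ← X_pow_mul, mul_assoc, ← mul_assoc, ← pow_add, h]

theorem coeff_weight_mul {m n : ℕ} {x y : TensorAlgebra A M} (hx : x ∈ weightIdeal A M m)
    (hy : y ∈ weightIdeal A M n) : (weight A M (x * y)).coeff (m + n) =
      (weight A M x).coeff m * (weight A M y).coeff n := by
  obtain ⟨p, hp⟩ := hx
  obtain ⟨q, hq⟩ := hy
  have coeff_self (n : ℕ) (p : (TensorAlgebra A M)[X]) : (X ^ n * p).coeff n = p.coeff 0 := by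
    rw [coeff_X_pow_mul', if_pos le_rfl, Nat.sub_self]
  rw [map_mul, hp, hq, mul_assoc, ← mul_assoc p, ← X_pow_mul, mul_assoc, ← mul_assoc, ← pow_add,
    coeff_self, coeff_self, coeff_self, mul_coeff_zero]

theorem weightIdeal_antitone : Antitone (weightIdeal A M) := fun _ _ h _ hx =>
  (pow_dvd_pow X h).trans hx

theorem ι_mem_weightIdeal (m : M) : TensorAlgebra.ι A m ∈ weightIdeal A M 1 := by
  change X ^ 1 ∣ weight A M _
  rw [weight_ι, pow_one, X_dvd_iff, coeff_monomial, if_neg one_ne_zero]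

end Weight

section TruncIdeal

variable {A M : Type u} [CommRing A] [Algebra ℂ A] [AddCommGroup M] [Module A M] [Module ℂ M]
  [IsScalarTower ℂ A M]

variable (A M) in
/-- The ideal which truncates the tensor algebra in weight `n` and NC-degree `d + 1`. -/
noncomputable def truncIdeal (d n : ℕ) : Ideal (TensorAlgebra A M) :=
  weightIdeal A M n ⊔ ncIdeal (TensorAlgebra A M) (d + 1)

instance (d n : ℕ) : (truncIdeal A M d n).IsTwoSided where
  mul_mem_of_left {x} y hx := by
    obtain ⟨a, ha, b, hb, rfl⟩ := Submodule.mem_sup.1 hx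
    rw [add_mul]
    exact Submodule.add_mem_sup (Ideal.mul_mem_right y _ ha) (Ideal.mul_mem_right y _ hb)

theorem isNCNilpotent_quotient_truncIdeal (d n : ℕ) :
    IsNCNilpotent d (TensorAlgebra A M ⧸ truncIdeal A M d n) := by
  refine (Submodule.eq_bot_iff _).2 fun y hy => ?_
  obtain ⟨x, hx, rfl⟩ := exists_mem_ncFil_map_eq
    (Ideal.Quotient.mkₐ_surjective ℂ (truncIdeal A M d n)) hy
  exact Ideal.Quotient.eq_zero_iff_mem.2 (Submodule.mem_sup_right hx)

theorem opSymbol_coeff_weight_eq_zero_of_mk_mem_ncFil {d n i s : ℕ} (hi : i ≤ d) (hn : i + s < n)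
    {t : TensorAlgebra A M} (ht : Ideal.Quotient.mk (truncIdeal A M d n) t ∈
      ncFil (TensorAlgebra A M ⧸ truncIdeal A M d n) (i + 1)) :
    opSymbol A M s ((weight A M t).coeff (i + s)) = 0 := by
  obtain ⟨x, hx, h⟩ := exists_mem_ncFil_map_eq
    (Ideal.Quotient.mkₐ_surjective ℂ (truncIdeal A M d n)) ht
  have hsub : t - x ∈ truncIdeal A M d n := Ideal.Quotient.eq.1 h.symm
  obtain ⟨a, ha, b, hb, hab⟩ := Submodule.mem_sup.1 hsub
  obtain rfl : t = a + (b + x) := by rw [← add_assoc, hab, sub_add_cancel]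
  rw [map_add, Polynomial.coeff_add, coeff_weight_eq_zero ha hn, zero_add]
  exact opSymbol_coeff_weight_eq_zero
    (add_mem (ncFil_antitone (Nat.succ_le_succ hi) hb) hx) s

end TruncIdeal

end FreeLie

/-! ### Polynomials in Lie elements -/

section Q

variable {A M : Type u} [CommRing A] [AddCommGroup M] [Module A M]

theorem prod_symGen_le_Q {l : List ℕ} {d : ℕ} (h : (l.map fun k => k + 1).sum = d) :
    (l.map fun k => symGen A M k).prod ≤ Q A M d :=
  le_iSup₂_of_le (f := fun (l : List ℕ) (_ : (l.map fun k => k + 1).sum = d) =>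
    (l.map fun k => symGen A M k).prod) l h le_rfl

theorem mul_mem_Q {i j k : ℕ} (h : i + j = k) {p q : SymmetricAlgebra A (LiePlus A M)}
    (hp : p ∈ Q A M i) (hq : q ∈ Q A M j) : p * q ∈ Q A M k := by
  have hle : Q A M i * Q A M j ≤ Q A M k := by
    simp only [Q, Submodule.iSup_mul, Submodule.mul_iSup]
    refine iSup₂_le fun l hl => iSup₂_le fun l' hl' => ?_
    rw [← List.prod_append, ← List.map_append]
    exact prod_symGen_le_Q (by rw [List.map_append, List.sum_append, hl, hl']; omega)
  exact hle (Submodule.mul_mem_mul hp hq)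

theorem algebraMap_mem_Q (a : A) : algebraMap A _ a ∈ Q A M 0 :=
  prod_symGen_le_Q (l := []) rfl (Submodule.mem_one.2 ⟨a, rfl⟩)

theorem gen_mem_Q (k : ℕ) (u : FreeLie.deg A M (k + 1)) : FreeLie.gen k u ∈ Q A M (k + 1) := by
  refine prod_symGen_le_Q (l := [k]) rfl ?_
  rw [List.map_singleton, List.prod_singleton]
  exact ⟨u, rfl⟩

end Q

/-! ### The Poisson envelope of an algebra whose differentials lift to the tensor square -/

namespace Env

open TensorProduct KaehlerDifferential

variable {A : Type u} [CommRing A] [Algebra ℂ A]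

instance : LieRing (Env A) where
  bracket := pb
  add_lie := add_pb
  lie_add := pb_add
  lie_self := pb_self
  leibniz_lie := pb_pb

instance : LieAlgebra ℂ (Env A) where
  lie_smul := pb_smul

theorem lie_eq_pb (x y : Env A) : ⁅x, y⁆ = pb x y := rfl

noncomputable instance : Algebra A (Env A) := (ι A).toRingHom.toAlgebra

theorem smul_eq_ι_mul (a : A) (x : Env A) : a • x = ι A a * x := rfl

instance : IsScalarTower ℂ A (Env A) := ⟨fun c a x => by
  rw [smul_eq_ι_mul, smul_eq_ι_mul, map_smul, smul_mul_assoc]⟩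

/-- The derivation `b ↦ {b, v}`, as a linear map on the Kähler differentials. -/
noncomputable def bracketDiff (v : Env A) : Ω[A⁄ℂ] →ₗ[A] Env A :=
  (Derivation.mk' ((PoissonAlgebra.bracket : Env A →ₗ[ℂ] _).flip v ∘ₗ (ι A).toLinearMap)
    fun a b => by
      change pb (ι A (a * b)) v = ι A a * pb (ι A b) v + ι A b * pb (ι A a) v
      rw [map_mul, mul_pb, mul_comm (pb _ _)]).liftKaehlerDifferential

theorem bracketDiff_D (v : Env A) (b : A) : bracketDiff v (D ℂ A b) = pb (ι A b) v :=
  Derivation.liftKaehlerDifferential_comp_D _ _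

variable (A) in
/-- The map `a ⊗ b ↦ a db`, whose sections replace a choice of coordinates on `A`. -/
noncomputable def diffMap : A ⊗[ℂ] A →ₗ[A] Ω[A⁄ℂ] :=
  LinearMap.liftBaseChange A (D ℂ A).toLinearMap

theorem diffMap_tmul (a b : A) : diffMap A (a ⊗ₜ b) = a • D ℂ A b :=
  LinearMap.liftBaseChange_tmul ..

theorem diffMap_surjective : Function.Surjective (diffMap A) := by
  rw [← LinearMap.range_eq_top, ← top_le_iff, ← span_range_derivation, Submodule.span_le]
  rintro _ ⟨b, rfl⟩
  exact ⟨1 ⊗ₜ b, by rw [diffMap_tmul, one_smul]⟩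

variable (A) in
/-- The scalar extension of `A → P(A)`. -/
noncomputable def ιTensor : A ⊗[ℂ] A →ₗ[A] A ⊗[ℂ] Env A := (ι A).toLinearMap.baseChange A

theorem ιTensor_tmul (a b : A) : ιTensor A (a ⊗ₜ b) = a ⊗ₜ ι A b := rfl

variable (A) in
/-- The multiplication map `A ⊗ P(A) → P(A)`; it does not respect the brackets, since the bracket
of `A ⊗ P(A)` is `A`-linear. -/
noncomputable def contract : A ⊗[ℂ] Env A →ₗ[A] Env A :=
  LinearMap.liftBaseChange A LinearMap.id

theorem contract_tmul (a : A) (x : Env A) : contract A (a ⊗ₜ x) = ι A a * x :=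
  LinearMap.liftBaseChange_tmul ..

theorem tensor_lie_add (x y z : A ⊗[ℂ] Env A) : ⁅x, y + z⁆ = ⁅x, y⁆ + ⁅x, z⁆ :=
  LieRing.lie_add x y z

theorem tensor_lie_zero (x : A ⊗[ℂ] Env A) : ⁅x, (0 : A ⊗[ℂ] Env A)⁆ = 0 :=
  (AddMonoidHom.mk' (fun y => ⁅x, y⁆) (tensor_lie_add x)).map_zero

theorem tmul_lie_tmul (a b : A) (x y : Env A) : ⁅a ⊗ₜ[ℂ] x, b ⊗ₜ[ℂ] y⁆ = (a * b) ⊗ₜ pb x y :=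
  LieAlgebra.ExtendScalars.bracket_tmul ..

theorem ιTensor_mem_baseChange (w : A ⊗[ℂ] A) : ιTensor A w ∈ (deg A 0).baseChange A := by
  induction w with
  | zero => exact map_zero (ιTensor A) ▸ zero_mem _
  | tmul a b => exact Submodule.tmul_mem_baseChange_of_mem a (ι_mem_deg b)
  | add x y hx hy => exact map_add (ιTensor A) x y ▸ add_mem hx hy

theorem lie_mem_baseChange {j k n : ℕ} (h : j + k + 1 = n) {x y : A ⊗[ℂ] Env A}
    (hx : x ∈ (deg A j).baseChange A) (hy : y ∈ (deg A k).baseChange A) :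
    ⁅x, y⁆ ∈ (deg A n).baseChange A := by
  obtain ⟨x, rfl⟩ := hx
  obtain ⟨y, rfl⟩ := hy
  induction x with
  | zero =>
    rw [map_zero, zero_lie]
    exact zero_mem _
  | add x x' hx hx' =>
    rw [map_add, add_lie]
    exact add_mem hx hx'
  | tmul a x =>
    induction y with
    | zero =>
      rw [map_zero, tensor_lie_zero]
      exact zero_mem _
    | add y y' hy hy' =>
      rw [map_add, tensor_lie_add]
      exact add_mem hy hy'
    | tmul b y =>
      rw [LinearMap.baseChange_tmul, LinearMap.baseChange_tmul, tmul_lie_tmul]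
      exact Submodule.tmul_mem_baseChange_of_mem _ (pb_mem_deg h x.2 y.2)

theorem contract_ιTensor_lie_sub_mem_dec {k n : ℕ} (h : k + 1 + 1 = n) (w : A ⊗[ℂ] A)
    {z : A ⊗[ℂ] Env A} (hz : z ∈ (deg A (k + 1)).baseChange A) :
    contract A ⁅ιTensor A w, z⁆ - bracketDiff (contract A z) (diffMap A w) ∈ dec A n := by
  induction w with
  | zero =>
    rw [map_zero, map_zero, zero_lie, map_zero, map_zero, sub_zero]
    exact zero_mem _
  | add x y hx hy =>
    rw [map_add, add_lie, map_add, map_add, map_add, add_sub_add_comm]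
    exact add_mem hx hy
  | tmul a b =>
    rw [diffMap_tmul, map_smul, bracketDiff_D, ιTensor_tmul, smul_eq_ι_mul]
    obtain ⟨z, rfl⟩ := hz
    induction z with
    | zero =>
      rw [map_zero, tensor_lie_zero, map_zero, ← lie_eq_pb, lie_zero, mul_zero, sub_zero]
      exact zero_mem _
    | add x y hx hy =>
      rw [map_add, tensor_lie_add, map_add, map_add, pb_add, mul_add, add_sub_add_comm]
      exact add_mem hx hy
    | tmul c y =>
      have hdec : pb (ι A b) (ι A c) * (y : Env A) ∈ dec A n :=
        mul_mem_dec (i := 0) (j := k) (by omega)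
          (pb_mem_deg (i := 0) (j := 0) (by omega) (ι_mem_deg b) (ι_mem_deg c)) y.2
      have hpb : ι A (a * c) * pb (ι A b) y - ι A a * pb (ι A b) (ι A c * y) =
          -(ι A a * (pb (ι A b) (ι A c) * y)) := by
        rw [pb_mul, map_mul]
        ring
      rw [LinearMap.baseChange_tmul, tmul_lie_tmul, contract_tmul, contract_tmul,
        Submodule.subtype_apply, hpb]
      exact neg_mem (ι_mul_mem_dec a hdec)

theorem contract_lie_ιTensor_tmul (w : A ⊗[ℂ] A) (b c : A) :
    contract A ⁅ιTensor A w, ιTensor A (b ⊗ₜ c)⁆ = ι A b * bracketDiff (ι A c) (diffMap A w) := by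
  induction w with
  | zero => rw [map_zero, zero_lie, map_zero, map_zero, map_zero, mul_zero]
  | tmul x y =>
    rw [ιTensor_tmul, ιTensor_tmul, tmul_lie_tmul, contract_tmul, diffMap_tmul, map_smul,
      bracketDiff_D, smul_eq_ι_mul, map_mul]
    ring
  | add x y hx hy => rw [map_add, add_lie, map_add, hx, hy, map_add, map_add, mul_add]

theorem contract_lie_ιTensor {w : A ⊗[ℂ] A} {a : A} (hw : diffMap A w = D ℂ A a)
    (w' : A ⊗[ℂ] A) :
    contract A ⁅ιTensor A w, ιTensor A w'⁆ = -bracketDiff (ι A a) (diffMap A w') := by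
  induction w' with
  | zero => rw [map_zero, tensor_lie_zero, map_zero, map_zero, map_zero, neg_zero]
  | tmul b c =>
    rw [contract_lie_ιTensor_tmul, hw, bracketDiff_D, diffMap_tmul, map_smul, bracketDiff_D,
      smul_eq_ι_mul, pb_antisymm, mul_neg]
  | add x y hx hy =>
    rw [map_add, tensor_lie_add, map_add, hx, hy, map_add, map_add, neg_add]

section Section

variable (σ : Ω[A⁄ℂ] →ₗ[A] A ⊗[ℂ] A)

/-- The homomorphism of Lie algebras over `A` from the free Lie algebra of the differentials which
is defined by a section of `a ⊗ b ↦ a db`. It takes its values in `A ⊗ P(A)`, since the bracket of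
`P(A)` is not `A`-bilinear. -/
noncomputable def lieToTensor : FreeLie A (Ω[A⁄ℂ]) →ₗ[A] A ⊗[ℂ] Env A :=
  (FreeLie.lift (ιTensor A ∘ₗ σ) : FreeLie A (Ω[A⁄ℂ]) →ₗ⁅A⁆ A ⊗[ℂ] Env A)

theorem lieToTensor_of (m : Ω[A⁄ℂ]) : lieToTensor σ (FreeLie.of A _ m) = ιTensor A (σ m) :=
  FreeLie.lift_of _ m

theorem lieToTensor_lie (x y : FreeLie A (Ω[A⁄ℂ])) :
    lieToTensor σ ⁅x, y⁆ = ⁅lieToTensor σ x, lieToTensor σ y⁆ :=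
  (FreeLie.lift (ιTensor A ∘ₗ σ) : FreeLie A (Ω[A⁄ℂ]) →ₗ⁅A⁆ A ⊗[ℂ] Env A).map_lie x y

theorem lieToTensor_mem_baseChange {k : ℕ} {u : FreeLie A (Ω[A⁄ℂ])} (hu : u ∈ FreeLie.deg A _ k) :
    lieToTensor σ u ∈ (deg A k).baseChange A := by
  refine FreeLie.deg_le (N := fun k => ((deg A k).baseChange A).comap (lieToTensor σ))
    (fun m => ?_) (fun k m y _ hy => ?_) k hu
  · rw [Submodule.mem_comap, lieToTensor_of]
    exact ιTensor_mem_baseChange (σ m)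
  · rw [Submodule.mem_comap, lieToTensor_lie, lieToTensor_of]
    exact lie_mem_baseChange (by omega) (ιTensor_mem_baseChange (σ m)) hy

/-- The map `Lie_A(Ω) → P(A)` which is defined by a section of `a ⊗ b ↦ a db`. -/
noncomputable def lieToEnv : FreeLie A (Ω[A⁄ℂ]) →ₗ[A] Env A := contract A ∘ₗ lieToTensor σ

/-- The map from the symmetric algebra of `Lie_+(Ω)` to `P(A)` which is defined by a section of
`a ⊗ b ↦ a db`. -/
noncomputable def symToEnv : SymmetricAlgebra A (LiePlus A (Ω[A⁄ℂ])) →ₐ[A] Env A :=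
  SymmetricAlgebra.lift (DirectSum.toModule A ℕ (Env A) fun k =>
    lieToEnv σ ∘ₗ (FreeLie.deg A (Ω[A⁄ℂ]) (k + 1)).subtype)

theorem symToEnv_gen (k : ℕ) (u : FreeLie.deg A (Ω[A⁄ℂ]) (k + 1)) :
    symToEnv σ (FreeLie.gen k u) = lieToEnv σ u := by
  rw [symToEnv, FreeLie.gen, LinearMap.comp_apply, SymmetricAlgebra.lift_ι_apply,
    DirectSum.toModule_lof]
  rfl

theorem contract_mem_deg {k : ℕ} {z : A ⊗[ℂ] Env A} (hz : z ∈ (deg A k).baseChange A) :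
    contract A z ∈ deg A k := by
  obtain ⟨z, rfl⟩ := hz
  induction z with
  | zero =>
    rw [map_zero, map_zero]
    exact zero_mem _
  | add x y hx hy =>
    rw [map_add, map_add]
    exact add_mem hx hy
  | tmul a x =>
    rw [LinearMap.baseChange_tmul, contract_tmul]
    exact ι_mul_mem_deg a x.2

theorem symToEnv_mem_deg_of_mem_prod {l : List ℕ}
    {q : SymmetricAlgebra A (LiePlus A (Ω[A⁄ℂ]))}
    (hq : q ∈ (l.map fun k => symGen A (Ω[A⁄ℂ]) k).prod) :
    symToEnv σ q ∈ deg A (l.map fun k => k + 1).sum := by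
  induction l generalizing q with
  | nil =>
    obtain ⟨a, rfl⟩ := Submodule.mem_one.1 hq
    rw [AlgHom.commutes]
    exact ι_mem_deg a
  | cons k l ih =>
    rw [List.map_cons, List.prod_cons] at hq
    rw [List.map_cons, List.sum_cons]
    induction hq using Submodule.mul_induction_on' with
    | mem_mul_mem x hx y hy =>
      obtain ⟨u, rfl⟩ := hx
      rw [map_mul]
      refine mul_mem_deg rfl ?_ (ih hy)
      exact symToEnv_gen σ k u ▸ contract_mem_deg (lieToTensor_mem_baseChange σ u.2)
    | add x _ y _ hx hy =>
      rw [map_add]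
      exact add_mem hx hy

theorem symToEnv_mem_deg {i : ℕ} {q : SymmetricAlgebra A (LiePlus A (Ω[A⁄ℂ]))}
    (hq : q ∈ Q A (Ω[A⁄ℂ]) i) : symToEnv σ q ∈ deg A i := by
  have hle : Q A (Ω[A⁄ℂ]) i ≤
      ({ deg A i with smul_mem' := fun a _ hx => ι_mul_mem_deg a hx } : Submodule A (Env A)).comap
        (symToEnv σ).toLinearMap := by
    refine iSup₂_le ?_
    rintro l rfl x hx
    exact symToEnv_mem_deg_of_mem_prod σ hx
  exact hle hq

variable {σ} (hσ : diffMap A ∘ₗ σ = LinearMap.id)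

include hσ

theorem lieToEnv_lie_sub_mem_dec (a : A) {k n : ℕ} (h : k + 1 + 1 = n) {u : FreeLie A (Ω[A⁄ℂ])}
    (hu : u ∈ FreeLie.deg A _ (k + 1)) :
    lieToEnv σ ⁅FreeLie.of A _ (D ℂ A a), u⁆ - pb (ι A a) (lieToEnv σ u) ∈ dec A n := by
  have h := contract_ιTensor_lie_sub_mem_dec h (σ (D ℂ A a)) (lieToTensor_mem_baseChange σ hu)
  rwa [← LinearMap.comp_apply (diffMap A), hσ, LinearMap.id_apply, bracketDiff_D, ← lieToTensor_of,
    ← lieToTensor_lie] at h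

theorem lieToEnv_lie_D (a b : A) :
    lieToEnv σ ⁅FreeLie.of A _ (D ℂ A a), FreeLie.of A _ (D ℂ A b)⁆ = pb (ι A a) (ι A b) := by
  rw [lieToEnv, LinearMap.comp_apply, lieToTensor_lie, lieToTensor_of, lieToTensor_of,
    contract_lie_ιTensor (LinearMap.congr_fun hσ (D ℂ A a)), ← LinearMap.comp_apply (diffMap A), hσ,
    LinearMap.id_apply, bracketDiff_D, ← pb_antisymm]

theorem IsWord.exists_sub_lieToEnv_mem_dec {k : ℕ} {x : Env A} (hx : IsWord (k + 1) x) :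
    ∃ u ∈ FreeLie.deg A (Ω[A⁄ℂ]) (k + 1), x - lieToEnv σ u ∈ dec A (k + 1) := by
  induction k generalizing x with
  | zero =>
    obtain _ | ⟨a, hx⟩ := hx
    obtain ⟨b⟩ := hx
    refine ⟨_, FreeLie.of_lie_mem_deg (D ℂ A a) (FreeLie.of_mem_deg (D ℂ A b)), ?_⟩
    rw [lieToEnv_lie_D hσ, sub_self]
    exact zero_mem _
  | succ k ih =>
    obtain _ | @⟨_, a, x, hx⟩ := hx
    obtain ⟨u, hu, h⟩ := ih hx
    refine ⟨_, FreeLie.of_lie_mem_deg (D ℂ A a) hu, ?_⟩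
    have hdec := pb_mem_dec_of_mem_right (k := k + 1 + 1) (by omega) (ι_mem_deg a) h
    rw [← lie_eq_pb, lie_sub, lie_eq_pb, lie_eq_pb] at hdec
    have h := sub_mem hdec (lieToEnv_lie_sub_mem_dec hσ a rfl hu)
    rwa [sub_sub_sub_cancel_right] at h

theorem IsWord.exists_sub_symToEnv_mem_dec {i : ℕ} {w : Env A} (hw : IsWord i w) :
    ∃ q ∈ Q A (Ω[A⁄ℂ]) i, w - symToEnv σ q ∈ dec A i := by
  cases i with
  | zero =>
    obtain ⟨b⟩ := hw
    refine ⟨algebraMap A _ b, algebraMap_mem_Q b, ?_⟩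
    rw [AlgHom.commutes]
    exact sub_self (ι A b) ▸ zero_mem _
  | succ i =>
    obtain ⟨u, hu, h⟩ := hw.exists_sub_lieToEnv_mem_dec hσ
    exact ⟨FreeLie.gen i ⟨u, hu⟩, gen_mem_Q i ⟨u, hu⟩, symToEnv_gen σ i ⟨u, hu⟩ ▸ h⟩

theorem deg_le_map_symToEnv (i : ℕ) :
    deg A i ≤ ((Q A (Ω[A⁄ℂ]) i).map (symToEnv σ).toLinearMap).restrictScalars ℂ := by
  induction i using Nat.strong_induction_on with
  | _ i ih =>
    have hdec : dec A i ≤ ((Q A (Ω[A⁄ℂ]) i).map (symToEnv σ).toLinearMap).restrictScalars ℂ := by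
      refine Submodule.span_le.2 ?_
      rintro _ ⟨j, k, h, x, hx, y, hy, rfl⟩
      obtain ⟨p, hp, rfl⟩ := ih (j + 1) (by omega) hx
      obtain ⟨q, hq, rfl⟩ := ih (k + 1) (by omega) hy
      exact ⟨p * q, mul_mem_Q h hp hq, map_mul (symToEnv σ) p q⟩
    refine (deg_le_wordDec i).trans (sup_le (Submodule.span_le.2 ?_) hdec)
    rintro _ ⟨a, w, hw, rfl⟩
    refine Submodule.smul_mem ((Q A (Ω[A⁄ℂ]) i).map (symToEnv σ).toLinearMap) a ?_
    obtain ⟨q, hq, h⟩ := hw.exists_sub_symToEnv_mem_dec hσ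
    have h := add_mem (hdec h) (Submodule.mem_map_of_mem (f := (symToEnv σ).toLinearMap) hq)
    rwa [AlgHom.toLinearMap_apply, sub_add_cancel] at h

theorem symToEnv_image_Q (i : ℕ) : symToEnv σ '' Q A (Ω[A⁄ℂ]) i = deg A i :=
  Set.Subset.antisymm (Set.image_subset_iff.2 fun _ => symToEnv_mem_deg σ)
    fun _ hx => deg_le_map_symToEnv hσ i hx

end Section

end Env

/-! ### Formally smooth algebras -/

section FormallyDSmooth

open TensorProduct

theorem ncFil_succ_eq_bot_of_commute {S : Type u} [Ring S] [Algebra ℂ S]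
    (h : ∀ x y : S, x * y = y * x) (k : ℕ) : ncFil S (k + 1) = ⊥ := by
  let F : ℕ → Submodule ℂ S := fun k => if k = 0 then ⊤ else ⊥
  have hlie : ∀ k, lieTerm S k ≤ F k := by
    rintro (_ | k)
    · exact le_top
    · rw [lieTerm_succ, Submodule.span_le]
      rintro _ ⟨x, y, -, rfl⟩
      exact sub_eq_zero.2 (h x y)
  have hmul : ∀ i j, F i * F j ≤ F (i + j) := by
    rintro (_ | i) (_ | j)
    · exact le_top
    all_goals simp [F]
  exact le_bot_iff.1 (ncFil_le F hlie hmul (k + 1))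

/-- Formal `d`-smoothness, which is `d`-smoothness without finite generation: `R` lies in `N_d`, and
homomorphisms from `R` lift along the surjections in `N_d` with nilpotent kernel. -/
structure IsFormallyDSmooth (d : ℕ) (R : Type u) [Ring R] [Algebra ℂ R] : Prop where
  ncNilpotent : IsNCNilpotent d R
  formallySmooth : ∀ (S T : Type u) [Ring S] [Algebra ℂ S] [Ring T] [Algebra ℂ T],
    IsNCNilpotent d S → IsNCNilpotent d T → ∀ p : S →ₐ[ℂ] T, Function.Surjective p →
    IsNilpotent (LinearMap.ker p.toLinearMap : Submodule ℂ S) →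
    ∀ f : R →ₐ[ℂ] T, ∃ g : R →ₐ[ℂ] S, p.comp g = f

variable {R : Type u} [Ring R] [Algebra ℂ R] {d : ℕ}

theorem IsDSmooth.isFormallyDSmooth (hR : IsDSmooth d R) : IsFormallyDSmooth d R where
  ncNilpotent := hR.ncNilpotent
  formallySmooth := hR.formallySmooth

theorem IsFormallyDSmooth.formallySmooth_Rab (hR : IsFormallyDSmooth d R) :
    Algebra.FormallySmooth ℂ (Rab R) := by
  refine Algebra.FormallySmooth.of_comp_surjective fun B _ _ I hI f => ?_
  have hker : IsNilpotent (LinearMap.ker (Ideal.Quotient.mkₐ ℂ I).toLinearMap) := by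
    refine ⟨2, le_bot_iff.1 ?_⟩
    rw [pow_two, Submodule.mul_le]
    intro x hx y hy
    have hxy := Ideal.mul_mem_mul (Ideal.Quotient.eq_zero_iff_mem.1 hx)
      (Ideal.Quotient.eq_zero_iff_mem.1 hy)
    rwa [← pow_two, hI] at hxy
  obtain ⟨g, hg⟩ := hR.formallySmooth B (B ⧸ I) (ncFil_succ_eq_bot_of_commute mul_comm d)
    (ncFil_succ_eq_bot_of_commute mul_comm d) (Ideal.Quotient.mkₐ ℂ I)
    (Ideal.Quotient.mkₐ_surjective ℂ I) hker (f.comp (Ideal.Quotient.mkₐ ℂ (ncIdeal R 1)))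
  have hg_ncIdeal : ∀ x ∈ ncIdeal R 1, g x = 0 := fun x hx => by
    have h := map_mem_ncFil g (k := 1) hx
    rwa [ncFil_succ_eq_bot_of_commute mul_comm] at h
  refine ⟨Ideal.Quotient.liftₐ (ncIdeal R 1) g hg_ncIdeal, AlgHom.ext fun a => ?_⟩
  obtain ⟨r, rfl⟩ := Ideal.Quotient.mk_surjective a
  exact DFunLike.congr_fun hg r

theorem IsFormallyDSmooth.exists_section (hR : IsFormallyDSmooth d R) :
    ∃ σ : Ω[Rab R⁄ℂ] →ₗ[Rab R] Rab R ⊗[ℂ] Rab R, Env.diffMap (Rab R) ∘ₗ σ = LinearMap.id := by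
  have := hR.formallySmooth_Rab
  exact Module.projective_lifting_property _ _ Env.diffMap_surjective

end FormallyDSmooth

/-! ### Jets -/

namespace FreeLie

section Truncation

variable {A M : Type u} [CommRing A] [AddCommGroup M] [Module A M]

theorem lieFil_le_weightIdeal (i : ℕ) :
    lieFil A M (i + 1) ≤ (weightIdeal A M (i + 2)).restrictScalars A := by
  refine iSup₂_le fun l hl v hv => ?_
  have hpos : 0 < l.length := List.length_pos_iff.2 fun h => by
    rw [h, List.sum_nil] at hl
    omega
  change Polynomial.X ^ (i + 2) ∣ weight A M v
  rw [weight_lieProd hv, Polynomial.X_pow_dvd_iff]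
  intro w hw
  rw [Polynomial.coeff_monomial, if_neg (by omega)]

theorem quotient_weightIdeal_two_comm (x y : TensorAlgebra A M ⧸ weightIdeal A M 2) :
    x * y = y * x := by
  obtain ⟨x, rfl⟩ := Ideal.Quotient.mk_surjective x
  obtain ⟨y, rfl⟩ := Ideal.Quotient.mk_surjective y
  rw [← map_mul, ← map_mul]
  exact Ideal.Quotient.eq.2 (lieFil_le_weightIdeal 0 (commutator_mem_lieFil x (mem_lieFil_zero y)))

variable [Algebra ℂ A] [Module ℂ M] [IsScalarTower ℂ A M]

theorem truncIdeal_le_weightIdeal_two (d : ℕ) {n : ℕ} (hn : 2 ≤ n) :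
    truncIdeal A M d n ≤ weightIdeal A M 2 :=
  sup_le (weightIdeal_antitone hn) fun _ hx =>
    weightIdeal_antitone (Nat.le_add_left 2 d) (lieFil_le_weightIdeal d (ncFil_le_lieFil _ hx))

variable (A M) in
/-- The projection of the truncated tensor algebra onto the truncation in weight `2`. -/
noncomputable def truncProj (d : ℕ) {n : ℕ} (hn : 2 ≤ n) :
    TensorAlgebra A M ⧸ truncIdeal A M d n →ₐ[ℂ] TensorAlgebra A M ⧸ weightIdeal A M 2 :=
  Ideal.Quotient.factorₐ ℂ (truncIdeal_le_weightIdeal_two d hn)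

theorem isNilpotent_ker_truncProj (d : ℕ) {n : ℕ} (hn : 2 ≤ n) :
    IsNilpotent (LinearMap.ker (truncProj A M d hn).toLinearMap) := by
  have hpow : ∀ k, LinearMap.ker (truncProj A M d hn).toLinearMap ^ k ≤
      ((weightIdeal A M (2 * k)).restrictScalars ℂ).map
        (Ideal.Quotient.mkₐ ℂ (truncIdeal A M d n)).toLinearMap := by
    intro k
    induction k with
    | zero =>
      intro x _
      obtain ⟨t, rfl⟩ := Ideal.Quotient.mk_surjective x
      exact ⟨t, one_dvd _, rfl⟩
    | succ k ih =>
      rw [pow_succ, Submodule.mul_le]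
      intro x hx y hy
      obtain ⟨x, hx', rfl⟩ := ih hx
      obtain ⟨y, rfl⟩ := Ideal.Quotient.mk_surjective y
      have hy : y ∈ weightIdeal A M 2 := Ideal.Quotient.eq_zero_iff_mem.1 hy
      exact ⟨x * y, mul_mem_weightIdeal rfl hx' hy,
        map_mul (Ideal.Quotient.mkₐ ℂ (truncIdeal A M d n)) x y⟩
  refine ⟨n, le_bot_iff.1 ((hpow n).trans ?_)⟩
  rintro _ ⟨t, ht, rfl⟩
  exact Ideal.Quotient.eq_zero_iff_mem.2
    (Submodule.mem_sup_left (weightIdeal_antitone (by omega) ht))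

end Truncation

end FreeLie

open FreeLie KaehlerDifferential TensorProduct

section Differentials

variable (A : Type u) [CommRing A] [Algebra ℂ A]

/-- The tensor algebra of the Kähler differentials. -/
abbrev FormAlgebra : Type u := TensorAlgebra A (Ω[A⁄ℂ])

/-- The truncated tensor algebra of the Kähler differentials, in which jets take their values. -/
abbrev JetAlgebra (d n : ℕ) : Type u := FormAlgebra A ⧸ truncIdeal A (Ω[A⁄ℂ]) d n

variable {A}

/-- The differential `da` as an element of the tensor algebra. -/
noncomputable abbrev form (a : A) : FormAlgebra A := TensorAlgebra.ι A (D ℂ A a)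

variable (A) in
/-- The homomorphism `a ↦ a + da`. -/
noncomputable def oneJet : A →ₐ[ℂ] FormAlgebra A ⧸ weightIdeal A (Ω[A⁄ℂ]) 2 where
  toFun a := Ideal.Quotient.mk (weightIdeal A (Ω[A⁄ℂ]) 2) (algebraMap A _ a + form a)
  map_one' := by rw [form, Derivation.map_one_eq_zero, map_zero, add_zero, map_one, map_one]
  map_zero' := by rw [form, map_zero, map_zero, map_zero, add_zero, map_zero]
  map_add' a b := by
    rw [← map_add, map_add (algebraMap A _), form, map_add (D ℂ A), map_add (TensorAlgebra.ι A),
      add_add_add_comm]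
  map_mul' a b := by
    have hdiff : algebraMap A _ (a * b) + form (a * b) -
        (algebraMap A _ a + form a) * (algebraMap A _ b + form b) = -(form a * form b) := by
      rw [map_mul, form, Derivation.leibniz, map_add, map_smul, map_smul, Algebra.smul_def,
        Algebra.smul_def, Algebra.commutes b]
      noncomm_ring
    rw [← map_mul, Ideal.Quotient.eq, hdiff]
    exact neg_mem (mul_mem_weightIdeal (Nat.add_comm 1 1) (ι_mem_weightIdeal (D ℂ A a))
      (ι_mem_weightIdeal (D ℂ A b)))
  commutes' c := by
    rw [form, Derivation.map_algebraMap, map_zero, add_zero]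
    rfl

end Differentials

theorem algebraMap_add_lie_algebraMap_add {A B : Type*} [CommRing A] [Ring B] [Algebra A B]
    (a b : A) (x y : B) : ⁅algebraMap A B a + x, algebraMap A B b + y⁆ = ⁅x, y⁆ := by
  simp only [Ring.lie_def, add_mul, mul_add, Algebra.commutes a y, Algebra.commutes b x,
    Algebra.commutes a (algebraMap A B b)]
  abel

section Jets

variable {R : Type u} [Ring R] [Algebra ℂ R] {d n : ℕ}

/-- The homomorphisms which are equal to `r ↦ r + dr` modulo elements of weight at least `2`. -/
def IsJet (g : R →ₐ[ℂ] JetAlgebra (Rab R) d n) : Prop :=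
  ∀ r, ∃ t, Ideal.Quotient.mk _ t = g r ∧
    t - (algebraMap (Rab R) _ (Ideal.Quotient.mk _ r) + form (Ideal.Quotient.mk _ r)) ∈
      weightIdeal (Rab R) (Ω[Rab R⁄ℂ]) 2

theorem IsFormallyDSmooth.exists_isJet (hR : IsFormallyDSmooth d R) (hn : 2 ≤ n) :
    ∃ g : R →ₐ[ℂ] JetAlgebra (Rab R) d n, IsJet g := by
  obtain ⟨g, hg⟩ := hR.formallySmooth _ _ (isNCNilpotent_quotient_truncIdeal d n)
    (ncFil_succ_eq_bot_of_commute quotient_weightIdeal_two_comm d) (truncProj _ _ d hn)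
    (Ideal.Quotient.factor_surjective (truncIdeal_le_weightIdeal_two d hn))
    (isNilpotent_ker_truncProj d hn) ((oneJet (Rab R)).comp (Ideal.Quotient.mkₐ ℂ (ncIdeal R 1)))
  refine ⟨g, fun r => ?_⟩
  obtain ⟨t, ht⟩ := Ideal.Quotient.mk_surjective (g r)
  refine ⟨t, ht, Ideal.Quotient.eq.1 ?_⟩
  have h : truncProj _ _ d hn (g r) = oneJet (Rab R) (Ideal.Quotient.mk _ r) :=
    DFunLike.congr_fun hg r
  rwa [← ht] at h

/-- The element `z` of `gr^i_F(R)` is the symbol of an element of `R` whose image under `g` has the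
form `a + t` with a constant `a` and with `t` of weight at least `w`, where `v` is the component of
`t` in weight `w`. -/
def HasLeadingModConst (g : R →ₐ[ℂ] JetAlgebra (Rab R) d n) (i w : ℕ) (z : Gr R)
    (v : FormAlgebra (Rab R)) : Prop :=
  ∃ (x : ncFil R i) (a : Rab R) (t : FormAlgebra (Rab R)), Gr.symb R i x = z ∧
    Ideal.Quotient.mk _ (algebraMap _ _ a + t) = g x ∧
      t ∈ weightIdeal (Rab R) (Ω[Rab R⁄ℂ]) w ∧ (weight _ _ t).coeff w = v

/-- The element `z` of `gr^i_F(R)` is the symbol of an element of `R` whose image under `g` has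
weight at least `w`, with component `v` in weight `w`. -/
def HasLeading (g : R →ₐ[ℂ] JetAlgebra (Rab R) d n) (i w : ℕ) (z : Gr R)
    (v : FormAlgebra (Rab R)) : Prop :=
  ∃ (x : ncFil R i) (t : FormAlgebra (Rab R)), Gr.symb R i x = z ∧
    Ideal.Quotient.mk _ t = g x ∧
      t ∈ weightIdeal (Rab R) (Ω[Rab R⁄ℂ]) w ∧ (weight _ _ t).coeff w = v

variable {g : R →ₐ[ℂ] JetAlgebra (Rab R) d n} {i j k w w' : ℕ} {z z' : Gr R}
  {v v' : FormAlgebra (Rab R)}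

theorem IsJet.hasLeadingModConst_ofRab (hg : IsJet g) (a : Rab R) :
    HasLeadingModConst g 0 1 (Gr.ofRab R a) (form a) := by
  obtain ⟨r, rfl⟩ := Ideal.Quotient.mk_surjective a
  obtain ⟨t, ht, hmem⟩ := hg r
  set a : Rab R := Ideal.Quotient.mk _ r
  rw [← sub_sub] at hmem
  refine ⟨⟨r, Gr.mem_ncFil_zero r⟩, a, t - algebraMap (Rab R) _ a, (Gr.ofRab_mk r).symm, ?_, ?_, ?_⟩
  · rw [add_sub_cancel, ht]
  · have h := add_mem (weightIdeal_antitone one_le_two hmem) (ι_mem_weightIdeal (D ℂ (Rab R) a))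
    rwa [sub_add_cancel] at h
  · have h := coeff_weight_eq_zero hmem one_lt_two
    rwa [map_sub, Polynomial.coeff_sub, weight_ι, Polynomial.coeff_monomial, if_pos rfl,
      sub_eq_zero] at h

theorem IsJet.hasLeading_ofRab (hg : IsJet g) (a : Rab R) :
    HasLeading g 0 0 (Gr.ofRab R a) (algebraMap _ _ a) := by
  obtain ⟨r, rfl⟩ := Ideal.Quotient.mk_surjective a
  obtain ⟨t, ht, hmem⟩ := hg r
  refine ⟨⟨r, Gr.mem_ncFil_zero r⟩, t, (Gr.ofRab_mk r).symm, ht, one_dvd _, ?_⟩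
  have h := coeff_weight_eq_zero hmem two_pos
  rwa [map_sub, map_add, Polynomial.coeff_sub, Polynomial.coeff_add, coeff_weight_algebraMap,
    if_pos rfl, coeff_weight_eq_zero (ι_mem_weightIdeal _) one_pos, add_zero, sub_eq_zero] at h

namespace HasLeading

theorem hasLeadingModConst (h : HasLeading g i w z v) : HasLeadingModConst g i w z v := by
  obtain ⟨x, t, hx, ht, hw, hv⟩ := h
  exact ⟨x, 0, t, hx, by rw [map_zero, zero_add, ht], hw, hv⟩

theorem zero (i w : ℕ) : HasLeading g i w 0 0 :=
  ⟨0, 0, map_zero _, by rw [map_zero, ZeroMemClass.coe_zero, map_zero], zero_mem _, by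
    rw [map_zero, Polynomial.coeff_zero]⟩

theorem add (h : HasLeading g i w z v) (h' : HasLeading g i w z' v') :
    HasLeading g i w (z + z') (v + v') := by
  obtain ⟨x, t, rfl, ht, hw, rfl⟩ := h
  obtain ⟨x', t', rfl, ht', hw', rfl⟩ := h'
  exact ⟨x + x', t + t', map_add _ _ _,
    by rw [map_add, ht, ht', Submodule.coe_add, map_add], add_mem hw hw',
    by rw [map_add, Polynomial.coeff_add]⟩

theorem mul (hi : i + j = k) {m : ℕ} (hw : w + w' = m) (h : HasLeading g i w z v)
    (h' : HasLeading g j w' z' v') : HasLeading g k m (z * z') (v * v') := by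
  subst hi hw
  obtain ⟨⟨x, hx⟩, t, rfl, ht, hw, rfl⟩ := h
  obtain ⟨⟨x', hx'⟩, t', rfl, ht', hw', rfl⟩ := h'
  exact ⟨⟨x * x', mul_mem_ncFil hx hx'⟩, t * t', (Gr.symb_mul i j hx hx').symm,
    by rw [map_mul, ht, ht', map_mul], mul_mem_weightIdeal rfl hw hw', coeff_weight_mul hw hw'⟩

theorem of_lt (hw : w' < w) (h : HasLeading g i w z v) : HasLeading g i w' z 0 := by
  obtain ⟨x, t, rfl, ht, ht', rfl⟩ := h
  exact ⟨x, t, rfl, ht, weightIdeal_antitone hw.le ht', coeff_weight_eq_zero ht' hw⟩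

theorem opSymbol_eq_zero {s : ℕ} (hi : i ≤ d) (hn : i + s < n) (h : HasLeading g i (i + s) 0 v) :
    opSymbol (Rab R) (Ω[Rab R⁄ℂ]) s v = 0 := by
  obtain ⟨⟨x, hx⟩, t, hz, ht, _, rfl⟩ := h
  refine opSymbol_coeff_weight_eq_zero_of_mk_mem_ncFil hi hn ?_
  rw [ht]
  exact map_mem_ncFil g (Gr.symb_eq_zero_iff.1 hz)

end HasLeading

theorem HasLeadingModConst.pb (hi : i + j + 1 = k) {m : ℕ} (hw : w + w' = m)
    (h : HasLeadingModConst g i w z v) (h' : HasLeadingModConst g j w' z' v') :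
    HasLeading g k m (pb z z') ⁅v, v'⁆ := by
  subst hi hw
  obtain ⟨⟨x, hx⟩, a, t, rfl, ht, hw, rfl⟩ := h
  obtain ⟨⟨y, hy⟩, b, s, rfl, hs, hw', rfl⟩ := h'
  refine ⟨⟨x * y - y * x, comm_mem_ncFil hx hy⟩, ⁅t, s⁆, (Gr.pb_symb ..).symm, ?_, ?_, ?_⟩
  · rw [← algebraMap_add_lie_algebraMap_add a b, Ring.lie_def, map_sub, map_mul, map_mul, ht, hs,
      map_sub, map_mul, map_mul]
  · exact sub_mem (mul_mem_weightIdeal rfl hw hw') (mul_mem_weightIdeal (Nat.add_comm ..) hw' hw)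
  · rw [Ring.lie_def, map_sub, Polynomial.coeff_sub, coeff_weight_mul hw hw', Nat.add_comm w,
      coeff_weight_mul hw' hw, Ring.lie_def]

end Jets

/-! ### Leading components of Lie words and of their products -/

section WordSymbols

attribute [local instance 100] LieRing.ofAssociativeRing

variable {A : Type u} [CommRing A] [Algebra ℂ A]

/-- The pairs of a right-normed word with `k` brackets in the Poisson envelope and the same word
in the differentials of its letters, bracketed in the tensor algebra. -/
inductive IsWordSymbol : ℕ → Env A → FormAlgebra A → Prop
  | of (a : A) : IsWordSymbol 0 (Env.ι A a) (form a)
  | pb (a : A) {k : ℕ} {y : Env A} {v : FormAlgebra A} (h : IsWordSymbol k y v) :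
      IsWordSymbol (k + 1) (pb (Env.ι A a) y) ⁅form a, v⁆

variable (A) in
/-- The span of the pairs `(1 ⊗ y, v)` for which `v` is the symbol of the word `y`. -/
noncomputable def wordSymbolSpan (k : ℕ) : Submodule A ((A ⊗[ℂ] Env A) × FormAlgebra A) :=
  Submodule.span A {p | ∃ y v, IsWordSymbol k y v ∧ ((1 : A) ⊗ₜ[ℂ] y, v) = p}

theorem mk_ιTensor_mem_wordSymbolSpan (w : A ⊗[ℂ] A) :
    (Env.ιTensor A w, TensorAlgebra.ι A (Env.diffMap A w)) ∈ wordSymbolSpan A 0 := by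
  induction w with
  | zero =>
    rw [map_zero, map_zero, map_zero]
    exact zero_mem _
  | tmul a b =>
    have h : (Env.ιTensor A (a ⊗ₜ b), TensorAlgebra.ι A (Env.diffMap A (a ⊗ₜ b))) =
        a • ((1 : A) ⊗ₜ[ℂ] Env.ι A b, form b) := by
      rw [Env.ιTensor_tmul, Env.diffMap_tmul, map_smul, Prod.smul_mk, smul_tmul', smul_eq_mul,
        mul_one]
    rw [h]
    exact Submodule.smul_mem _ a (Submodule.subset_span ⟨_, _, .of b, rfl⟩)
  | add x y hx hy =>
    rw [map_add, map_add, map_add]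
    exact add_mem hx hy

theorem mk_lie_form_mem_wordSymbolSpan (b : A) {k : ℕ} {p : (A ⊗[ℂ] Env A) × FormAlgebra A}
    (hp : p ∈ wordSymbolSpan A k) :
    (⁅(1 : A) ⊗ₜ[ℂ] Env.ι A b, p.1⁆, ⁅form b, p.2⁆) ∈ wordSymbolSpan A (k + 1) := by
  let bracket := (LieModule.toEnd A (A ⊗[ℂ] Env A) (A ⊗[ℂ] Env A) ((1 : A) ⊗ₜ Env.ι A b)).prodMap
    (LinearMap.mulLeft A (form b) - LinearMap.mulRight A (form b))
  have hle : wordSymbolSpan A k ≤ (wordSymbolSpan A (k + 1)).comap bracket := by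
    refine Submodule.span_le.2 ?_
    rintro _ ⟨y, v, h, rfl⟩
    have hy := Env.tmul_lie_tmul 1 1 (Env.ι A b) y
    rw [mul_one] at hy
    exact Submodule.subset_span ⟨_, _, h.pb b, Prod.ext hy.symm rfl⟩
  exact hle hp

theorem mk_lie_ιTensor_mem_wordSymbolSpan (w : A ⊗[ℂ] A) {k : ℕ}
    {p : (A ⊗[ℂ] Env A) × FormAlgebra A} (hp : p ∈ wordSymbolSpan A k) :
    (⁅Env.ιTensor A w, p.1⁆, ⁅TensorAlgebra.ι A (Env.diffMap A w), p.2⁆) ∈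
      wordSymbolSpan A (k + 1) := by
  let bracket : A ⊗[ℂ] A →ₗ[A] (A ⊗[ℂ] Env A) × FormAlgebra A :=
    ((LieModule.toEnd A (A ⊗[ℂ] Env A) (A ⊗[ℂ] Env A)).toLinearMap.flip p.1 ∘ₗ Env.ιTensor A).prod
      ((LinearMap.mulRight A p.2 - LinearMap.mulLeft A p.2) ∘ₗ TensorAlgebra.ι A ∘ₗ Env.diffMap A)
  change bracket w ∈ wordSymbolSpan A (k + 1)
  induction w with
  | zero =>
    rw [map_zero]
    exact zero_mem _
  | tmul a b =>
    have hb := mk_lie_form_mem_wordSymbolSpan b hp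
    rw [← Env.ιTensor_tmul, form, ← one_smul A (D ℂ A b), ← Env.diffMap_tmul] at hb
    rw [← mul_one a, ← smul_eq_mul, ← smul_tmul', map_smul]
    exact Submodule.smul_mem _ a hb
  | add x y hx hy =>
    rw [map_add]
    exact add_mem hx hy

variable {σ : Ω[A⁄ℂ] →ₗ[A] A ⊗[ℂ] A}

theorem mk_lieToTensor_mem_wordSymbolSpan (hσ : Env.diffMap A ∘ₗ σ = LinearMap.id) {k : ℕ}
    {u : FreeLie A (Ω[A⁄ℂ])} (hu : u ∈ FreeLie.deg A (Ω[A⁄ℂ]) k) :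
    (Env.lieToTensor σ u, toTensor A (Ω[A⁄ℂ]) u) ∈ wordSymbolSpan A k := by
  have of_mem (m : Ω[A⁄ℂ]) :
      (Env.lieToTensor σ (of A _ m), toTensor A _ (of A _ m)) ∈ wordSymbolSpan A 0 := by
    have h := mk_ιTensor_mem_wordSymbolSpan (σ m)
    rwa [← LinearMap.comp_apply (Env.diffMap A), hσ, LinearMap.id_apply, ← Env.lieToTensor_of,
      ← toTensor_of] at h
  refine FreeLie.deg_le (N := fun k => (wordSymbolSpan A k).comap
    ((Env.lieToTensor σ).prod (toTensor A (Ω[A⁄ℂ])))) of_mem (fun k m y _ hy => ?_) k hu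
  have h := mk_lie_ιTensor_mem_wordSymbolSpan (σ m) hy
  rw [← LinearMap.comp_apply (Env.diffMap A), hσ, LinearMap.id_apply, ← Env.lieToTensor_of,
    ← toTensor_of] at h
  change (Env.lieToTensor σ _, toTensor A (Ω[A⁄ℂ]) _) ∈ wordSymbolSpan A (k + 1)
  rwa [Env.lieToTensor_lie, toTensor_lie]

end WordSymbols

section Leading

variable {R : Type u} [Ring R] [Algebra ℂ R] {d n : ℕ} {g : R →ₐ[ℂ] JetAlgebra (Rab R) d n}
  {k : ℕ}

theorem IsWordSymbol.hasLeadingModConst (hg : IsJet g) {y : Env (Rab R)} {v : FormAlgebra (Rab R)}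
    (h : IsWordSymbol k y v) : HasLeadingModConst g k (k + 1) (Gr.envHom R y) v := by
  induction h with
  | of a =>
    rw [Gr.envHom_ι]
    exact hg.hasLeadingModConst_ofRab a
  | pb a _ ih =>
    rw [Gr.envHom_pb, Gr.envHom_ι]
    exact ((hg.hasLeadingModConst_ofRab a).pb (by omega) (by omega) ih).hasLeadingModConst

theorem IsWordSymbol.hasLeading (hg : IsJet g) {y : Env (Rab R)} {v : FormAlgebra (Rab R)}
    (h : IsWordSymbol (k + 1) y v) : HasLeading g (k + 1) (k + 2) (Gr.envHom R y) v := by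
  cases h with
  | pb a h =>
    rw [Gr.envHom_pb, Gr.envHom_ι]
    exact (hg.hasLeadingModConst_ofRab a).pb (by omega) (by omega) (h.hasLeadingModConst hg)

theorem IsJet.hasLeading_of_mem_wordSymbolSpan (hg : IsJet g)
    {p : (Rab R ⊗[ℂ] Env (Rab R)) × FormAlgebra (Rab R)} (hp : p ∈ wordSymbolSpan (Rab R) (k + 1)) :
    HasLeading g (k + 1) (k + 2) (Gr.envHom R (Env.contract (Rab R) p.1)) p.2 := by
  induction hp using Submodule.span_induction with
  | mem p hp =>
    obtain ⟨y, v, h, rfl⟩ := hp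
    rw [Env.contract_tmul, map_one, one_mul]
    exact h.hasLeading hg
  | zero =>
    rw [Prod.fst_zero, map_zero, map_zero]
    exact .zero _ _
  | add p q _ _ hp hq =>
    rw [Prod.fst_add, map_add, map_add]
    exact hp.add hq
  | smul a p _ hp =>
    rw [Prod.smul_fst, map_smul, Env.smul_eq_ι_mul, map_mul, Gr.envHom_ι, Prod.smul_snd,
      Algebra.smul_def]
    exact (hg.hasLeading_ofRab a).mul (Nat.zero_add _) (Nat.zero_add _) hp

variable {σ : Ω[Rab R⁄ℂ] →ₗ[Rab R] Rab R ⊗[ℂ] Rab R}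

theorem IsJet.hasLeading_gen (hg : IsJet g) (hσ : Env.diffMap (Rab R) ∘ₗ σ = LinearMap.id)
    (u : FreeLie.deg (Rab R) (Ω[Rab R⁄ℂ]) (k + 1)) :
    HasLeading g (k + 1) (k + 2) (Gr.envHom R (Env.symToEnv σ (gen k u)))
      (toTensor (Rab R) (Ω[Rab R⁄ℂ]) u) := by
  rw [Env.symToEnv_gen]
  exact hg.hasLeading_of_mem_wordSymbolSpan (mk_lieToTensor_mem_wordSymbolSpan hσ u.2)

theorem IsJet.exists_hasLeading (hg : IsJet g) (hσ : Env.diffMap (Rab R) ∘ₗ σ = LinearMap.id)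
    {l : List ℕ} {q : SymmetricAlgebra (Rab R) (LiePlus (Rab R) (Ω[Rab R⁄ℂ]))}
    (hq : q ∈ (l.map fun k => symGen (Rab R) (Ω[Rab R⁄ℂ]) k).prod) :
    ∃ v, (v, q) ∈ (l.map (genPair (Rab R) (Ω[Rab R⁄ℂ]))).prod ∧
      HasLeading g (l.map fun k => k + 1).sum ((l.map fun k => k + 1).sum + l.length)
        (Gr.envHom R (Env.symToEnv σ q)) v := by
  induction l generalizing q with
  | nil =>
    obtain ⟨a, rfl⟩ := Submodule.mem_one.1 hq
    refine ⟨algebraMap _ _ a, Submodule.mem_one.2 ⟨a, rfl⟩, ?_⟩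
    rw [AlgHom.commutes, Algebra.algebraMap_eq_smul_one, Env.smul_eq_ι_mul, mul_one, Gr.envHom_ι]
    exact hg.hasLeading_ofRab a
  | cons k l ih =>
    simp only [List.map_cons, List.prod_cons, List.sum_cons, List.length_cons] at hq ⊢
    induction hq using Submodule.mul_induction_on' with
    | mem_mul_mem x hx y hy =>
      obtain ⟨u, rfl⟩ := hx
      obtain ⟨v, hv, h⟩ := ih hy
      refine ⟨toTensor _ _ u * v, Submodule.mul_mem_mul (M := genPair _ _ k) ⟨u, rfl⟩ hv, ?_⟩
      rw [map_mul, map_mul]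
      exact (hg.hasLeading_gen hσ u).mul rfl (by omega) h
    | add x _ y _ hx hy =>
      obtain ⟨v, hv, h⟩ := hx
      obtain ⟨w, hw, h'⟩ := hy
      refine ⟨v + w, add_mem hv hw, ?_⟩
      rw [map_add, map_add]
      exact h.add h'

end Leading

/-! ### Injectivity on the polynomials in Lie elements -/

section LengthFiltration

variable (A M : Type u) [CommRing A] [AddCommGroup M] [Module A M]

/-- The part of `Q^i_A(M)` spanned by the products of at least `s` Lie elements: the filtration
along which the leading components of a jet determine an element of `Q^i_A(M)` step by step. -/
noncomputable def QFil (i s : ℕ) : Submodule A (SymmetricAlgebra A (LiePlus A M)) :=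
  ⨆ l : {l : List ℕ // (l.map fun k => k + 1).sum = i ∧ s ≤ l.length},
    (l.1.map fun k => symGen A M k).prod

variable {A M}

theorem prod_symGen_le_QFil {i s : ℕ} {l : List ℕ} (hl : (l.map fun k => k + 1).sum = i)
    (hs : s ≤ l.length) : (l.map fun k => symGen A M k).prod ≤ QFil A M i s :=
  le_iSup (fun l : {l : List ℕ // (l.map fun k => k + 1).sum = i ∧ s ≤ l.length} =>
    (l.1.map fun k => symGen A M k).prod) ⟨l, hl, hs⟩

theorem Q_le_QFil_zero (i : ℕ) : Q A M i ≤ QFil A M i 0 :=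
  iSup₂_le fun _ hl => prod_symGen_le_QFil hl (Nat.zero_le _)

theorem QFil_eq_bot {i s : ℕ} (h : i < s) : QFil A M i s = ⊥ := by
  refine le_bot_iff.1 (iSup_le ?_)
  rintro ⟨l, rfl, hl⟩
  have hlen : l.length ≤ (l.map fun k => k + 1).sum := by
    simpa only [List.length_map] using List.length_le_sum_of_one_le (l.map fun k => k + 1)
      (List.forall_mem_map.2 fun _ _ => Nat.le_add_left 1 _)
  omega

end LengthFiltration

section Injective

variable {R : Type u} [Ring R] [Algebra ℂ R] {d n : ℕ} {g : R →ₐ[ℂ] JetAlgebra (Rab R) d n}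
  {σ : Ω[Rab R⁄ℂ] →ₗ[Rab R] Rab R ⊗[ℂ] Rab R} {i s : ℕ}
  {q : SymmetricAlgebra (Rab R) (LiePlus (Rab R) (Ω[Rab R⁄ℂ]))}

theorem IsJet.exists_opSymbol_eq (hg : IsJet g) (hσ : Env.diffMap (Rab R) ∘ₗ σ = LinearMap.id)
    (hq : q ∈ QFil (Rab R) (Ω[Rab R⁄ℂ]) i s) :
    ∃ q' ∈ QFil (Rab R) (Ω[Rab R⁄ℂ]) i (s + 1), ∃ v,
      HasLeading g i (i + s) (Gr.envHom R (Env.symToEnv σ q)) v ∧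
        opSymbol (Rab R) (Ω[Rab R⁄ℂ]) s v = (s.factorial : Rab R) • (q - q') := by
  induction hq using Submodule.iSup_induction' with
  | mem l x hx =>
    obtain ⟨l, rfl, hl⟩ := l
    obtain ⟨v, hv, h⟩ := hg.exists_hasLeading hσ hx
    obtain rfl | hlt := hl.eq_or_lt
    · refine ⟨0, zero_mem _, v, h, ?_⟩
      rw [opSymbol_eq_factorial_smul hv, sub_zero]
    · refine ⟨x, prod_symGen_le_QFil rfl hlt hx, 0, h.of_lt (Nat.add_lt_add_left hlt _), ?_⟩
      rw [map_zero, sub_self, smul_zero]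
  | zero =>
    refine ⟨0, zero_mem _, 0, ?_, ?_⟩
    · rw [map_zero, map_zero]
      exact .zero _ _
    · rw [map_zero, sub_zero, smul_zero]
  | add x y _ _ hx hy =>
    obtain ⟨x', hx', v, hv, hxv⟩ := hx
    obtain ⟨y', hy', w, hw, hyw⟩ := hy
    refine ⟨x' + y', add_mem hx' hy', v + w, ?_, ?_⟩
    · rw [map_add, map_add]
      exact hv.add hw
    · rw [map_add, hxv, hyw, ← smul_add, add_sub_add_comm]

theorem IsJet.eq_zero_of_envHom_symToEnv_eq_zero (hg : IsJet g)
    (hσ : Env.diffMap (Rab R) ∘ₗ σ = LinearMap.id) (hi : i ≤ d) (hn : 2 * d < n)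
    (hq : q ∈ Q (Rab R) (Ω[Rab R⁄ℂ]) i) (h : Gr.envHom R (Env.symToEnv σ q) = 0) : q = 0 := by
  have hmem : ∀ s ≤ i + 1, q ∈ QFil (Rab R) (Ω[Rab R⁄ℂ]) i s := by
    intro s hs
    induction s with
    | zero => exact Q_le_QFil_zero i hq
    | succ s ih =>
      obtain ⟨q', hq', v, hv, hsymbol⟩ := hg.exists_opSymbol_eq hσ (ih (by omega))
      rw [h] at hv
      rw [hv.opSymbol_eq_zero hi (by omega), eq_comm,
        (IsUnit.natCast_factorial_of_algebra ℂ s).smul_eq_zero, sub_eq_zero] at hsymbol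
      rwa [hsymbol]
  simpa only [QFil_eq_bot i.lt_succ_self, Submodule.mem_bot] using hmem (i + 1) le_rfl

namespace IsFormallyDSmooth

theorem eq_zero_of_envHom_symToEnv_eq_zero (hR : IsFormallyDSmooth d R)
    (hσ : Env.diffMap (Rab R) ∘ₗ σ = LinearMap.id) (hi : i ≤ d)
    (hq : q ∈ Q (Rab R) (Ω[Rab R⁄ℂ]) i) (h : Gr.envHom R (Env.symToEnv σ q) = 0) : q = 0 := by
  obtain ⟨g, hg⟩ := hR.exists_isJet (n := 2 * d + 2) (by omega)
  exact hg.eq_zero_of_envHom_symToEnv_eq_zero hσ hi (by omega) hq h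

theorem eq_zero_of_envHom_eq_zero (hR : IsFormallyDSmooth d R) (hi : i ≤ d) {x : Env (Rab R)}
    (hx : x ∈ Env.deg (Rab R) i) (h : Gr.envHom R x = 0) : x = 0 := by
  obtain ⟨σ, hσ⟩ := hR.exists_section
  rw [← SetLike.mem_coe, ← Env.symToEnv_image_Q hσ] at hx
  obtain ⟨q, hq, rfl⟩ := hx
  rw [hR.eq_zero_of_envHom_symToEnv_eq_zero hσ hi hq h, map_zero]

theorem nonempty_deg_equiv_Q (hR : IsFormallyDSmooth d R) (hi : i ≤ d) :
    Nonempty (Gr.deg R i ≃ₗ[Rab R] Q (Rab R) (Ω[Rab R⁄ℂ]) i) := by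
  obtain ⟨σ, hσ⟩ := hR.exists_section
  let f : SymmetricAlgebra (Rab R) (LiePlus (Rab R) (Ω[Rab R⁄ℂ])) →ₐ[Rab R] Gr R :=
    AlgHom.comp { Gr.envHom R with commutes' := Gr.envHom_ι } (Env.symToEnv σ)
  let fQ := f.toLinearMap.domRestrict (Q (Rab R) (Ω[Rab R⁄ℂ]) i)
  have hinj : Function.Injective fQ := (injective_iff_map_eq_zero fQ).2 fun q h =>
    Subtype.ext (hR.eq_zero_of_envHom_symToEnv_eq_zero hσ hi q.2 h)
  have hrange : LinearMap.range fQ = Gr.deg R i := by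
    rw [LinearMap.range_domRestrict]
    refine SetLike.coe_injective ?_
    rw [← Gr.envHom_image_deg, ← Env.symToEnv_image_Q hσ, Set.image_image]
    rfl
  exact ⟨((LinearEquiv.ofInjective fQ hinj).trans (LinearEquiv.ofEq _ _ hrange)).symm⟩

end IsFormallyDSmooth

end Injective

end NCGeom

open NCGeom in
theorem theorem4p2p1_general {R : Type u} [Ring R] [Algebra ℂ R] (d : ℕ)
    (hR : IsFormallyDSmooth d R) :
    (∃ e : (Env (Rab R) ⧸ Env.ge (Rab R) (d + 1)) ≃ₐ[ℂ] Gr R,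
      ((∀ x y, e (pb x y) = pb (e x) (e y)) ∧
        (∀ a : Rab R, e (Ideal.Quotient.mk _ (Env.ι (Rab R) a)) = Gr.ofRab R a)) ∧
      (∀ i : ℕ, (fun x => e (Ideal.Quotient.mk _ x)) '' (Env.deg (Rab R) i : Set (Env (Rab R))) =
        (Gr.deg R i : Set (Gr R))) ∧
      ∀ e' : (Env (Rab R) ⧸ Env.ge (Rab R) (d + 1)) ≃ₐ[ℂ] Gr R,
        (∀ x y, e' (pb x y) = pb (e' x) (e' y)) →
        (∀ a : Rab R, e' (Ideal.Quotient.mk _ (Env.ι (Rab R) a)) = Gr.ofRab R a) → e' = e) ∧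
    ∀ i : ℕ, i ≤ d → Nonempty (Gr.deg R i ≃ₗ[Rab R] Q (Rab R) (Ω[Rab R⁄ℂ]) i) := by
  have hinj : ∀ i < d + 1, ∀ x ∈ Env.deg (Rab R) i, Gr.envHom R x = 0 → x = 0 :=
    fun i hi x hx h => hR.eq_zero_of_envHom_eq_zero (Nat.le_of_lt_succ hi) hx h
  refine ⟨⟨Gr.envEquiv hR.ncNilpotent hinj,
    ⟨Gr.envEquiv_pb hR.ncNilpotent hinj, Gr.envHom_ι⟩, Gr.envHom_image_deg,
    fun e' hpb hι => AlgEquiv.ext ?_⟩,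
    fun i hi => hR.nonempty_deg_equiv_Q hi⟩
  exact Ideal.Quotient.mk_surjective.forall.2
    (DFunLike.congr_fun (Gr.comp_mk_eq_envHom (e := e'.toAlgHom) hpb hι))

/-- For a `d`-smooth algebra `R` with `A = R_ab`, the Poisson algebra `gr_F(R)` is canonically
isomorphic to `P(A)/P^{≥ d+1}(A)`: there is exactly one isomorphism of Poisson algebras which is
compatible with the canonical maps from `A`, and it respects the gradings. Moreover
`gr^i_F(R) ≃ Q^i_A(Ω¹_A)` as `A`-modules for `i ≤ d`. -/
theorem theorem4p2p1 {R : Type u} [Ring R] [Algebra ℂ R] (d : ℕ) (hR : NCGeom.IsDSmooth d R) :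
    (∃ e : (NCGeom.Env (NCGeom.Rab R) ⧸ NCGeom.Env.ge (NCGeom.Rab R) (d + 1)) ≃ₐ[ℂ] NCGeom.Gr R,
      ((∀ x y, e (NCGeom.pb x y) = NCGeom.pb (e x) (e y)) ∧
        (∀ a : NCGeom.Rab R, e (Ideal.Quotient.mk _ (NCGeom.Env.ι (NCGeom.Rab R) a)) =
          NCGeom.Gr.ofRab R a)) ∧
      (∀ i : ℕ, (fun x => e (Ideal.Quotient.mk _ x)) ''
          (NCGeom.Env.deg (NCGeom.Rab R) i : Set (NCGeom.Env (NCGeom.Rab R))) =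
        (NCGeom.Gr.deg R i : Set (NCGeom.Gr R))) ∧
      ∀ e' : (NCGeom.Env (NCGeom.Rab R) ⧸ NCGeom.Env.ge (NCGeom.Rab R) (d + 1)) ≃ₐ[ℂ]
          NCGeom.Gr R,
        (∀ x y, e' (NCGeom.pb x y) = NCGeom.pb (e' x) (e' y)) →
        (∀ a : NCGeom.Rab R, e' (Ideal.Quotient.mk _ (NCGeom.Env.ι (NCGeom.Rab R) a)) =
          NCGeom.Gr.ofRab R a) → e' = e) ∧
    ∀ i : ℕ, i ≤ d →
      Nonempty (NCGeom.Gr.deg R i ≃ₗ[NCGeom.Rab R]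
        NCGeom.Q (NCGeom.Rab R) (Ω[NCGeom.Rab R⁄ℂ]) i) :=
  theorem4p2p1_general d hR.isFormallyDSmooth
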